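/- For real numbers $\alpha,\Delta>0$, call a finite simple graph $G=(V,E)$ $(\alpha,\Delta)$-bounded if at least $\alpha|V|$ of its vertices have degree at most $\Delta$. For all constants $\Delta,\alpha>0$ there is a constant $\varepsilon=\varepsilon_{\Delta,\alpha}\in(0,1)$ such that the chromatic number of $(\alpha,\Delta)$-bounded graphs can be computed in $O\left((2-\varepsilon)^n\right)$ time, where $n$ is the number of vertices. That is, there are a deterministic random access machine program $P$ and a constant $C$, both depending only on $\Delta$ and $\alpha$, such that for every $n\ge 0$ and every $(\alpha,\Delta)$-bounded graph $G$ on the vertex set $\{0,\dots,n-1\}$, given by $n$ and its adjacency matrix, $P$ halts on input $G$ with output $\chi(G)$ after a run of cost at most $C\,(2-\varepsilon)^n$. Here cost is logarithmic: every elementary step (copying a number, testing a register for zero, reading or writing a memory cell through its address, adding, subtracting, multiplying or dividing natural numbers) is charged one plus the bit lengths of the numbers and addresses involved, and a multiplication or division is charged in addition the product of the bit lengths of its operands. -/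

import Mathlib

namespace RAM

/-- Arithmetic operations of the machine, on natural numbers. Subtraction is truncated, division is
rounded down, and division by zero gives zero. -/
inductive Op where
  | add
  | sub
  | mul
  | div

/-- The value of an operation. -/
def Op.eval : Op → ℕ → ℕ → ℕ
  | .add, x, y => x + y
  | .sub, x, y => x - y
  | .mul, x, y => x * y
  | .div, x, y => x / y

/-- The cost of an operation, in terms of the bit lengths `Nat.size` of its operands: linear for
addition and subtraction, and the schoolbook bound for multiplication and division. -/
def Op.cost : Op → ℕ → ℕ → ℕ
  | .add, x, y => 1 + x.size + y.size
  | .sub, x, y => 1 + x.size + y.size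
  | .mul, x, y => 1 + x.size + y.size + x.size * y.size
  | .div, x, y => 1 + x.size + y.size + x.size * y.size

/-- Programs of a random access machine, with structured control flow. A program is a finite object
and refers to finitely many registers; unbounded storage is available only through indirect
addressing (`load` and `store`). -/
inductive Prog where
  /-- do nothing -/
  | skip
  /-- `r := c` -/
  | const (r c : ℕ)
  /-- `r := a` -/
  | move (r a : ℕ)
  /-- `r := a op b` -/
  | arith (o : Op) (r a b : ℕ)
  /-- `r := memory[a]` -/
  | load (r a : ℕ)
  /-- `memory[a] := b` -/
  | store (a b : ℕ)
  /-- first `p`, then `q` -/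
  | seq (p q : Prog)
  /-- if register `a` is nonzero then `p` else `q` -/
  | ite (a : ℕ) (p q : Prog)
  /-- while register `a` is nonzero do `p` -/
  | loop (a : ℕ) (p : Prog)

/-- A configuration of the machine: the contents of the registers and of the memory cells. -/
@[ext]
structure State where
  reg : ℕ → ℕ
  mem : ℕ → ℕ

/-- Write `x` into register `r`. -/
def State.setReg (s : State) (r x : ℕ) : State :=
  { s with reg := Function.update s.reg r x }

/-- Write `x` into the memory cell with address `a`. -/
def State.setMem (s : State) (a x : ℕ) : State :=
  { s with mem := Function.update s.mem a x }

/-- `Exec p s t s'`: started in configuration `s`, the program `p` halts in configuration `s'`, and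
the run has total cost exactly `t`. The cost is logarithmic: every elementary step, including every
evaluation of a branching or loop condition, costs one plus the bit lengths of the numbers (values
and memory addresses) it handles, with `Op.cost` for arithmetic. -/
inductive Exec : Prog → State → ℕ → State → Prop
  | skip (s : State) : Exec .skip s 1 s
  | const (s : State) (r c : ℕ) : Exec (.const r c) s (1 + c.size) (s.setReg r c)
  | move (s : State) (r a : ℕ) :
      Exec (.move r a) s (1 + (s.reg a).size) (s.setReg r (s.reg a))
  | arith (s : State) (o : Op) (r a b : ℕ) :
      Exec (.arith o r a b) s (o.cost (s.reg a) (s.reg b))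
        (s.setReg r (o.eval (s.reg a) (s.reg b)))
  | load (s : State) (r a : ℕ) :
      Exec (.load r a) s (1 + (s.reg a).size + (s.mem (s.reg a)).size)
        (s.setReg r (s.mem (s.reg a)))
  | store (s : State) (a b : ℕ) :
      Exec (.store a b) s (1 + (s.reg a).size + (s.reg b).size)
        (s.setMem (s.reg a) (s.reg b))
  | seq {p q : Prog} {s s' s'' : State} {t t' : ℕ} :
      Exec p s t s' → Exec q s' t' s'' → Exec (.seq p q) s (t + t') s''
  | ite_true {a : ℕ} {p q : Prog} {s s' : State} {t : ℕ} :
      s.reg a ≠ 0 → Exec p s t s' → Exec (.ite a p q) s (1 + (s.reg a).size + t) s'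
  | ite_false {a : ℕ} {p q : Prog} {s s' : State} {t : ℕ} :
      s.reg a = 0 → Exec q s t s' → Exec (.ite a p q) s (1 + (s.reg a).size + t) s'
  | loop_true {a : ℕ} {p : Prog} {s s' s'' : State} {t t' : ℕ} :
      s.reg a ≠ 0 → Exec p s t s' → Exec (.loop a p) s' t' s'' →
        Exec (.loop a p) s (1 + (s.reg a).size + t + t') s''
  | loop_false {a : ℕ} {p : Prog} {s : State} :
      s.reg a = 0 → Exec (.loop a p) s (1 + (s.reg a).size) s

/-- The machine is deterministic: a program has at most one halting run from a configuration. -/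
theorem Exec.deterministic {p : Prog} {s s₁ s₂ : State} {t₁ t₂ : ℕ}
    (h₁ : Exec p s t₁ s₁) (h₂ : Exec p s t₂ s₂) : t₁ = t₂ ∧ s₁ = s₂ := by
  induction h₁ generalizing t₂ s₂ with
  | skip | const | move | arith | load | store => cases h₂; exact ⟨rfl, rfl⟩
  | seq _ _ ih ih' =>
    cases h₂ with
    | seq k k' =>
      obtain ⟨rfl, rfl⟩ := ih k
      obtain ⟨rfl, rfl⟩ := ih' k'
      exact ⟨rfl, rfl⟩
  | ite_true h _ ih =>
    cases h₂ with
    | ite_true _ k => obtain ⟨rfl, rfl⟩ := ih k; exact ⟨rfl, rfl⟩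
    | ite_false k _ => exact absurd k h
  | ite_false h _ ih =>
    cases h₂ with
    | ite_true k _ => exact absurd h k
    | ite_false _ k => obtain ⟨rfl, rfl⟩ := ih k; exact ⟨rfl, rfl⟩
  | loop_true h _ _ ih ih' =>
    cases h₂ with
    | loop_true _ k k' =>
      obtain ⟨rfl, rfl⟩ := ih k
      obtain ⟨rfl, rfl⟩ := ih' k'
      exact ⟨rfl, rfl⟩
    | loop_false k => exact absurd k h
  | loop_false h =>
    cases h₂ with
    | loop_true k _ _ => exact absurd h k
    | loop_false _ => exact ⟨rfl, rfl⟩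

/-- The input configuration for a graph on the vertices `0, …, n - 1`: register `0` holds `n`, all
other registers hold `0`, the memory cells `0, …, n ^ 2 - 1` hold the adjacency matrix row by row,
and all other memory cells hold `0`. -/
def graphInput {n : ℕ} (G : SimpleGraph (Fin n)) [DecidableRel G.Adj] : State where
  reg r := if r = 0 then n else 0
  mem a := if ∃ i j : Fin n, a = (i : ℕ) * n + (j : ℕ) ∧ G.Adj i j then 1 else 0

/-- On input `G`, the program `p` halts, its cost is at most `T`, and on halting register `0` holds
the chromatic number of `G`. -/
def ComputesChromaticNumber (p : Prog) {n : ℕ} (G : SimpleGraph (Fin n)) [DecidableRel G.Adj]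
    (T : ℝ) : Prop :=
  ∃ (t : ℕ) (s : State), Exec p (graphInput G) t s ∧ (t : ℝ) ≤ T ∧
    G.chromaticNumber = ((s.reg 0 : ℕ) : ℕ∞)

end RAM

/-- A finite graph is `(α, Δ)`-bounded if at least `α * |V|` of its vertices have degree at most
`Δ`. -/
def SimpleGraph.IsAlphaDeltaBounded {V : Type*} [Fintype V] (G : SimpleGraph V)
    [DecidableRel G.Adj] (α Δ : ℝ) : Prop :=
  α * (Fintype.card V : ℝ) ≤ ((Finset.univ.filter fun v : V => (G.degree v : ℝ) ≤ Δ).card : ℝ)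

/-! Let `D = ⌊Δ⌋`, and call vertices of degree at most `D` low. The search rests on disjoint sets
`A` and `B` such that `A` consists of low vertices, the closed neighbourhoods N[a], a ∈ A, are
pairwise disjoint outside `B`, and |A| ≥ M|B| + n/q for suitable constants `M` and `q` (`Suitable`).
They are found in rounds (`wp_findSets`): for the current `B` pick a maximal `A` greedily, and if it
is too small, add all its closed neighbourhoods to `B`. By maximality a failed round shrinks N[y] \
B for every low vertex y that is still outside `B`, while q|B| + n grows only by a constant factor.
After `D + 1` failures no low vertex could be outside `B`, although |B| < αn.

Given a proper colouring with k + 1 colours, every a ∈ A sees at most `D` colours. By averaging,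
some colour class has a trace `T` on `B` such that the set F of all a ∈ A without a neighbour in `T`
has at least |A|/(D + 1) elements (`exists_color_class_free`). Extend the class to a largest
independent set I with I ∩ B = T. Its complement X is covered by k independent sets and contains
N[a] \ B for no a ∈ F, since otherwise a could join I (`exists_cover_of_colorableBelow`).
Conversely, any X with a cover by k independent sets and an independent complement yields k + 1
colours. So it suffices to try all T ⊆ B and, for each, all X that contain no N[a] \ B with a ∈ F.

These X form a family closed under subsets. It can therefore be listed in time proportional to its
size, up to polynomial factors, and the numbers of covers of all its members are obtained by
inclusion-exclusion inside the family (`lowCount_succ`, `coverCount_succ`). By disjointness the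
family has at most 2^n (1 - 2^{-(D+1)})^|F| members (`card_avoiding_le`). The saving is exponential
in |A|: with `M` large it pays for the 2^|B| choices of `T` and leaves a factor σ^n with σ < 1
(`two_pow_mul_length_le`).

The program is written in a small structured language. Correctness is derived by weakest
preconditions (`Cmd.wp`, `Cmd.compile_spec`). The bound `Cmd.cost` depends only on the text, the
word length and the loop limits, so up to polynomial factors the running time is read off from the
nesting of the loops (`dom_cost`). -/

namespace RAM

/-! ### Expressions and their translation to the machine. -/

/-- Arithmetic expressions over natural number variables and eight arrays. -/
inductive Expr where
  | var (x : ℕ)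
  | const (c : ℕ)
  | op (o : Op) (a b : Expr)
  | get (j : Fin 8) (e : Expr)

/-- An environment: the values of the variables and of the arrays. -/
structure Env where
  var : ℕ → ℕ
  arr : Fin 8 → ℕ → ℕ

namespace Env

/-- Assign a value to a variable. -/
def setVar (s : Env) (x a : ℕ) : Env :=
  { s with var := fun y => if y = x then a else s.var y }

/-- Assign a value to an array entry. -/
def setArr (s : Env) (j : Fin 8) (i a : ℕ) : Env :=
  { s with arr := fun j' i' => if j' = j ∧ i' = i then a else s.arr j' i' }

@[simp] theorem setVar_var (s : Env) (x a y : ℕ) :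
    (s.setVar x a).var y = if y = x then a else s.var y := rfl

@[simp] theorem setVar_arr (s : Env) (x a : ℕ) : (s.setVar x a).arr = s.arr := rfl

@[simp] theorem setArr_var (s : Env) (j : Fin 8) (i a : ℕ) : (s.setArr j i a).var = s.var := rfl

@[simp] theorem setArr_arr (s : Env) (j : Fin 8) (i a : ℕ) (j' : Fin 8) (i' : ℕ) :
    (s.setArr j i a).arr j' i' = if j' = j ∧ i' = i then a else s.arr j' i' := rfl

end Env

namespace Expr

instance : Add Expr := ⟨op .add⟩
instance : Sub Expr := ⟨op .sub⟩
instance : Mul Expr := ⟨op .mul⟩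
instance : Div Expr := ⟨op .div⟩

/-- The value of an expression in an environment. -/
def eval (s : Env) : Expr → ℕ
  | var x => s.var x
  | const c => c
  | op o a b => o.eval (a.eval s) (b.eval s)
  | get j e => s.arr j (e.eval s)

@[simp] theorem eval_var (s : Env) (x : ℕ) : (var x).eval s = s.var x := rfl
@[simp] theorem eval_const (s : Env) (c : ℕ) : (const c).eval s = c := rfl
@[simp] theorem eval_get (s : Env) (j : Fin 8) (e : Expr) :
    (get j e).eval s = s.arr j (e.eval s) := rfl
@[simp] theorem eval_add (s : Env) (a b : Expr) : (a + b).eval s = a.eval s + b.eval s := rfl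
@[simp] theorem eval_sub (s : Env) (a b : Expr) : (a - b).eval s = a.eval s - b.eval s := rfl
@[simp] theorem eval_mul (s : Env) (a b : Expr) : (a * b).eval s = a.eval s * b.eval s := rfl
@[simp] theorem eval_div (s : Env) (a b : Expr) : (a / b).eval s = a.eval s / b.eval s := rfl

/-- A bound for the bit length of the value of an expression, when all variables and array entries
have at most `w` bits. -/
def bits (w : ℕ) : Expr → ℕ
  | var _ => w
  | const c => c.size
  | op _ a b => a.bits w + b.bits w + 1
  | get _ _ => w

end Expr

/-- The cost of computing the address of an array entry from an index of at most `b` bits. -/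
def addrCost (w b : ℕ) : ℕ := 5 + (1 + b) * 5 + 5 + (b + 6) * 5 + (b + 11) * (1 + w)

namespace Expr

/-- A bound for the cost of evaluating an expression. -/
def cost (w : ℕ) : Expr → ℕ
  | var _ => 1 + w
  | const c => 1 + c.size
  | op _ a b => a.cost w + (b.cost w + (1 + a.bits w) * (1 + b.bits w))
  | get _ e => e.cost w + (addrCost w (e.bits w) + (1 + (e.bits w + w + 11) + w))

end Expr

/-- The temporary registers used in the evaluation of expressions. -/
def tmp (d : ℕ) : ℕ := 2 * d + 3

/-- Turn the index in register `tmp d` into the address of the entry of array `j`. -/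
def addrProg (j : Fin 8) (d : ℕ) : Prog :=
  .seq (.const (tmp (d + 1)) 8) (.seq (.arith .mul (tmp d) (tmp d) (tmp (d + 1)))
    (.seq (.const (tmp (d + 1)) j) (.seq (.arith .add (tmp d) (tmp d) (tmp (d + 1)))
      (.arith .add (tmp d) (tmp d) 1))))

/-- Evaluate an expression into the register `tmp d`. -/
def Expr.compile : Expr → ℕ → Prog
  | .var x, d => .move (tmp d) (2 * x)
  | .const c, d => .const (tmp d) c
  | .op o a b, d => .seq (a.compile d) (.seq (b.compile (d + 1))
      (.arith o (tmp d) (tmp d) (tmp (d + 1))))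
  | .get j e, d => .seq (e.compile d) (.seq (addrProg j d) (.load (tmp d) (tmp d)))

/-- The parameters of a computation: the read-only input, its length, a bound for the bit lengths of
all variables and array entries, and bounds for the limits of loops. -/
structure Ctx where
  inp : ℕ → ℕ
  base : ℕ
  w : ℕ
  bound : ℕ → ℕ
  base_lt : base < 2 ^ w
  inp_lt : ∀ i, inp i < 2 ^ w

/-- The machine state `σ` represents the environment `s`. -/
structure Rel (C : Ctx) (s : Env) (σ : State) : Prop where
  base : σ.reg 1 = C.base
  var : ∀ x, σ.reg (2 * x) = s.var x
  inp : ∀ i < C.base, σ.mem i = C.inp i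
  arr : ∀ (j : Fin 8) i, σ.mem (C.base + (8 * i + j)) = s.arr j i
  var_lt : ∀ x, s.var x < 2 ^ C.w
  arr_lt : ∀ j i, s.arr j i < 2 ^ C.w

theorem size_add_le (x y : ℕ) : (x + y).size ≤ x.size + y.size + 1 := by
  rw [Nat.size_le]
  have hx := Nat.lt_size_self x
  have hy := Nat.lt_size_self y
  have h1 : 2 ^ x.size ≤ 2 ^ (x.size + y.size) := Nat.pow_le_pow_right (by norm_num) (by omega)
  have h2 : 2 ^ y.size ≤ 2 ^ (x.size + y.size) := Nat.pow_le_pow_right (by norm_num) (by omega)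
  rw [pow_succ]
  omega

theorem size_mul_le (x y : ℕ) : (x * y).size ≤ x.size + y.size := by
  rw [Nat.size_le, pow_add]
  exact Nat.mul_lt_mul'' (Nat.lt_size_self x) (Nat.lt_size_self y)

theorem Op.size_eval_le (o : Op) (x y : ℕ) : (o.eval x y).size ≤ x.size + y.size + 1 := by
  cases o with
  | add => exact size_add_le x y
  | sub => exact (Nat.size_le_size (Nat.sub_le x y)).trans (by omega)
  | mul => exact (size_mul_le x y).trans (by omega)
  | div => exact (Nat.size_le_size (Nat.div_le_self x y)).trans (by omega)

/-- The product expands to the schoolbook bound for multiplication, so one formula serves all four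
operations. -/
theorem Op.cost_le (o : Op) {x y a b : ℕ} (hx : x.size ≤ a) (hy : y.size ≤ b) :
    o.cost x y ≤ (1 + a) * (1 + b) := by
  refine le_trans ?_ (Nat.mul_le_mul (Nat.add_le_add_left hx 1) (Nat.add_le_add_left hy 1))
  cases o <;> simp only [Op.cost] <;> ring_nf <;> omega

theorem Rel.bits_le {C : Ctx} {s : Env} {σ : State} (h : Rel C s σ) (e : Expr) :
    (e.eval s).size ≤ e.bits C.w := by
  induction e with
  | var x => exact Nat.size_le.2 (h.var_lt x)
  | const c => exact le_rfl
  | op o a b iha ihb =>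
    have := o.size_eval_le (a.eval s) (b.eval s)
    simp only [Expr.eval, Expr.bits]
    omega
  | get j e ih => exact Nat.size_le.2 (h.arr_lt _ _)

/-- Agreement of two machine states except on temporary registers from `tmp d` on. -/
structure SameUpTo (d : ℕ) (σ σ' : State) : Prop where
  reg : ∀ r, (r < tmp d ∨ Even r) → σ'.reg r = σ.reg r
  mem : σ'.mem = σ.mem

theorem SameUpTo.refl (d : ℕ) (σ : State) : SameUpTo d σ σ := ⟨fun _ _ => rfl, rfl⟩

theorem SameUpTo.trans {d : ℕ} {σ σ' σ'' : State} (h : SameUpTo d σ σ') (h' : SameUpTo d σ' σ'') :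
    SameUpTo d σ σ'' :=
  ⟨fun r hr => (h'.reg r hr).trans (h.reg r hr), h'.mem.trans h.mem⟩

theorem SameUpTo.mono {d d' : ℕ} {σ σ' : State} (hd : d' ≤ d) (h : SameUpTo d σ σ') :
    SameUpTo d' σ σ' :=
  ⟨fun r hr => h.reg r (hr.imp_left fun h => by simp only [tmp] at *; omega), h.mem⟩

theorem SameUpTo.setReg {d d' : ℕ} {σ σ' : State} (h : SameUpTo d σ σ') (hd : d ≤ d') (a : ℕ) :
    SameUpTo d σ (σ'.setReg (tmp d') a) := by
  refine ⟨fun r hr => ?_, h.mem⟩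
  have hne : r ≠ tmp d' := by
    rcases hr with hr | ⟨m, hm⟩ <;> simp only [tmp] at * <;> omega
  simp [State.setReg, Function.update_of_ne hne, h.reg r hr]

theorem SameUpTo.rel {C : Ctx} {s : Env} {d : ℕ} {σ σ' : State} (h : SameUpTo d σ σ')
    (hr : Rel C s σ) : Rel C s σ' where
  base := by rw [h.reg 1 (by simp only [tmp]; omega), hr.base]
  var x := by rw [h.reg _ (by simp), hr.var]
  inp i hi := by rw [h.mem, hr.inp i hi]
  arr j i := by rw [h.mem, hr.arr]
  var_lt := hr.var_lt
  arr_lt := hr.arr_lt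

theorem tmp_succ_ne (d : ℕ) : tmp d ≠ tmp (d + 1) := by simp [tmp]

/-- The eight arrays are interleaved above the input. Hence each of them is unbounded and no two
entries share a cell. -/
theorem addrProg_spec {C : Ctx} {s : Env} {σ : State} (hr : Rel C s σ) (j : Fin 8) {d i b : ℕ}
    (hi : σ.reg (tmp d) = i) (hb : i.size ≤ b) :
    ∃ T σ', Exec (addrProg j d) σ T σ' ∧ T ≤ addrCost C.w b ∧
      σ'.reg (tmp d) = C.base + (8 * i + j) ∧ SameUpTo d σ σ' := by
  have hj : (j : ℕ).size ≤ 4 := Nat.size_le.2 (by omega)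
  have h8 : Nat.size 8 = 4 := by decide
  have hmul : (i * 8).size ≤ b + 4 := (size_mul_le _ _).trans (by omega)
  have hadd : (i * 8 + j).size ≤ b + 9 := (size_add_le _ _).trans (by omega)
  have hbase : C.base.size ≤ C.w := Nat.size_le.2 C.base_lt
  have hne := tmp_succ_ne d
  have h1 : (1 : ℕ) ≠ tmp d := by simp [tmp]
  have h1' : (1 : ℕ) ≠ tmp (d + 1) := by simp [tmp]
  refine ⟨_, _, .seq (.const _ _ _) (.seq (.arith _ _ _ _ _) (.seq (.const _ _ _)
    (.seq (.arith _ _ _ _ _) (.arith _ _ _ _ _)))), ?_, ?_, ?_⟩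
  · simp only [State.setReg, Function.update_self, Function.update_of_ne hne,
      Function.update_of_ne h1, Function.update_of_ne h1', hi,
      hr.base, Op.eval, addrCost, h8]
    have c1 := Op.cost_le .mul hb h8.le
    have c2 := Op.cost_le .add hmul hj
    have c3 := Op.cost_le .add hadd hbase
    have e2 : (1 + (b + 4)) * (1 + 4) ≤ (b + 6) * 5 := by omega
    have e3 : (1 + (b + 9)) * (1 + C.w) ≤ (b + 11) * (1 + C.w) :=
      Nat.mul_le_mul_right _ (by omega)
    omega
  · simp only [State.setReg, Function.update_self, Function.update_of_ne hne,
      Function.update_of_ne h1, Function.update_of_ne h1', hi,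
      hr.base, Op.eval]
    ring
  · exact (((((SameUpTo.refl d σ).setReg (by omega) _).setReg le_rfl _).setReg (by omega) _).setReg
      le_rfl _).setReg le_rfl _

theorem addr_size_le {C : Ctx} (j : Fin 8) {i b : ℕ} (hb : i.size ≤ b) :
    (C.base + (8 * i + j)).size ≤ b + C.w + 11 := by
  have hj : (j : ℕ).size ≤ 4 := Nat.size_le.2 (by omega)
  have h8 : Nat.size 8 = 4 := by decide
  have hmul : (8 * i).size ≤ b + 4 := (size_mul_le _ _).trans (by omega)
  have hadd : (8 * i + j).size ≤ b + 9 := (size_add_le _ _).trans (by omega)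
  have hbase : C.base.size ≤ C.w := Nat.size_le.2 C.base_lt
  exact (size_add_le _ _).trans (by omega)

theorem Expr.compile_spec {C : Ctx} {s : Env} (e : Expr) (d : ℕ) {σ : State} (hr : Rel C s σ) :
    ∃ T σ', Exec (e.compile d) σ T σ' ∧ T ≤ e.cost C.w ∧ σ'.reg (tmp d) = e.eval s ∧
      SameUpTo d σ σ' := by
  induction e generalizing d σ with
  | var x =>
    refine ⟨_, _, .move _ _ _, ?_, ?_, (SameUpTo.refl d σ).setReg le_rfl _⟩
    · rw [hr.var]
      exact Nat.add_le_add_left (Nat.size_le.2 (hr.var_lt x)) 1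
    · simp [State.setReg, hr.var]
  | const c =>
    exact ⟨_, _, .const _ _ _, le_rfl, by simp [State.setReg],
      (SameUpTo.refl d σ).setReg le_rfl _⟩
  | op o a b iha ihb =>
    obtain ⟨T, σ₁, h₁, hT, hv, hs⟩ := iha d hr
    obtain ⟨T', σ₂, h₂, hT', hv', hs'⟩ := ihb (d + 1) (hs.rel hr)
    -- The second operand uses temporaries from `tmp (d + 1)` on only, so the first value survives.
    have hv₂ : σ₂.reg (tmp d) = a.eval s := by
      rw [hs'.reg _ (by simp [tmp]), hv]
    refine ⟨_, _, .seq h₁ (.seq h₂ (.arith _ _ _ _ _)), ?_, ?_, ?_⟩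
    · have := o.cost_le (hr.bits_le a) (hr.bits_le b)
      simp only [Expr.cost, hv₂, hv']
      omega
    · simp [State.setReg, hv₂, hv', Expr.eval]
    · exact (hs.trans (hs'.mono (by omega))).setReg le_rfl _
  | get j e ih =>
    obtain ⟨T, σ₁, h₁, hT, hv, hs⟩ := ih d hr
    obtain ⟨T', σ₂, h₂, hT', hv', hs'⟩ := addrProg_spec (hs.rel hr) j hv (hr.bits_le e)
    have hr₂ := hs'.rel (hs.rel hr)
    refine ⟨_, _, .seq h₁ (.seq h₂ (.load _ _ _)), ?_, ?_, ?_⟩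
    · have := addr_size_le (C := C) j (hr.bits_le e)
      have h3 := Nat.size_le.2 (hr.arr_lt j (e.eval s))
      simp only [Expr.cost, hv', hr₂.arr]
      omega
    · simp [State.setReg, hv', hr₂.arr, Expr.eval]
    · exact (hs.trans hs').setReg le_rfl _

/-! ### Structured commands, weakest preconditions and cost. -/

/-- Structured commands. A `loop x y c` runs `c` with `x = 0, 1, …, y - 1`. -/
inductive Cmd where
  | skip
  | assign (x : ℕ) (e : Expr)
  | put (j : Fin 8) (i e : Expr)
  | input (x : ℕ) (e : Expr)
  | seq (c d : Cmd)
  | ite (e : Expr) (c d : Cmd)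
  | loop (x y : ℕ) (c : Cmd)

namespace Cmd

/-- Translation into programs of the machine. -/
def compile : Cmd → Prog
  | skip => .skip
  | assign x e => .seq (e.compile 0) (.move (2 * x) (tmp 0))
  | put j i e => .seq (e.compile 0) (.seq (i.compile 1) (.seq (addrProg j 1)
      (.store (tmp 1) (tmp 0))))
  | input x e => .seq (e.compile 0) (.load (2 * x) (tmp 0))
  | seq c d => .seq c.compile d.compile
  | ite e c d => .seq (e.compile 0) (.ite (tmp 0) c.compile d.compile)
  | loop x y c => .seq (.const (2 * x) 0) (.seq (.arith .sub (tmp 0) (2 * y) (2 * x))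
      (.loop (tmp 0) (.seq c.compile (.seq (.const (tmp 0) 1)
        (.seq (.arith .add (2 * x) (2 * x) (tmp 0)) (.arith .sub (tmp 0) (2 * y) (2 * x)))))))

/-- A bound for the cost of a command, where `β y` bounds the limit `y` of a loop. -/
def cost (w : ℕ) (β : ℕ → ℕ) : Cmd → ℕ
  | skip => 1
  | assign _ e => e.cost w + (1 + w)
  | put _ i e => e.cost w + (i.cost w + (addrCost w (i.bits w) + (1 + (i.bits w + w + 11) + w)))
  | input _ e => e.cost w + (1 + e.bits w + w)
  | seq c d => c.cost w β + d.cost w β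
  | ite e c d => e.cost w + (1 + e.bits w + (c.cost w β + d.cost w β))
  | loop _ y c => 1 + ((1 + w) * (1 + w) +
      (β y * (1 + w + (c.cost w β + (2 + ((1 + w) * 2 + (1 + w) * (1 + w))))) + 1))

/-- The variables that a command may change. -/
def modVar : Cmd → List ℕ
  | skip => []
  | assign x _ => [x]
  | put _ _ _ => []
  | input x _ => [x]
  | seq c d => c.modVar ++ d.modVar
  | ite _ c d => c.modVar ++ d.modVar
  | loop x _ c => x :: c.modVar

/-- The arrays that a command may change. -/
def modArr : Cmd → List (Fin 8)
  | skip => []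
  | assign _ _ => []
  | put j _ _ => [j]
  | input _ _ => []
  | seq c d => c.modArr ++ d.modArr
  | ite _ c d => c.modArr ++ d.modArr
  | loop _ _ c => c.modArr

/-- The weakest precondition for a run in which all values are bounded as demanded by `C`. -/
def wp (C : Ctx) : Cmd → (Env → Prop) → Env → Prop
  | skip, Q, s => Q s
  | assign x e, Q, s => e.eval s < 2 ^ C.w ∧ Q (s.setVar x (e.eval s))
  | put j i e, Q, s => e.eval s < 2 ^ C.w ∧ Q (s.setArr j (i.eval s) (e.eval s))
  | input x e, Q, s => e.eval s < C.base ∧ Q (s.setVar x (C.inp (e.eval s)))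
  | seq c d, Q, s => wp C c (wp C d Q) s
  | ite e c d, Q, s => (e.eval s ≠ 0 → wp C c Q s) ∧ (e.eval s = 0 → wp C d Q s)
  | loop x y c, Q, s => x ≠ y ∧ s.var y ≤ C.bound y ∧ ∃ I : ℕ → Env → Prop,
      I 0 (s.setVar x 0) ∧
      (∀ i < s.var y, ∀ s', s'.var x = i → s'.var y = s.var y → I i s' →
        wp C c (fun t => t.var x = i ∧ t.var y = s.var y ∧ I (i + 1) (t.setVar x (i + 1))) s') ∧
      ∀ s', s'.var x = s.var y → I (s.var y) s' → Q s'

/-- Agreement of two environments outside given variables and arrays. -/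
structure Agree (vs : List ℕ) (as : List (Fin 8)) (s s' : Env) : Prop where
  var : ∀ x, x ∉ vs → s'.var x = s.var x
  arr : ∀ j, j ∉ as → s'.arr j = s.arr j

theorem Agree.refl (vs : List ℕ) (as : List (Fin 8)) (s : Env) : Agree vs as s s :=
  ⟨fun _ _ => rfl, fun _ _ => rfl⟩

theorem Agree.trans {vs : List ℕ} {as : List (Fin 8)} {s s' s'' : Env} (h : Agree vs as s s')
    (h' : Agree vs as s' s'') : Agree vs as s s'' :=
  ⟨fun x hx => (h'.var x hx).trans (h.var x hx), fun j hj => (h'.arr j hj).trans (h.arr j hj)⟩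

theorem Agree.mono {vs vs' : List ℕ} {as as' : List (Fin 8)} {s s' : Env} (h : Agree vs as s s')
    (hv : vs ⊆ vs') (ha : as ⊆ as') : Agree vs' as' s s' :=
  ⟨fun x hx => h.var x fun h => hx (hv h), fun j hj => h.arr j fun h => hj (ha h)⟩

theorem wp_seq {C : Ctx} {c d : Cmd} {Q : Env → Prop} {s : Env} (h : wp C c (wp C d Q) s) :
    wp C (seq c d) Q s := h

theorem wp_mono {C : Ctx} {c : Cmd} {Q Q' : Env → Prop} {s : Env} (h : wp C c Q s)
    (hQ : ∀ s', Q s' → Q' s') : wp C c Q' s := by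
  induction c generalizing Q Q' s with
  | skip => exact hQ _ h
  | assign x e => exact ⟨h.1, hQ _ h.2⟩
  | put j i e => exact ⟨h.1, hQ _ h.2⟩
  | input x e => exact ⟨h.1, hQ _ h.2⟩
  | seq c d ihc ihd => exact ihc h fun s' hs' => ihd hs' hQ
  | ite e c d ihc ihd => exact ⟨fun he => ihc (h.1 he) hQ, fun he => ihd (h.2 he) hQ⟩
  | loop x y c ih =>
    obtain ⟨hxy, hb, I, h0, hs, hq⟩ := h
    exact ⟨hxy, hb, I, h0, hs, fun s' hx hI => hQ _ (hq s' hx hI)⟩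

/-- A command changes only what its text assigns to. With this added to the postcondition,
specifications need to mention only what a command produces. -/
theorem wp_frame {C : Ctx} {c : Cmd} {Q : Env → Prop} {s : Env} (h : wp C c Q s) :
    wp C c (fun s' => Agree c.modVar c.modArr s s' ∧ Q s') s := by
  induction c generalizing Q s with
  | skip => exact ⟨Agree.refl _ _ _, h⟩
  | assign x e =>
    exact ⟨h.1, ⟨fun y hy => by simp_all [modVar], fun j _ => rfl⟩, h.2⟩
  | put j i e =>
    exact ⟨h.1, ⟨fun y _ => rfl, fun j' hj => by funext i'; simp_all [modArr]⟩, h.2⟩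
  | input x e =>
    exact ⟨h.1, ⟨fun y hy => by simp_all [modVar], fun j _ => rfl⟩, h.2⟩
  | seq c d ihc ihd =>
    refine wp_seq (wp_mono (ihc h) fun s' hs' => wp_mono (ihd hs'.2) fun s'' hs'' => ⟨?_, hs''.2⟩)
    exact (hs'.1.mono (by simp [modVar]) (by simp [modArr])).trans
      (hs''.1.mono (by simp [modVar]) (by simp [modArr]))
  | ite e c d ihc ihd =>
    exact ⟨fun he => wp_mono (ihc (h.1 he)) fun s' hs' =>
        ⟨hs'.1.mono (by simp [modVar]) (by simp [modArr]), hs'.2⟩,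
      fun he => wp_mono (ihd (h.2 he)) fun s' hs' =>
        ⟨hs'.1.mono (by simp [modVar]) (by simp [modArr]), hs'.2⟩⟩
  | loop x y c ih =>
    obtain ⟨hxy, hb, I, h0, hs, hq⟩ := h
    have hset : ∀ (t : Env) a, Agree (loop x y c).modVar (loop x y c).modArr t (t.setVar x a) :=
      fun t a => ⟨fun z hz => by simp_all [modVar], fun j _ => rfl⟩
    refine ⟨hxy, hb, fun i s' => Agree (loop x y c).modVar (loop x y c).modArr s s' ∧ I i s',
      ⟨hset s 0, h0⟩, fun i hi s' hx hy hI => ?_, fun s' hx hI => ⟨hI.1, hq s' hx hI.2⟩⟩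
    refine wp_mono (ih (hs i hi s' hx hy hI.2)) fun t ht => ⟨ht.2.1, ht.2.2.1, ?_, ht.2.2.2⟩
    exact (hI.1.trans (ht.1.mono (by simp [modVar]) (by simp [modArr]))).trans (hset _ _)

/-- The rule for loops, with framing. -/
theorem wp_loop {C : Ctx} {x y : ℕ} {c : Cmd} {Q : Env → Prop} {s : Env} (N : ℕ)
    (hN : s.var y = N) (hb : N ≤ C.bound y) (hxy : x ≠ y) (hx : x ∉ c.modVar) (hy : y ∉ c.modVar)
    (I : ℕ → Env → Prop) (h0 : I 0 (s.setVar x 0))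
    (hs : ∀ i < N, ∀ s', Agree (loop x y c).modVar c.modArr s s' → s'.var x = i → I i s' →
      wp C c (fun t => Agree (loop x y c).modVar c.modArr s t → t.var x = i →
        I (i + 1) (t.setVar x (i + 1))) s')
    (hQ : ∀ s', Agree (loop x y c).modVar c.modArr s s' → s'.var x = N → I N s' → Q s') :
    wp C (loop x y c) Q s := by
  have hset : ∀ (t : Env) a, Agree (loop x y c).modVar c.modArr t (t.setVar x a) :=
    fun t a => ⟨fun z hz => by simp_all [modVar], fun j _ => rfl⟩
  subst hN
  refine ⟨hxy, hb, fun i s' => Agree (loop x y c).modVar c.modArr s s' ∧ I i s',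
    ⟨hset s 0, h0⟩, fun i hi s' hx' hy' hI => ?_, fun s' hx' hI => hQ s' hI.1 hx' hI.2⟩
  refine wp_mono (wp_frame (hs i hi s' hI.1 hx' hI.2)) fun t ht => ?_
  have hA : Agree (loop x y c).modVar c.modArr s t :=
    hI.1.trans (ht.1.mono (by simp [modVar]) (by simp))
  have htx : t.var x = i := (ht.1.var x hx).trans hx'
  exact ⟨htx, (ht.1.var y hy).trans hy', hA.trans (hset _ _), ht.2 hA htx⟩

theorem rel_setVar {C : Ctx} {s : Env} {σ : State} (h : Rel C s σ) {x a : ℕ} (ha : a < 2 ^ C.w) :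
    Rel C (s.setVar x a) (σ.setReg (2 * x) a) where
  base := by
    have : (1 : ℕ) ≠ 2 * x := by omega
    simp [State.setReg, Function.update_of_ne this, h.base]
  var y := by
    by_cases hy : y = x
    · simp [State.setReg, hy]
    · have : 2 * y ≠ 2 * x := by omega
      simp [State.setReg, h.var, hy]
  inp i hi := h.inp i hi
  arr j i := h.arr j i
  var_lt y := by
    rw [Env.setVar_var]
    split_ifs
    exacts [ha, h.var_lt y]
  arr_lt := h.arr_lt

theorem rel_setArr {C : Ctx} {s : Env} {σ : State} (h : Rel C s σ) {j : Fin 8} {i a : ℕ}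
    (ha : a < 2 ^ C.w) : Rel C (s.setArr j i a) (σ.setMem (C.base + (8 * i + j)) a) where
  base := h.base
  var := h.var
  inp k hk := by
    have : k ≠ C.base + (8 * i + j) := by omega
    simp [State.setMem, Function.update_of_ne this, h.inp k hk]
  arr j' i' := by
    by_cases hj : j' = j ∧ i' = i
    · obtain ⟨rfl, rfl⟩ := hj
      simp [State.setMem]
    -- An address determines array and index, as remainder and quotient by 8.
    · have : C.base + (8 * i' + j') ≠ C.base + (8 * i + j) := by
        intro he
        exact hj ⟨Fin.ext (by omega), by omega⟩
      simp [State.setMem, Function.update_of_ne this, h.arr, hj]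
  var_lt := h.var_lt
  arr_lt j' i' := by
    rw [Env.setArr_arr]
    split_ifs
    exacts [ha, h.arr_lt j' i']

/-- The cost bound does not involve the environment. Every round of a loop therefore has the same
bound, and a loop costs at most its limit times that. -/
theorem compile_spec {C : Ctx} (c : Cmd) {Q : Env → Prop} {s : Env} {σ : State}
    (h : wp C c Q s) (hr : Rel C s σ) :
    ∃ T σ' s', Exec c.compile σ T σ' ∧ T ≤ c.cost C.w C.bound ∧ Rel C s' σ' ∧ Q s' := by
  induction c generalizing Q s σ with
  | skip => exact ⟨_, _, s, .skip _, le_rfl, hr, h⟩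
  | assign x e =>
    obtain ⟨T, σ₁, h₁, hT, hv, hs⟩ := e.compile_spec 0 hr
    refine ⟨_, _, _, .seq h₁ (.move _ _ _), ?_, ?_, h.2⟩
    · have := Nat.size_le.2 h.1
      simp only [hv, cost]
      omega
    · rw [hv]
      exact rel_setVar (hs.rel hr) h.1
  | put j i e =>
    obtain ⟨T, σ₁, h₁, hT, hv, hs⟩ := e.compile_spec 0 hr
    have hr₁ := hs.rel hr
    obtain ⟨T', σ₂, h₂, hT', hv', hs'⟩ := i.compile_spec 1 hr₁
    have hr₂ := hs'.rel hr₁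
    obtain ⟨T'', σ₃, h₃, hT'', hv'', hs''⟩ := addrProg_spec hr₂ j hv' (hr.bits_le i)
    have hr₃ := hs''.rel hr₂
    have hv₃ : σ₃.reg (tmp 0) = e.eval s := by
      rw [hs''.reg _ (by simp [tmp]), hs'.reg _ (by simp [tmp]), hv]
    refine ⟨_, _, _, .seq h₁ (.seq h₂ (.seq h₃ (.store _ _ _))), ?_, ?_, h.2⟩
    · have h1 := Nat.size_le.2 h.1
      have h2 := addr_size_le (C := C) j (hr.bits_le i)
      simp only [hv₃, hv'', cost]
      omega
    · rw [hv'', hv₃]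
      exact rel_setArr hr₃ h.1
  | input x e =>
    obtain ⟨T, σ₁, h₁, hT, hv, hs⟩ := e.compile_spec 0 hr
    have hr₁ := hs.rel hr
    refine ⟨_, _, _, .seq h₁ (.load _ _ _), ?_, ?_, h.2⟩
    · have h1 := Nat.size_le.2 (C.inp_lt (e.eval s))
      have h2 := hr.bits_le e
      simp only [hv, cost, hr₁.inp _ h.1]
      omega
    · rw [hv, hr₁.inp _ h.1]
      exact rel_setVar hr₁ (C.inp_lt _)
  | seq c d ihc ihd =>
    obtain ⟨T, σ₁, s₁, h₁, hT, hr₁, hQ₁⟩ := ihc h hr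
    obtain ⟨T', σ₂, s₂, h₂, hT', hr₂, hQ₂⟩ := ihd hQ₁ hr₁
    exact ⟨_, _, _, .seq h₁ h₂, Nat.add_le_add hT hT', hr₂, hQ₂⟩
  | ite e c d ihc ihd =>
    obtain ⟨T, σ₁, h₁, hT, hv, hs⟩ := e.compile_spec 0 hr
    have hr₁ := hs.rel hr
    have hb := hr.bits_le e
    by_cases he : e.eval s = 0
    · obtain ⟨T', σ₂, s₂, h₂, hT', hr₂, hQ₂⟩ := ihd (h.2 he) hr₁
      refine ⟨_, _, _, .seq h₁ (.ite_false (hv.trans he) h₂), ?_, hr₂, hQ₂⟩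
      simp only [hv, cost]
      omega
    · obtain ⟨T', σ₂, s₂, h₂, hT', hr₂, hQ₂⟩ := ihc (h.1 he) hr₁
      refine ⟨_, _, _, .seq h₁ (.ite_true (by rwa [hv]) h₂), ?_, hr₂, hQ₂⟩
      simp only [hv, cost]
      omega
  | loop x y c ih =>
    obtain ⟨hxy, hb, I, h0, hs, hq⟩ := h
    have hsub : ∀ (s' : Env) (σ' : State), Rel C s' σ' →
        Op.sub.cost (σ'.reg (2 * y)) (σ'.reg (2 * x)) ≤ (1 + C.w) * (1 + C.w) := by
      intro s' σ' hr'
      rw [hr'.var, hr'.var]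
      exact Op.cost_le _ (Nat.size_le.2 (hr'.var_lt _)) (Nat.size_le.2 (hr'.var_lt _))
    -- Induction on the number `k` of rounds left, which is the content of `tmp 0` whenever the loop
    -- condition is tested.
    have main : ∀ k i, i + k = s.var y → ∀ s' σ', Rel C s' σ' → s'.var x = i →
        s'.var y = s.var y → I i s' → σ'.reg (tmp 0) = k →
        ∃ T σ'' s'', Exec (.loop (tmp 0) (.seq c.compile (.seq (.const (tmp 0) 1)
          (.seq (.arith .add (2 * x) (2 * x) (tmp 0)) (.arith .sub (tmp 0) (2 * y) (2 * x))))))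
          σ' T σ'' ∧ T ≤ k * (1 + C.w + (c.cost C.w C.bound +
            (2 + ((1 + C.w) * 2 + (1 + C.w) * (1 + C.w))))) + 1 ∧ Rel C s'' σ'' ∧ Q s'' := by
      intro k
      induction k with
      | zero =>
        intro i hi s' σ' hr' hx hy hI hk
        refine ⟨_, _, s', .loop_false hk, by simp [hk], hr', ?_⟩
        obtain rfl : i = s.var y := by omega
        exact hq s' hx hI
      | succ k ihk =>
        intro i hi s' σ' hr' hx hy hI hk
        obtain ⟨T, σ₁, s₁, h₁, hT, hr₁, hx₁, hy₁, hI₁⟩ := ih (hs i (by omega) s' hx hy hI) hr'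
        -- The new counter is at most the limit, which is itself a variable of at most `C.w` bits.
        have hlt : i + 1 < 2 ^ C.w := lt_of_le_of_lt (by omega) (hr₁.var_lt y)
        set σ₂ := σ₁.setReg (tmp 0) 1
        have hS₂ : SameUpTo 0 σ₁ σ₂ := (SameUpTo.refl 0 σ₁).setReg le_rfl 1
        have hr₂ := hS₂.rel hr₁
        have hv₂ : σ₂.reg (tmp 0) = 1 := by simp [σ₂, State.setReg]
        have hx₂ : σ₂.reg (2 * x) = i := by rw [hr₂.var, hx₁]
        have hr₃ := rel_setVar (x := x) hr₂ hlt
        set σ₃ := σ₂.setReg (2 * x) (i + 1)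
        have hy₃ : σ₃.reg (2 * y) = s.var y := by
          rw [hr₃.var, Env.setVar_var, if_neg hxy.symm, hy₁]
        have hx₃ : σ₃.reg (2 * x) = i + 1 := by simp [σ₃, State.setReg]
        set σ₄ := σ₃.setReg (tmp 0) (s.var y - (i + 1))
        have hS₄ : SameUpTo 0 σ₃ σ₄ := (SameUpTo.refl 0 σ₃).setReg le_rfl _
        have hr₄ := hS₄.rel hr₃
        obtain ⟨T', σ₅, s₅, h₅, hT', hr₅, hQ₅⟩ := ihk (i + 1) (by omega) _ σ₄ hr₄ (by simp)
          (by simp [hxy.symm, hy₁]) hI₁ (by simp only [σ₄, State.setReg, Function.update_self]; omega)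
        have e3 : Exec (.arith .add (2 * x) (2 * x) (tmp 0)) σ₂ (Op.add.cost i 1) σ₃ := by
          have := Exec.arith σ₂ .add (2 * x) (2 * x) (tmp 0)
          rwa [hx₂, hv₂] at this
        have e4 : Exec (.arith .sub (tmp 0) (2 * y) (2 * x)) σ₃ (Op.sub.cost (s.var y) (i + 1))
            σ₄ := by
          have := Exec.arith σ₃ .sub (tmp 0) (2 * y) (2 * x)
          rwa [hx₃, hy₃] at this
        refine ⟨_, _, _, .loop_true (by omega) (.seq h₁ (.seq (.const _ _ _) (.seq e3 e4))) h₅, ?_,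
          hr₅, hQ₅⟩
        have c1 : (σ'.reg (tmp 0)).size ≤ C.w := by
          rw [hk]
          exact Nat.size_le.2 (lt_of_le_of_lt (by omega) (hr₁.var_lt y))
        have c3 : Op.add.cost i 1 ≤ (1 + C.w) * 2 :=
          Op.cost_le .add (b := 1) (Nat.size_le.2 (by omega)) (by simp)
        have c4 := hsub _ _ hr₃
        rw [hy₃, hx₃] at c4
        have c2 : Nat.size 1 = 1 := Nat.size_one
        rw [c2, Nat.add_one_mul]
        omega
    have h2 : (0 : ℕ) < 2 ^ C.w := by positivity
    have hr₁ := rel_setVar (x := x) hr h2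
    set σ₁ := σ.setReg (2 * x) 0
    have hy₁ : σ₁.reg (2 * y) = s.var y := by
      rw [hr₁.var, Env.setVar_var, if_neg hxy.symm]
    have hx₁ : σ₁.reg (2 * x) = 0 := by simp [σ₁, State.setReg]
    set σ₂ := σ₁.setReg (tmp 0) (s.var y - 0)
    have hS₂ : SameUpTo 0 σ₁ σ₂ := (SameUpTo.refl 0 σ₁).setReg le_rfl _
    have e2 : Exec (.arith .sub (tmp 0) (2 * y) (2 * x)) σ₁ (Op.sub.cost (s.var y) 0) σ₂ := by
      have := Exec.arith σ₁ .sub (tmp 0) (2 * y) (2 * x)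
      rwa [hx₁, hy₁] at this
    obtain ⟨T, σ₃, s₃, h₃, hT, hr₃, hQ₃⟩ := main (s.var y) 0 (by omega) _ σ₂ (hS₂.rel hr₁) (by simp)
      (by simp [hxy.symm]) h0 (by simp [σ₂, State.setReg])
    refine ⟨_, _, _, .seq (.const _ _ _) (.seq e2 h₃), ?_, hr₃, hQ₃⟩
    have c2 := hsub _ _ hr₁
    rw [hy₁, hx₁] at c2
    have c3 := Nat.mul_le_mul_right (1 + C.w + (c.cost C.w C.bound +
            (2 + ((1 + C.w) * 2 + (1 + C.w) * (1 + C.w))))) hb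
    simp only [cost, Nat.size_zero]
    omega

end Cmd

end RAM

/-! ### Finite sets as binary numbers. -/

open Finset

/-- The number whose binary digits are the indicator function of a finite set. -/
def enc (A : Finset ℕ) : ℕ := ∑ i ∈ A, 2 ^ i

theorem testBit_enc (A : Finset ℕ) (v : ℕ) : (enc A).testBit v = decide (v ∈ A) := by
  have h : v ∈ (enc A).bitIndices.toFinset ↔ v ∈ A := by
    rw [enc, Finset.toFinset_bitIndices_sum_two_pow]
  rw [List.mem_toFinset, Nat.mem_bitIndices] at h
  by_cases hv : v ∈ A <;> simp_all

theorem enc_injective : Function.Injective enc := by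
  intro A B h
  ext v
  have h1 := testBit_enc A v
  rw [h, testBit_enc] at h1
  simpa using h1.symm

@[simp] theorem enc_empty : enc ∅ = 0 := rfl

theorem enc_insert {A : Finset ℕ} {v : ℕ} (h : v ∉ A) : enc (insert v A) = enc A + 2 ^ v := by
  rw [enc, Finset.sum_insert h, add_comm]; rfl

/-- Removal of an element is a subtraction of codes. This is how the transforms address the table
entry of a smaller set. -/
theorem enc_erase {A : Finset ℕ} {v : ℕ} (h : v ∈ A) : enc (A.erase v) = enc A - 2 ^ v := by
  have := enc_insert (Finset.notMem_erase v A)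
  rw [Finset.insert_erase h] at this
  omega

theorem enc_range (n : ℕ) : enc (range n) + 1 = 2 ^ n := by
  induction n with
  | zero => rfl
  | succ n ih => rw [Finset.range_add_one, enc_insert (by simp), pow_succ]; omega

theorem enc_sdiff {A : Finset ℕ} {n : ℕ} (h : A ⊆ range n) :
    enc (range n \ A) = 2 ^ n - 1 - enc A := by
  have h1 : enc (range n \ A) + enc A = enc (range n) := Finset.sum_sdiff h
  have := enc_range n
  omega

theorem enc_lt {A : Finset ℕ} {n : ℕ} (h : A ⊆ range n) : enc A < 2 ^ n := by
  have h1 : enc (range n \ A) + enc A = enc (range n) := Finset.sum_sdiff h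
  have := enc_range n
  omega

/-! ### Listing a family of sets that is closed under subsets. -/

section Listing

open Classical in
/-- A list of the subsets of `{0, …, v - 1}` that have a property inherited by subsets. -/
noncomputable def subsetList (P : Finset ℕ → Prop) : ℕ → List (Finset ℕ)
  | 0 => [∅]
  | v + 1 => subsetList P v ++ ((subsetList P v).map (insert v)).filter (fun X => P X)

variable {P : Finset ℕ → Prop}

/-- If `insert v Y` has the property, then so does `Y`, which is on the list already. So it is
enough to extend listed sets. -/
theorem mem_subsetList (h0 : P ∅) (hP : ∀ X Y, X ⊆ Y → P Y → P X) {v : ℕ} {X : Finset ℕ} :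
    X ∈ subsetList P v ↔ X ⊆ range v ∧ P X := by
  induction v generalizing X with
  | zero =>
    simp only [subsetList, List.mem_singleton, range_zero, subset_empty]
    exact ⟨fun h => ⟨h, h ▸ h0⟩, fun h => h.1⟩
  | succ v ih =>
    simp only [subsetList, List.mem_append, List.mem_filter, List.mem_map, decide_eq_true_eq, ih]
    constructor
    · rintro (⟨h, hX⟩ | ⟨⟨Y, ⟨hY, -⟩, rfl⟩, hX⟩)
      · exact ⟨h.trans (range_subset_range.2 (by omega)), hX⟩
      · refine ⟨?_, hX⟩
        rw [range_add_one]
        exact insert_subset_insert v hY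
    · rintro ⟨h, hX⟩
      by_cases hv : v ∈ X
      · refine Or.inr ⟨⟨X.erase v, ⟨?_, hP _ _ (erase_subset v X) hX⟩, insert_erase hv⟩, hX⟩
        rw [range_add_one] at h
        exact (subset_insert_iff.1 h)
      · refine Or.inl ⟨?_, hX⟩
        rw [range_add_one] at h
        exact (subset_insert_iff_of_notMem hv).1 h

theorem subset_range_of_mem_subsetList {v : ℕ} {X : Finset ℕ} (h : X ∈ subsetList P v) :
    X ⊆ range v := by
  induction v generalizing X with
  | zero => simp_all [subsetList]
  | succ v ih =>
    simp only [subsetList, List.mem_append, List.mem_filter, List.mem_map] at h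
    rcases h with h | ⟨⟨Y, hY, rfl⟩, -⟩
    · exact (ih h).trans (range_subset_range.2 (by omega))
    · rw [range_add_one]
      exact insert_subset_insert v (ih hY)

/-- Without repetitions, a pass over the list updates each table entry exactly once. -/
theorem nodup_subsetList (v : ℕ) : (subsetList P v).Nodup := by
  induction v with
  | zero => simp [subsetList]
  | succ v ih =>
    have hv : ∀ X ∈ subsetList P v, v ∉ X := fun X hX h => by
      simpa using subset_range_of_mem_subsetList hX h
    refine List.Nodup.append ih (List.Nodup.filter _ ?_) ?_
    · refine (List.nodup_map_iff_inj_on ih).2 fun X hX Y hY h => ?_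
      rw [← erase_insert (hv X hX), h, erase_insert (hv Y hY)]
    · intro X hX hX'
      simp only [List.mem_filter, List.mem_map] at hX'
      obtain ⟨⟨Y, -, rfl⟩, -⟩ := hX'
      exact hv _ hX (mem_insert_self v Y)

theorem length_subsetList_mono {v w : ℕ} (h : v ≤ w) :
    (subsetList P v).length ≤ (subsetList P w).length := by
  induction w, h using Nat.le_induction with
  | base => exact le_rfl
  | succ w _ ih => simp only [subsetList, List.length_append]; omega

open Classical in
theorem length_subsetList (h0 : P ∅) (hP : ∀ X Y, X ⊆ Y → P Y → P X) (v : ℕ) :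
    (subsetList P v).length = #{X ∈ (range v).powerset | P X} := by
  rw [← List.toFinset_card_of_nodup (nodup_subsetList v)]
  congr 1
  ext X
  simp [mem_subsetList h0 hP]

end Listing

/-! ### Counting independent subsets and covers, one element at a time. -/

section Counting

variable (R : ℕ → ℕ → Prop)

/-- No two elements of the set are related. -/
def Indep (X : Finset ℕ) : Prop := ∀ u ∈ X, ∀ v ∈ X, ¬R u v

open Classical in
/-- The independent subsets of `X`. -/
noncomputable def indepSubsets (X : Finset ℕ) : Finset (Finset ℕ) := {I ∈ X.powerset | Indep R I}

/-- The set `I` contains all elements of `X` from `v` on. -/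
def ContainsFrom (v : ℕ) (X I : Finset ℕ) : Prop := ∀ u ∈ X, v ≤ u → u ∈ I

open Classical in
/-- The number of independent subsets of `X` that contain all elements of `X` from `v` on. -/
noncomputable def lowCount (v : ℕ) (X : Finset ℕ) : ℕ :=
  #{I ∈ indepSubsets R X | ContainsFrom v X I}

open Classical in
/-- The number of `k`-tuples of independent subsets of `X` that cover all elements of `X` below
`v`. -/
noncomputable def coverCount (k v : ℕ) (X : Finset ℕ) : ℕ :=
  #{t ∈ Fintype.piFinset (fun _ : Fin k => indepSubsets R X) | ∀ u ∈ X, u < v → ∃ i, u ∈ t i}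

variable {R}

theorem mem_indepSubsets {X I : Finset ℕ} : I ∈ indepSubsets R X ↔ I ⊆ X ∧ Indep R I := by
  simp [indepSubsets]

-- Only `I = X` qualifies, so the transform starts from the outcome of an independence test.
open Classical in
theorem lowCount_zero (X : Finset ℕ) : lowCount R 0 X = if Indep R X then 1 else 0 := by
  have h : ∀ I ∈ indepSubsets R X, ContainsFrom 0 X I ↔ I = X := fun I hI =>
    ⟨fun h => (mem_indepSubsets.1 hI).1.antisymm fun u hu => h u hu (Nat.zero_le u),
      fun h u hu _ => h ▸ hu⟩
  rw [lowCount, filter_congr h, filter_eq']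
  simp only [mem_indepSubsets, Subset.refl, true_and]
  split_ifs <;> rfl

theorem lowCount_succ_of_notMem {v : ℕ} {X : Finset ℕ} (hv : v ∉ X) :
    lowCount R (v + 1) X = lowCount R v X := by
  classical
  unfold lowCount
  congr 1
  refine filter_congr fun _ _ => forall₂_congr fun u hu => ?_
  have : u ≠ v := fun h => hv (h ▸ hu)
  exact imp_congr_left (by omega)

/-- Split by `v ∈ I`: the sets with `v` are counted at stage `v` for `X`, those without `v` at stage
`v` for `X.erase v`. The step refers only to subsets of `X`, so it can be carried out inside a
family closed under subsets. -/
theorem lowCount_succ {v : ℕ} {X : Finset ℕ} (hv : v ∈ X) :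
    lowCount R (v + 1) X = lowCount R v X + lowCount R v (X.erase v) := by
  classical
  unfold lowCount
  rw [← card_filter_add_card_filter_not (s := {I ∈ indepSubsets R X | ContainsFrom (v + 1) X I}) (fun I => v ∈ I),
    filter_filter, filter_filter]
  congr 2
  · refine filter_congr fun I _ => ⟨fun h u hu huv => ?_, fun h => ⟨fun u hu huv => ?_, ?_⟩⟩
    · rcases huv.eq_or_lt with rfl | huv
      exacts [h.2, h.1 u hu huv]
    · exact h u hu (by omega)
    · exact h v hv le_rfl
  · ext I
    simp only [mem_filter, mem_indepSubsets, subset_erase]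
    constructor
    · rintro ⟨⟨h1, h2⟩, h3, h4⟩
      refine ⟨⟨⟨h1, h4⟩, h2⟩, fun u hu huv => h3 u (mem_of_mem_erase hu) ?_⟩
      have := ne_of_mem_erase hu
      omega
    · rintro ⟨⟨⟨h1, h4⟩, h2⟩, h3⟩
      exact ⟨⟨h1, h2⟩, fun u hu huv => h3 u (mem_erase.2 ⟨by omega, hu⟩) (by omega), h4⟩

theorem lowCount_of_subset {n : ℕ} {X : Finset ℕ} (hX : X ⊆ range n) :
    lowCount R n X = #(indepSubsets R X) := by
  classical
  rw [lowCount, filter_true_of_mem]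
  intro I _ u hu hn
  have := mem_range.1 (hX hu)
  omega

theorem lowCount_le {n : ℕ} {X : Finset ℕ} (hX : X ⊆ range n) (v : ℕ) :
    lowCount R v X ≤ 2 ^ n := by
  classical
  refine (card_filter_le _ _).trans ((card_filter_le _ _).trans ?_)
  rw [card_powerset]
  exact Nat.pow_le_pow_right (by norm_num) (by simpa using card_le_card hX)

theorem coverCount_zero (k : ℕ) (X : Finset ℕ) :
    coverCount R k 0 X = #(indepSubsets R X) ^ k := by
  classical
  rw [coverCount, filter_true_of_mem (by simp)]
  simp

theorem coverCount_le {n : ℕ} {X : Finset ℕ} (hX : X ⊆ range n) (k v : ℕ) :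
    coverCount R k v X ≤ 2 ^ (n * k) := by
  classical
  refine (card_filter_le _ _).trans ?_
  rw [Fintype.card_piFinset_const, pow_mul, ← lowCount_of_subset hX]
  exact Nat.pow_le_pow_left (lowCount_le hX n) k

theorem coverCount_succ_of_notMem {k v : ℕ} {X : Finset ℕ} (hv : v ∉ X) :
    coverCount R k (v + 1) X = coverCount R k v X := by
  classical
  unfold coverCount
  congr 1
  refine filter_congr fun _ _ => forall₂_congr fun u hu => ?_
  have : u ≠ v := fun h => hv (h ▸ hu)
  exact imp_congr_left (by omega)

/-- The tuples that cover everything below `v` but miss `v` are exactly the tuples counted for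
`X.erase v`. In particular the truncated subtraction is exact. -/
theorem coverCount_succ {k v : ℕ} {X : Finset ℕ} (hv : v ∈ X) :
    coverCount R k (v + 1) X = coverCount R k v X - coverCount R k v (X.erase v) := by
  classical
  unfold coverCount
  rw [← card_filter_add_card_filter_not
    (s := {t ∈ Fintype.piFinset (fun _ : Fin k => indepSubsets R X) | ∀ u ∈ X, u < v → _})
    (fun t => ∃ i, v ∈ t i), filter_filter, filter_filter]
  refine (Nat.sub_eq_of_eq_add ?_).symm
  congr 2
  · refine filter_congr fun t _ => ⟨fun h u hu huv => ?_, fun h => ⟨fun u hu huv => ?_, ?_⟩⟩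
    · rcases (Nat.lt_succ_iff.1 huv).eq_or_lt with rfl | huv
      exacts [h.2, h.1 u hu huv]
    · exact h u hu (by omega)
    · exact h v hv (by omega)
  · ext t
    simp only [mem_filter, Fintype.mem_piFinset, mem_indepSubsets, subset_erase, mem_erase,
      not_exists]
    constructor
    · rintro ⟨h1, h3, h4⟩
      exact ⟨fun i => ⟨⟨(h1 i).1, h4 i⟩, (h1 i).2⟩, fun u hu huv => h3 u hu.2 huv⟩
    · rintro ⟨h1, h3⟩
      exact ⟨fun i => ⟨(h1 i).1.1, (h1 i).2⟩, fun u hu huv => h3 u ⟨by omega, hu⟩ huv,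
        fun i => (h1 i).1.2⟩

theorem coverCount_ne_zero {k n : ℕ} {X : Finset ℕ} (hX : X ⊆ range n) :
    coverCount R k n X ≠ 0 ↔
      ∃ t : Fin k → Finset ℕ, (∀ i, t i ⊆ X ∧ Indep R (t i)) ∧ ∀ u ∈ X, ∃ i, u ∈ t i := by
  classical
  rw [coverCount, Finset.card_ne_zero]
  simp only [Finset.Nonempty, mem_filter, Fintype.mem_piFinset, mem_indepSubsets]
  exact exists_congr fun t => and_congr_right fun _ =>
    forall₂_congr fun u hu => ⟨fun h => h (mem_range.1 (hX hu)), fun h _ => h⟩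

end Counting

/-! ### Colourings, free vertices and sets avoiding neighbourhoods. -/

section Coloring

variable (R : ℕ → ℕ → Prop)

/-- The relation `R` on `{0, …, n - 1}` has a proper coloring with `k` colors. -/
def ColorableBelow (n k : ℕ) : Prop :=
  ∃ c : ℕ → ℕ, (∀ u < n, c u < k) ∧ ∀ u < n, ∀ v < n, R u v → c u ≠ c v

open Classical in
/-- The elements of `A` that are not related to an element of `T`. -/
noncomputable def freeOf (A T : Finset ℕ) : Finset ℕ := {a ∈ A | ∀ u ∈ T, ¬R a u}

open Classical in
/-- The neighbours of `a` among `{0, …, n - 1}`. -/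
noncomputable def nbrs (n a : ℕ) : Finset ℕ := {u ∈ range n | R a u}

open Classical in
/-- The closed neighbourhood of `a` outside `B`. -/
noncomputable def outerNbhd (n : ℕ) (B : Finset ℕ) (a : ℕ) : Finset ℕ :=
  {u ∈ range n | (R a u ∨ u = a) ∧ u ∉ B}

variable {R}

/-- Each element of `X` takes the index of some member of the cover that contains it, and the
independent complement takes the new colour `k`. -/
theorem colorableBelow_succ_of_coverCount {n k : ℕ} {X : Finset ℕ} (hX : X ⊆ range n)
    (hc : coverCount R k n X ≠ 0) (hi : Indep R (range n \ X)) : ColorableBelow R n (k + 1) := by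
  classical
  obtain ⟨t, ht, hcov⟩ := (coverCount_ne_zero hX).1 hc
  choose f hf using hcov
  refine ⟨fun u => if h : u ∈ X then (f u h : ℕ) else k, fun u hu => ?_, fun u hu v hv hR => ?_⟩
  · dsimp only
    split_ifs <;> omega
  · dsimp only
    by_cases huX : u ∈ X <;> by_cases hvX : v ∈ X
    · simp only [huX, hvX, dif_pos]
      intro h
      have h' : f u huX = f v hvX := Fin.ext h
      exact (ht _).2 u (hf u huX) v (h' ▸ hf v hvX) hR
    · simp only [huX, hvX, dif_pos, dif_neg, not_false_eq_true]
      have := (f u huX).2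
      omega
    · simp only [huX, hvX, dif_pos, dif_neg, not_false_eq_true]
      have := (f v hvX).2
      omega
    · exact absurd hR (hi u (by simp [hu, huX]) v (by simp [hv, hvX]))

/-- Double counting of pairs of a colour `j` and a vertex `a ∈ A` without neighbours of colour `j`
in `B`. For each `a` there are at least `k - D` such colours, and at least one, hence at least k/(D
+ 1). Some colour attains the average. -/
theorem exists_color_class_free {n k D : ℕ} {c : ℕ → ℕ} (hc : ∀ u < n, c u < k)
    (hR : ∀ u < n, ∀ v < n, R u v → c u ≠ c v) {A B : Finset ℕ} (hA : A ⊆ range n)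
    (hB : B ⊆ range n) (hD : ∀ a ∈ A, #(nbrs R n a) ≤ D) (hk : 0 < k) :
    ∃ j < k, #A ≤ #(freeOf R A {u ∈ B | c u = j}) * (D + 1) := by
  classical
  have key : ∀ a ∈ A, k ≤ #{j ∈ range k | ∀ u ∈ B, c u = j → ¬R a u} * (D + 1) := by
    intro a ha
    have han := mem_range.1 (hA ha)
    -- The colour of `a` itself always counts, which matters when `k ≤ D`.
    have h1 : 1 ≤ #{j ∈ range k | ∀ u ∈ B, c u = j → ¬R a u} := by
      refine card_pos.2 ⟨c a, ?_⟩
      simp only [mem_filter, mem_range]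
      exact ⟨hc a han, fun u hu hcu h => hR a han u (mem_range.1 (hB hu)) h hcu.symm⟩
    have h2 : #{j ∈ range k | ¬∀ u ∈ B, c u = j → ¬R a u} ≤ D := by
      refine le_trans (card_le_card (t := (nbrs R n a).image c) fun j hj => ?_)
        (card_image_le.trans (hD a ha))
      simp only [mem_filter, mem_range, not_forall, not_not] at hj
      obtain ⟨-, u, hu, rfl, h⟩ := hj
      exact mem_image_of_mem c (by simp [nbrs, h, mem_range.1 (hB hu)])
    have h3 := card_filter_add_card_filter_not (s := range k)
      (fun j => ∀ u ∈ B, c u = j → ¬R a u)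
    rw [card_range] at h3
    have h4 : D ≤ D * #{j ∈ range k | ∀ u ∈ B, c u = j → ¬R a u} := Nat.le_mul_of_pos_right D h1
    rw [mul_add_one, mul_comm]
    omega
  have hcount : ∑ j ∈ range k, #(freeOf R A {u ∈ B | c u = j}) =
      ∑ a ∈ A, #{j ∈ range k | ∀ u ∈ B, c u = j → ¬R a u} := by
    have := sum_card_bipartiteAbove_eq_sum_card_bipartiteBelow (s := range k) (t := A)
      (fun j a => ∀ u ∈ B, c u = j → ¬R a u)
    simp only [bipartiteAbove, bipartiteBelow] at this
    rw [← this]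
    refine sum_congr rfl fun j _ => ?_
    congr 1
    ext a
    simp [freeOf]
  by_contra! hcon
  have h5 : ∑ j ∈ range k, #(freeOf R A {u ∈ B | c u = j}) * (D + 1) < ∑ j ∈ range k, #A :=
    sum_lt_sum_of_nonempty ⟨0, mem_range.2 hk⟩ fun j hj => hcon j (mem_range.1 hj)
  rw [← sum_mul, hcount, sum_mul, sum_const, card_range, smul_eq_mul] at h5
  have h6 := sum_le_sum key
  rw [sum_const, smul_eq_mul] at h6
  rw [mul_comm k] at h5
  omega

/-- `X` is the complement of a largest independent set `I` that contains the colour class and has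
the same trace `T` on `B`. If `X` contained the outer neighbourhood of a free vertex `a`, all
neighbours of `a` in `I` would lie in `B`, hence in `T`. There are none there, so `insert a I` would
be a larger set of this kind. -/
theorem exists_cover_of_colorableBelow {n k D : ℕ} (hs : ∀ u v, R u v → R v u)
    (hirr : ∀ u, ¬R u u)
    (h : ColorableBelow R n (k + 1)) {A B : Finset ℕ} (hA : A ⊆ range n) (hB : B ⊆ range n)
    (hAB : Disjoint A B) (hD : ∀ a ∈ A, #(nbrs R n a) ≤ D) :
    ∃ T ⊆ B, #A ≤ #(freeOf R A T) * (D + 1) ∧ ∃ X ⊆ range n,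
      (∀ a ∈ freeOf R A T, ¬outerNbhd R n B a ⊆ X) ∧ coverCount R k n X ≠ 0 ∧
        Indep R (range n \ X) := by
  classical
  obtain ⟨c, hc, hR⟩ := h
  obtain ⟨j, hj, hcard⟩ := exists_color_class_free hc hR hA hB hD (Nat.succ_pos k)
  set T : Finset ℕ := {u ∈ B | c u = j} with hT
  refine ⟨T, filter_subset _ _, hcard, ?_⟩
  set F : Finset (Finset ℕ) := {I ∈ (range n).powerset |
    Indep R I ∧ I ∩ B = T ∧ ∀ u < n, c u = j → u ∈ I} with hF
  have hne : F.Nonempty := by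
    refine ⟨{u ∈ range n | c u = j}, ?_⟩
    simp only [hF, mem_filter, mem_powerset]
    refine ⟨filter_subset _ _, fun u hu v hv hR' => ?_, ?_, fun u hu h => by simp [hu, h]⟩
    · simp only [mem_filter, mem_range] at hu hv
      exact hR u hu.1 v hv.1 hR' (hu.2.trans hv.2.symm)
    · ext u
      simp only [mem_inter, mem_filter, hT, mem_range]
      exact ⟨fun h => ⟨h.2, h.1.2⟩, fun h => ⟨⟨mem_range.1 (hB h.1), h.2⟩, h.1⟩⟩
  obtain ⟨I, hI, hmax⟩ := exists_max_image F card hne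
  simp only [hF, mem_filter, mem_powerset] at hI
  obtain ⟨hIn, hII, hIB, hIc⟩ := hI
  refine ⟨range n \ I, sdiff_subset, fun a ha hsub => ?_, ?_, ?_⟩
  · simp only [freeOf, mem_filter] at ha
    have han : a ∈ range n := hA ha.1
    have haB : a ∉ B := disjoint_left.1 hAB ha.1
    have hout : ∀ u ∈ I, (R a u ∨ u = a) → u ∈ B := fun u hu hau => by
      by_contra huB
      have := hsub (show u ∈ outerNbhd R n B a by simp [outerNbhd, hau, huB, mem_range.1 (hIn hu)])
      exact (mem_sdiff.1 this).2 hu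
    have hnR : ∀ u ∈ I, ¬R a u := fun u hu hau => by
      have huB := hout u hu (Or.inl hau)
      exact ha.2 u (hIB ▸ mem_inter.2 ⟨hu, huB⟩) hau
    have haI : a ∉ I := fun h => haB (hout a h (Or.inr rfl))
    have hins : insert a I ∈ F := by
      simp only [hF, mem_filter, mem_powerset]
      refine ⟨insert_subset han hIn, fun u hu v hv hR' => ?_, ?_,
        fun u hu h => mem_insert_of_mem (hIc u hu h)⟩
      · rcases mem_insert.1 hu with rfl | hu' <;> rcases mem_insert.1 hv with rfl | hv'
        · exact hirr _ hR'
        · exact hnR v hv' hR'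
        · exact hnR u hu' (hs _ _ hR')
        · exact hII u hu' v hv' hR'
      · rw [insert_inter_of_notMem haB, hIB]
    have := hmax _ hins
    rw [card_insert_of_notMem haI] at this
    omega
  · rw [coverCount_ne_zero sdiff_subset]
    -- Colour `j` is entirely inside `I`. Skipping it renumbers the other classes by `Fin k`.
    refine ⟨fun i => {u ∈ range n \ I | c u = if (i : ℕ) < j then (i : ℕ) else i + 1},
      fun i => ⟨filter_subset _ _, fun u hu v hv hR' => ?_⟩, fun u hu => ?_⟩
    · simp only [mem_filter, mem_sdiff, mem_range] at hu hv
      exact hR u hu.1.1 v hv.1.1 hR' (hu.2.trans hv.2.symm)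
    · have hu' := mem_sdiff.1 hu
      have hun := mem_range.1 hu'.1
      have hcj : c u ≠ j := fun h => hu'.2 (hIc u hun h)
      have := hc u hun
      by_cases hlt : c u < j
      · refine ⟨⟨c u, by omega⟩, mem_filter.2 ⟨hu, ?_⟩⟩
        simp [hlt]
      · refine ⟨⟨c u - 1, by omega⟩, mem_filter.2 ⟨hu, ?_⟩⟩
        have : ¬(c u - 1 < j) := by omega
        simp only [this, if_false]
        omega
  · rw [Finset.sdiff_sdiff_eq_self hIn]
    exact hII

open Classical in
/-- Few sets contain none of a family of disjoint small sets. -/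
theorem card_avoiding_le (A : Finset ℕ) (nb : ℕ → Finset ℕ) (m : ℕ)
    (hm : ∀ a ∈ A, #(nb a) ≤ m) (hdisj : (A : Set ℕ).PairwiseDisjoint nb) (W : Finset ℕ)
    (hW : ∀ a ∈ A, nb a ⊆ W) :
    #{X ∈ W.powerset | ∀ a ∈ A, ¬nb a ⊆ X} * (2 ^ m) ^ #A ≤ 2 ^ #W * (2 ^ m - 1) ^ #A := by
  induction A using Finset.induction_on generalizing W with
  | empty => simp
  | insert a A ha ih =>
    have hd : ∀ b ∈ A, Disjoint (nb b) (nb a) := fun b hb =>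
      hdisj (by simp [hb]) (by simp) (fun h => ha (h ▸ hb))
    have ih' := ih (fun b hb => hm b (mem_insert_of_mem hb))
      (hdisj.subset (by simp)) (W \ nb a)
      (fun b hb => subset_sdiff.2 ⟨hW b (mem_insert_of_mem hb), hd b hb⟩)
    -- `X` is determined by its part in `nb a`, which is a proper subset of `nb a`, and by the rest,
    -- which is subject to the induction hypothesis because the other neighbourhoods are disjoint
    -- from `nb a`.
    have hinj : #{X ∈ W.powerset | ∀ b ∈ insert a A, ¬nb b ⊆ X} ≤
        #(((nb a).powerset.erase (nb a)) ×ˢ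
          {X ∈ (W \ nb a).powerset | ∀ b ∈ A, ¬nb b ⊆ X}) := by
      refine card_le_card_of_injOn (fun X => (X ∩ nb a, X \ nb a)) (fun X hX => ?_)
        (fun X _ Y _ h => ?_)
      · simp only [coe_filter, mem_powerset, Set.mem_ofPred_eq] at hX
        simp only [coe_product, Set.mem_prod, mem_coe, mem_erase, mem_powerset, mem_filter]
        refine ⟨⟨fun h => hX.2 a (mem_insert_self a A) (inter_eq_right.1 h), inter_subset_right⟩,
          sdiff_subset_sdiff hX.1 le_rfl, fun b hb h => ?_⟩
        exact hX.2 b (mem_insert_of_mem hb) (h.trans sdiff_subset)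
      · simp only [Prod.mk.injEq] at h
        rw [← sup_inf_sdiff X (nb a), ← sup_inf_sdiff Y (nb a)]
        exact congrArg₂ _ h.1 h.2
    rw [card_product, card_erase_of_mem (by simp), card_powerset] at hinj
    have hWc : 2 ^ #W = 2 ^ #(nb a) * 2 ^ #(W \ nb a) := by
      rw [← pow_add, add_comm, card_sdiff_add_card_eq_card (hW a (mem_insert_self a A))]
    have hle : 2 ^ #(nb a) ≤ 2 ^ m :=
      Nat.pow_le_pow_right (by norm_num) (hm a (mem_insert_self a A))
    -- The inequality 1 - 2^{-s} ≤ 1 - 2^{-m} for s ≤ m, without denominators.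
    have hfac : (2 ^ #(nb a) - 1) * 2 ^ m ≤ 2 ^ #(nb a) * (2 ^ m - 1) := by
      rw [Nat.sub_mul, Nat.mul_sub]
      omega
    rw [card_insert_of_notMem ha, pow_succ, pow_succ, hWc]
    calc _ ≤ ((2 ^ #(nb a) - 1) * #{X ∈ (W \ nb a).powerset | ∀ b ∈ A, ¬nb b ⊆ X}) *
          ((2 ^ m) ^ #A * 2 ^ m) := Nat.mul_le_mul_right _ hinj
      _ = ((2 ^ #(nb a) - 1) * 2 ^ m) *
          (#{X ∈ (W \ nb a).powerset | ∀ b ∈ A, ¬nb b ⊆ X} * (2 ^ m) ^ #A) := by ring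
      _ ≤ (2 ^ #(nb a) * (2 ^ m - 1)) * (2 ^ #(W \ nb a) * (2 ^ m - 1) ^ #A) :=
        Nat.mul_le_mul hfac ih'
      _ = _ := by ring

end Coloring

/-! ### The algorithm as a command. -/

namespace RAM
open RAM.Expr RAM.Cmd

infixr:60 " ;; " => Cmd.seq

/-- Digit `f` of the number `e`, where array `1` holds the powers of two. -/
def bit (e f : Expr) : Expr := e / get 1 f - e / get 1 f / const 2 * const 2

/-- An expression with value `1` if `e = f`, and `0` otherwise. -/
def eqTest (e f : Expr) : Expr := const 1 - ((e - f) + (f - e))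

/-! Variables: `1` number of vertices, `2` current set, `3` flag, `4` and `5` vertices, `6` entry of
the adjacency matrix, `7` result of a test, `8` set `A`, `9` set `B`, `10` size of `A`, `11` bound
for the size of `B`, `12` whether `A` and `B` are found, `13` and `14` rounds, `15` vertex, `16` and
`17` sets of used vertices, `18` degree, `19` flag, `20` set `T`, `21` and `22` index and length for
the list of all `T`, `23` flag, `24` number of free vertices, `25` length of the list of sets, `26`
and `34` limits of loops, `27` and `30` vertices, `28` and `29` indices, `31` number of colors, `32`
result, `33` exponent.

Arrays: `1` powers of two, `2` list of sets, `3` numbers of independent subsets, `4` their powers,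
`5` numbers of covers, `6` free vertices, `7` list of all `T`. -/

/-- Fill array `1` with powers of two. -/
def powTable : Cmd :=
  put 1 (const 0) (const 1) ;; loop 33 1 (put 1 (var 33 + const 1) (get 1 (var 33) * const 2))

/-- Test whether the set in variable `2` is independent. -/
def indepTest : Cmd :=
  assign 3 (const 1) ;; loop 4 1 (loop 5 1 (input 6 (var 4 * var 1 + var 5) ;;
    ite (var 6 * (bit (var 2) (var 4) * bit (var 2) (var 5))) (assign 3 (const 0)) skip))

/-- Test whether the set in variable `2` is contained in `B`. -/
def subsetTest : Cmd :=
  assign 7 (const 1) ;; loop 4 1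
    (ite (bit (var 2) (var 4) * (const 1 - bit (var 9) (var 4))) (assign 7 (const 0)) skip)

/-- Test whether the set in variable `2` contains no closed neighbourhood outside `B` of a free
vertex. -/
def avoidTest : Cmd :=
  assign 7 (const 1) ;; loop 15 1 (ite (get 6 (var 15))
    (assign 3 (const 1) ;; loop 4 1 (input 6 (var 15 * var 1 + var 4) ;;
      ite ((var 6 + eqTest (var 15) (var 4)) *
        ((const 1 - bit (var 9) (var 4)) * (const 1 - bit (var 2) (var 4))))
        (assign 3 (const 0)) skip) ;;
      ite (var 3) (assign 7 (const 0)) skip) skip)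

/-- List in array `j`, with length in variable `l`, all sets that pass a test. -/
def listSets (j : Fin 8) (l m : ℕ) (test : Cmd) : Cmd :=
  -- The first entry is the code of the empty set. The length is copied to `m` because `l` grows
  -- while the old entries are extended.
  put j (const 0) (const 0) ;; assign l (const 1) ;; loop 27 1 (assign m (var l) ;;
    loop 28 m (assign 2 (get j (var 28) + get 1 (var 27)) ;; test ;;
      ite (var 7) (put j (var l) (var 2) ;; assign l (var l + const 1)) skip))

/-- Find the free vertices. -/
def freeTest : Cmd :=
  assign 24 (const 0) ;; loop 15 1 (assign 23 (bit (var 8) (var 15)) ;;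
    loop 4 1 (input 6 (var 15 * var 1 + var 4) ;;
      ite (var 6 * bit (var 20) (var 4)) (assign 23 (const 0)) skip) ;;
    put 6 (var 15) (var 23) ;; assign 24 (var 24 + var 23))

/-- Compute the degree of a vertex, whether it can be picked, and the new used vertices. -/
def inspect : Cmd :=
  loop 4 1 (input 6 (var 15 * var 1 + var 4) ;; assign 18 (var 18 + var 6) ;;
    ite (var 6 + eqTest (var 15) (var 4))
      (ite (bit (var 16) (var 4)) (ite (bit (var 9) (var 4)) skip (assign 19 (const 1)))
        (assign 17 (var 17 + get 1 (var 4)))) skip)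

/-- Greedily pick vertices of degree at most `D` with disjoint closed neighbourhoods outside `B`. -/
def pick (D : ℕ) : Cmd :=
  loop 15 1 (assign 18 (const 0) ;; assign 19 (bit (var 9) (var 15)) ;; assign 17 (var 16) ;;
    -- Truncated subtraction serves as comparison: the second factor is nonzero exactly if the
    -- degree is at most `D`.
    inspect ;; ite ((const 1 - var 19) * (const (D + 1) - var 18))
      (assign 8 (var 8 + get 1 (var 15)) ;; assign 10 (var 10 + const 1) ;; assign 16 (var 17))
      skip)

/-- Find the sets `A` and `B`. -/
def findSets (D q M : ℕ) : Cmd :=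
  assign 9 (const 0) ;; assign 11 (const 0) ;; assign 12 (const 0) ;; assign 14 (const (D + 1)) ;;
    loop 13 14 (ite (var 12) skip (assign 8 (const 0) ;; assign 10 (const 0) ;; assign 16 (var 9) ;;
      -- Nonzero exactly if q|A| ≥ qMb + n, where b, in variable `11`, bounds |B|.
      pick D ;; ite (const q * var 10 + const 1 - (const (q * M) * var 11 + var 1))
        (assign 12 (const 1))
        (assign 11 (var 11 + const (D + 1) * var 10) ;; assign 9 (var 16))))

/-- Run a command for all sets of the list in array `2`. -/
def forEach (c : Cmd) : Cmd := loop 29 25 (assign 2 (get 2 (var 29)) ;; c)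

/-- Apply a partial sum or difference transform to array `j` in place. -/
def transform (o : Op) (j : Fin 8) : Cmd :=
  loop 30 1 (forEach (ite (bit (var 2) (var 30))
    (put j (var 2) (.op o (get j (var 2)) (get j (var 2 - get 1 (var 30))))) skip))

/-- Look for a set with a cover whose complement is independent. -/
def checkSets : Cmd :=
  forEach (ite (get 5 (var 2)) (assign 2 (get 1 (var 1) - const 1 - var 2) ;; indepTest ;;
    ite (var 3 * (var 32 - (var 31 + const 1))) (assign 32 (var 31 + const 1)) skip) skip)

/-- Count independent subsets for all sets of the list. -/
def initTables : Cmd :=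
  forEach (indepTest ;; put 3 (var 2) (var 3)) ;; transform .add 3 ;;
    forEach (put 4 (var 2) (const 1))

/-- Try all numbers of colors. -/
def tryColors : Cmd :=
  -- At the start of round `k`, array `4` holds the `k`-th powers of the numbers in array `3`.
  loop 31 1 (forEach (put 5 (var 2) (get 4 (var 2))) ;; transform .sub 5 ;; checkSets ;;
    forEach (put 4 (var 2) (get 4 (var 2) * get 3 (var 2))))

/-- The search for one set `T`. -/
def searchOne (D : ℕ) : Cmd :=
  assign 20 (get 7 (var 21)) ;; freeTest ;; ite (var 24 * const (D + 1) + const 1 - var 10)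
    (listSets 2 25 26 avoidTest ;; initTables ;; tryColors) skip

/-- Prepare the powers of two and the sets `A` and `B`. -/
def setup (D q M : ℕ) : Cmd := assign 1 (var 0) ;; powTable ;; findSets D q M

/-- The search for the least number of colors. -/
def search (D : ℕ) : Cmd :=
  listSets 7 22 34 subsetTest ;; assign 32 (var 1) ;; loop 21 22 (searchOne D) ;;
    assign 0 (var 32)

/-! ### Correctness of the elementary tests. -/

/-- The computation takes place on the relation `R` on `{0, …, n - 1}`. -/
structure Setting (C : Ctx) (R : ℕ → ℕ → Prop) (n D : ℕ) : Prop where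
  base : C.base = n * n
  inp_of_rel : ∀ u < n, ∀ v < n, R u v → C.inp (u * n + v) = 1
  inp_of_not_rel : ∀ u < n, ∀ v < n, ¬R u v → C.inp (u * n + v) = 0
  -- Numbers of covers may have about `n * n` bits. The factor in `D` leaves room for the size bound
  -- that `findSets` maintains.
  large : (D + 2) ^ 2 * 2 ^ (n * n + n + 1) < 2 ^ C.w
  bound : n ≤ C.bound 1

/-- The number of vertices and the powers of two are available. -/
structure Ready (n : ℕ) (s : Env) : Prop where
  size : s.var 1 = n
  pow : ∀ i ≤ n, s.arr 1 i = 2 ^ i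

theorem Ready.of_agree {n : ℕ} {s s' : Env} {vs as} (h : Ready n s) (hA : Agree vs as s s')
    (hv : 1 ∉ vs) (ha : 1 ∉ as) : Ready n s' :=
  ⟨by rw [hA.var 1 hv, h.size], by rw [hA.arr 1 ha]; exact h.pow⟩

section

variable {C : Ctx} {R : ℕ → ℕ → Prop} {n D : ℕ} {s : Env} {Q : Env → Prop}

theorem Setting.pow_lt (hS : Setting C R n D) {x : ℕ} (hx : x ≤ 2 ^ (n * n + n + 1)) :
    x < 2 ^ C.w :=
  lt_of_le_of_lt (hx.trans (Nat.le_mul_of_pos_left _ (by positivity))) hS.large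

theorem Setting.set_lt (hS : Setting C R n D) {X : Finset ℕ} (hX : X ⊆ range n) :
    enc X < 2 ^ C.w :=
  hS.pow_lt ((enc_lt hX).le.trans (Nat.pow_le_pow_right (by norm_num) (by omega)))

theorem Setting.small_lt (hS : Setting C R n D) {x : ℕ} (hx : x ≤ n + 1) : x < 2 ^ C.w := by
  refine hS.pow_lt (hx.trans ?_)
  have : n + 1 < 2 ^ (n + 1) := Nat.lt_two_pow_self
  exact this.le.trans (Nat.pow_le_pow_right (by norm_num) (by omega))

theorem Setting.cell_lt (hS : Setting C R n D) {u v : ℕ} (hu : u < n) (hv : v < n) :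
    u * n + v < C.base := by
  rw [hS.base]
  calc u * n + v < u * n + n := by omega
    _ = (u + 1) * n := by ring
    _ ≤ n * n := Nat.mul_le_mul_right _ hu

open Classical in
theorem Setting.inp_eq (hS : Setting C R n D) {u v : ℕ} (hu : u < n) (hv : v < n) :
    C.inp (u * n + v) = if R u v then 1 else 0 := by
  split_ifs with h
  exacts [hS.inp_of_rel u hu v hv h, hS.inp_of_not_rel u hu v hv h]

theorem eval_bit {e f : Expr} {X : Finset ℕ} {v : ℕ} (he : e.eval s = enc X) (hf : f.eval s = v)
    (hp : s.arr 1 v = 2 ^ v) : (bit e f).eval s = if v ∈ X then 1 else 0 := by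
  have h1 : (bit e f).eval s = enc X / 2 ^ v % 2 := by
    simp only [bit, eval_sub, eval_mul, eval_div, eval_get, eval_const, he, hf, hp]
    omega
  have h2 := testBit_enc X v
  rw [Nat.testBit_eq_decide_div_mod_eq] at h2
  rw [h1]
  have h3 := Nat.mod_two_eq_zero_or_one (enc X / 2 ^ v)
  split_ifs with h <;> simp only [h, decide_true, decide_false, decide_eq_true_eq,
    decide_eq_false_iff_not] at h2 <;> omega

theorem eval_eqTest {e f : Expr} : (eqTest e f).eval s = if f.eval s = e.eval s then 1 else 0 := by
  simp only [eqTest, eval_sub, eval_add, eval_const]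
  split_ifs <;> omega

/-- The rule for blocks whose effect is described by a postcondition. -/
theorem wp_then {c d : Cmd} {P : Env → Prop} (hc : wp C c P s)
    (hd : ∀ s', Agree c.modVar c.modArr s s' → P s' → wp C d Q s') : wp C (c ;; d) Q s :=
  wp_seq (wp_mono (wp_frame hc) fun s' h => hd s' h.1 h.2)

/-- A loop that clears a flag unless a condition holds throughout. -/
theorem wp_flag_loop {x y f : ℕ} {c : Cmd} (N : ℕ) (hN : s.var y = N) (hb : N ≤ C.bound y)
    (hxy : x ≠ y) (hx : x ∉ c.modVar) (hy : y ∉ c.modVar) (hfx : f ≠ x) (p : ℕ → Prop)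
    [DecidablePred p]
    (hs : ∀ i < N, ∀ s', Agree (x :: c.modVar) c.modArr s s' → s'.var x = i →
      wp C c (fun t => t.var f = if p i then s'.var f else 0) s') :
    wp C (loop x y c) (fun s' => s'.var f = if ∀ i < N, p i then s.var f else 0) s := by
  refine wp_loop N hN hb hxy hx hy
    (fun i s' => s'.var f = if ∀ k < i, p k then s.var f else 0) (by simp [hfx])
    (fun i hi s' hA hx' hI => wp_mono (hs i hi s' hA hx') fun t ht _ _ => ?_) fun s' _ _ h => h
  simp only [Env.setVar_var, hfx, if_false, ht, hI, Nat.lt_succ_iff_lt_or_eq, or_imp,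
    forall_and, forall_eq]
  by_cases h1 : p i <;> by_cases h2 : ∀ k < i, p k <;> simp [h1, h2]

@[simp] theorem modVar_powTable : powTable.modVar = [33] := rfl
@[simp] theorem modArr_powTable : powTable.modArr = [1, 1] := rfl
@[simp] theorem modVar_indepTest : indepTest.modVar = [3, 4, 5, 6, 3] := rfl
@[simp] theorem modArr_indepTest : indepTest.modArr = [] := rfl
@[simp] theorem modVar_subsetTest : subsetTest.modVar = [7, 4, 7] := rfl
@[simp] theorem modArr_subsetTest : subsetTest.modArr = [] := rfl
@[simp] theorem modVar_avoidTest : avoidTest.modVar = [7, 15, 3, 4, 6, 3, 7] := rfl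
@[simp] theorem modArr_avoidTest : avoidTest.modArr = [] := rfl
@[simp] theorem modVar_listSets (j l m t) :
    (listSets j l m t).modVar = [l, 27, m, 28, 2] ++ (t.modVar ++ [l]) := by
  simp [listSets, modVar]
@[simp] theorem modArr_listSets (j l m t) :
    (listSets j l m t).modArr = j :: (t.modArr ++ [j]) := by
  simp [listSets, modArr]
@[simp] theorem modVar_freeTest : freeTest.modVar = [24, 15, 23, 4, 6, 23, 24] := rfl
@[simp] theorem modArr_freeTest : freeTest.modArr = [6] := rfl
@[simp] theorem modVar_inspect : inspect.modVar = [4, 6, 18, 19, 17] := rfl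
@[simp] theorem modArr_inspect : inspect.modArr = [] := rfl
@[simp] theorem modVar_pick (D) :
    (pick D).modVar = [15, 18, 19, 17, 4, 6, 18, 19, 17, 8, 10, 16] := rfl
@[simp] theorem modArr_pick (D) : (pick D).modArr = [] := rfl
@[simp] theorem modVar_findSets (D q M) : (findSets D q M).modVar =
    [9, 11, 12, 14, 13, 8, 10, 16, 15, 18, 19, 17, 4, 6, 18, 19, 17, 8, 10, 16, 12, 11, 9] := rfl
@[simp] theorem modArr_findSets (D q M) : (findSets D q M).modArr = [] := rfl
@[simp] theorem modVar_forEach (c) : (forEach c).modVar = 29 :: 2 :: c.modVar := rfl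
@[simp] theorem modArr_forEach (c) : (forEach c).modArr = c.modArr := rfl
@[simp] theorem modVar_transform (o j) : (transform o j).modVar = [30, 29, 2] := rfl
@[simp] theorem modArr_transform (o j) : (transform o j).modArr = [j] := rfl
@[simp] theorem modVar_checkSets : checkSets.modVar = [29, 2, 2, 3, 4, 5, 6, 3, 32] := rfl
@[simp] theorem modArr_checkSets : checkSets.modArr = [] := rfl
@[simp] theorem modVar_initTables :
    initTables.modVar = [29, 2, 3, 4, 5, 6, 3, 30, 29, 2, 29, 2] := rfl
@[simp] theorem modArr_initTables : initTables.modArr = [3, 3, 4] := rfl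
@[simp] theorem modVar_tryColors : tryColors.modVar =
    [31, 29, 2, 30, 29, 2, 29, 2, 2, 3, 4, 5, 6, 3, 32, 29, 2] := rfl
@[simp] theorem modArr_tryColors : tryColors.modArr = [5, 5, 4] := rfl

theorem wp_powTable (hS : Setting C R n D) (hn : s.var 1 = n) :
    wp C powTable (Ready n) s := by
  refine wp_seq ⟨hS.small_lt (by simp), ?_⟩
  refine wp_loop n hn hS.bound (by decide) (by simp [modVar]) (by simp [modVar])
    (fun i t => ∀ k ≤ i, t.arr 1 k = 2 ^ k) ?_ (fun i hi t hA hx hI => ⟨?_, fun _ _ => ?_⟩) ?_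
  · simp
  · simp only [eval_mul, eval_get, eval_var, eval_const, hx, hI i le_rfl]
    exact hS.pow_lt (by rw [← pow_succ]; exact Nat.pow_le_pow_right (by norm_num) (by omega))
  · intro k hk
    simp only [eval_mul, eval_get, eval_var, eval_const, eval_add, hx, hI i le_rfl,
      Env.setVar_arr, Env.setArr_arr, true_and]
    split_ifs with h
    · rw [h, pow_succ]
    · exact hI k (by omega)
  · intro t hA hx hI
    exact ⟨by rw [hA.var 1 (by simp [modVar])]; simpa using hn, hI⟩

open Classical in
theorem wp_indepTest (hS : Setting C R n D) (hs : Ready n s) {X : Finset ℕ}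
    (hX : s.var 2 = enc X) (hXn : X ⊆ range n) :
    wp C indepTest (fun t => t.var 3 = if Indep R X then 1 else 0) s := by
  refine wp_seq ⟨hS.small_lt (by simp), ?_⟩
  refine wp_mono (wp_flag_loop n (f := 3) (by simp [hs.size]) hS.bound (by decide) (by simp [modVar])
    (by simp [modVar]) (by decide) (fun u => ∀ v < n, ¬(R u v ∧ u ∈ X ∧ v ∈ X)) ?_) ?_
  · intro u hu t hA hu'
    beta_reduce
    refine wp_flag_loop n ?_ hS.bound (by decide) (by simp [modVar]) (by simp [modVar])
      (by decide) (fun v => ¬(R u v ∧ u ∈ X ∧ v ∈ X)) ?_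
    · simp [hA.var 1 (by simp [modVar]), hs.size]
    · intro v hv t' hA' hv'
      have h1 : t'.var 1 = n := by
        simp [hA'.var 1 (by simp [modVar]), hA.var 1 (by simp [modVar]), hs.size]
      have h2 : t'.var 2 = enc X := by
        simp [hA'.var 2 (by simp [modVar]), hA.var 2 (by simp [modVar]), hX]
      have h4 : t'.var 4 = u := by rw [hA'.var 4 (by simp [modVar]), hu']
      have hp : ∀ i ≤ n, t'.arr 1 i = 2 ^ i := by
        rw [hA'.arr 1 (by simp [modArr]), hA.arr 1 (by simp [modArr])]; exact hs.pow
      refine wp_seq ⟨?_, ?_⟩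
      · simpa [h1, h4, hv'] using hS.cell_lt hu hv
      · simp only [eval_add, eval_mul, eval_var, h1, h4, hv', hS.inp_eq hu hv]
        have e1 : ∀ a, (bit (var 2) (var 4)).eval (t'.setVar 6 a) = if u ∈ X then 1 else 0 :=
          fun a => eval_bit (by simp [h2]) (by simp [h4]) (hp u hu.le)
        have e2 : ∀ a, (bit (var 2) (var 5)).eval (t'.setVar 6 a) = if v ∈ X then 1 else 0 :=
          fun a => eval_bit (by simp [h2]) (by simp [hv']) (hp v hv.le)
        by_cases c1 : R u v <;> by_cases c2 : u ∈ X <;> by_cases c3 : v ∈ X <;>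
          simp [wp, e1, e2, c1, c2, c3]
  · intro t ht
    rw [ht]
    simp only [Env.setVar_var, if_true, eval_const]
    congr 1
    refine propext ⟨fun h u hu v hv hR => ?_, fun h u _ v _ hc => h u hc.2.1 v hc.2.2 hc.1⟩
    exact h u (mem_range.1 (hXn hu)) v (mem_range.1 (hXn hv)) ⟨hR, hu, hv⟩

open Classical in
theorem wp_subsetTest (hS : Setting C R n D) (hs : Ready n s) {X B : Finset ℕ}
    (hX : s.var 2 = enc X) (hXn : X ⊆ range n) (hB : s.var 9 = enc B) :
    wp C subsetTest (fun t => t.var 7 = if X ⊆ B then 1 else 0) s := by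
  refine wp_seq ⟨hS.small_lt (by simp), ?_⟩
  refine wp_mono (wp_flag_loop n (f := 7) (by simp [hs.size]) hS.bound (by decide) (by simp [modVar])
    (by simp [modVar]) (by decide) (fun u => u ∈ X → u ∈ B) ?_) ?_
  · intro u hu t hA hu'
    have h2 : t.var 2 = enc X := by simp [hA.var 2 (by simp [modVar]), hX]
    have h9 : t.var 9 = enc B := by simp [hA.var 9 (by simp [modVar]), hB]
    have hp : ∀ i ≤ n, t.arr 1 i = 2 ^ i := by
      rw [hA.arr 1 (by simp [modArr])]; exact hs.pow
    have e1 : (bit (var 2) (var 4)).eval t = if u ∈ X then 1 else 0 :=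
      eval_bit h2 hu' (hp u hu.le)
    have e2 : (bit (var 9) (var 4)).eval t = if u ∈ B then 1 else 0 :=
      eval_bit h9 hu' (hp u hu.le)
    by_cases c2 : u ∈ X <;> by_cases c3 : u ∈ B <;> simp [wp, e1, e2, c2, c3]
  · intro t ht
    rw [ht]
    simp only [Env.setVar_var, if_true, eval_const]
    congr 1
    exact propext ⟨fun h u hu => h u (mem_range.1 (hXn hu)) hu, fun h u _ hu => h hu⟩

open Classical in
theorem wp_avoidTest (hS : Setting C R n D) (hs : Ready n s) {X B F : Finset ℕ}
    (hX : s.var 2 = enc X) (hB : s.var 9 = enc B) (hFn : F ⊆ range n)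
    (hF : ∀ a < n, s.arr 6 a = if a ∈ F then 1 else 0) :
    wp C avoidTest
      (fun t => t.var 7 = if ∀ a ∈ F, ¬outerNbhd R n B a ⊆ X then 1 else 0) s := by
  refine wp_seq ⟨hS.small_lt (by simp), ?_⟩
  refine wp_mono (wp_flag_loop n (f := 7) (by simp [hs.size]) hS.bound (by decide) (by simp [modVar])
    (by simp [modVar]) (by decide) (fun a => a ∈ F → ¬outerNbhd R n B a ⊆ X) ?_) ?_
  · intro a ha t hA ha'
    have h1 : t.var 1 = n := by simp [hA.var 1 (by simp [modVar]), hs.size]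
    have h2 : t.var 2 = enc X := by simp [hA.var 2 (by simp [modVar]), hX]
    have h9 : t.var 9 = enc B := by simp [hA.var 9 (by simp [modVar]), hB]
    have h6 : t.arr 6 a = if a ∈ F then 1 else 0 := by
      rw [hA.arr 6 (by simp [modArr])]; exact hF a ha
    have hp : ∀ i ≤ n, t.arr 1 i = 2 ^ i := by
      rw [hA.arr 1 (by simp [modArr])]; exact hs.pow
    refine ⟨fun hc => ?_, fun hc => ?_⟩
    · have haF : a ∈ F := by
        by_contra h
        simp [ha', h6, h] at hc
      refine wp_seq ⟨hS.small_lt (by simp), ?_⟩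
      refine wp_then (wp_flag_loop n (f := 3) (by simp [h1]) hS.bound (by decide) (by simp [modVar])
        (by simp [modVar]) (by decide) (fun u => u ∈ outerNbhd R n B a → u ∈ X) ?_) ?_
      · intro u hu t' hA' hu'
        have h1' : t'.var 1 = n := by simp [hA'.var 1 (by simp [modVar]), h1]
        have h2' : t'.var 2 = enc X := by simp [hA'.var 2 (by simp [modVar]), h2]
        have h9' : t'.var 9 = enc B := by simp [hA'.var 9 (by simp [modVar]), h9]
        have h15 : t'.var 15 = a := by simp [hA'.var 15 (by simp [modVar]), ha']
        have hp' : ∀ i ≤ n, t'.arr 1 i = 2 ^ i := by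
          rw [hA'.arr 1 (by simp [modArr])]; exact hp
        refine wp_seq ⟨?_, ?_⟩
        · simpa [h1', h15, hu'] using hS.cell_lt ha hu
        · simp only [eval_add, eval_mul, eval_var, h1', h15, hu', hS.inp_eq ha hu]
          have e1 : ∀ b, (bit (var 9) (var 4)).eval (t'.setVar 6 b) = if u ∈ B then 1 else 0 :=
            fun b => eval_bit (by simp [h9']) (by simp [hu']) (hp' u hu.le)
          have e2 : ∀ b, (bit (var 2) (var 4)).eval (t'.setVar 6 b) = if u ∈ X then 1 else 0 :=
            fun b => eval_bit (by simp [h2']) (by simp [hu']) (hp' u hu.le)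
          have e3 : ∀ b, (eqTest (var 15) (var 4)).eval (t'.setVar 6 b) =
            if u = a then 1 else 0 := fun b => by simp [eval_eqTest, hu', h15]
          by_cases c1 : R a u <;> by_cases c2 : u = a <;> by_cases c3 : u ∈ B <;>
            by_cases c4 : u ∈ X <;>
            simp [wp, e1, e2, e3, c1, c2, c3, c4, outerNbhd, hu] <;> simp_all
      · intro t' hA' h3
        have h3' : t'.var 3 = if outerNbhd R n B a ⊆ X then 1 else 0 := by
          rw [h3]
          simp only [Env.setVar_var, if_true, eval_const]
          congr 1
          refine propext ⟨fun h u hu => h u ?_ hu, fun h u _ hu => h hu⟩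
          exact mem_range.1 (mem_filter.1 hu).1
        have h7 : t'.var 7 = t.var 7 := by simp [hA'.var 7 (by simp [modVar])]
        by_cases c1 : outerNbhd R n B a ⊆ X <;> simp [wp, h3', c1, haF, h7]
    · have haF : a ∉ F := by
        intro h
        simp [ha', h6, h] at hc
      simp [wp, haF]
  · intro t ht
    rw [ht]
    simp only [Env.setVar_var, if_true, eval_const]
    congr 1
    exact propext ⟨fun h a ha => h a (mem_range.1 (hFn ha)) ha, fun h a _ ha => h a ha⟩

end

end RAM

/-! ### Correctness of the listing procedure and of the free vertices. -/

namespace RAM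
open RAM.Expr RAM.Cmd

/-- Array `j` with length in variable `l` represents a list of sets. -/
structure Lists (s : Env) (j : Fin 8) (l : ℕ) (L : List (Finset ℕ)) : Prop where
  length : s.var l = L.length
  get : ∀ i X, L[i]? = some X → s.arr j i = enc X

theorem Lists.of_eq {s s' : Env} {j : Fin 8} {l : ℕ} {L : List (Finset ℕ)} (h : Lists s j l L)
    (hl : s'.var l = s.var l) (hj : s'.arr j = s.arr j) : Lists s' j l L :=
  ⟨hl.trans h.length, fun i X hi => by rw [hj]; exact h.get i X hi⟩

theorem Lists.push {s : Env} {j : Fin 8} {l : ℕ} {L : List (Finset ℕ)} (h : Lists s j l L)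
    (X : Finset ℕ) :
    Lists ((s.setArr j (s.var l) (enc X)).setVar l (s.var l + 1)) j l (L ++ [X]) := by
  refine ⟨by simp [h.length], fun i Y hi => ?_⟩
  rw [List.getElem?_append] at hi
  split_ifs at hi with hlt
  · have : i ≠ s.var l := by rw [h.length]; omega
    simpa [this] using h.get i Y hi
  · obtain ⟨hi', rfl⟩ : i - L.length = 0 ∧ X = Y := by
      rcases Nat.eq_zero_or_pos (i - L.length) with h0 | h0
      · rw [h0] at hi; exact ⟨h0, by simpa using hi⟩
      · rw [List.getElem?_eq_none (by rw [List.length_singleton]; omega)] at hi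
        simp at hi
    have : i = s.var l := by rw [h.length]; omega
    simp [this]

open Classical in
theorem length_subsetList_le (P : Finset ℕ → Prop) (v : ℕ) : (subsetList P v).length ≤ 2 ^ v := by
  induction v with
  | zero => simp [subsetList]
  | succ v ih =>
    have := List.length_filter_le (fun X => decide (P X)) ((subsetList P v).map (insert v))
    rw [List.length_map] at this
    simp only [subsetList, List.length_append, pow_succ]
    omega

theorem filter_lt_succ (S : Finset ℕ) (x : ℕ) :
    {a ∈ S | a < x + 1} = if x ∈ S then insert x {a ∈ S | a < x} else {a ∈ S | a < x} := by
  split_ifs with h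
  · ext a
    simp only [mem_filter, mem_insert]
    by_cases hax : a = x
    · simp [hax, h]
    · simp only [hax, false_or]
      exact and_congr_right fun _ => by omega
  · refine filter_congr fun a ha => ?_
    have : a ≠ x := fun hax => h (hax ▸ ha)
    omega

variable {C : Ctx} {R : ℕ → ℕ → Prop} {n D : ℕ} {s : Env} {Q : Env → Prop}

-- The two invariants follow the recursion of `subsetList`: after the outer stage `v` the array is
-- the list for `v`, and inside it the first `i` sets have been extended by `v`. Only extensions of
-- listed sets are tested, so the work is governed by the length of the list instead of 2^n.
open Classical in
theorem wp_listSets (hS : Setting C R n D) (hs : Ready n s) {j : Fin 8} {l m : ℕ} {test : Cmd}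
    {P : Finset ℕ → Prop} (hj : j ≠ 1) (hl : l ∉ [1, 2, 7, 27, 28, m])
    (hm : m ∉ [1, 2, 7, 27, 28]) (hv : ∀ x ∈ [l, m, 1, 2, 27, 28], x ∉ test.modVar)
    (ha : test.modArr = []) (hb : (subsetList P n).length ≤ C.bound m)
    (ht : ∀ s', Agree (listSets j l m test).modVar (listSets j l m test).modArr s s' →
      Ready n s' → ∀ X ⊆ range n, s'.var 2 = enc X →
        wp C test (fun t => t.var 7 = if P X then 1 else 0) s') :
    wp C (listSets j l m test) (fun t => Lists t j l (subsetList P n)) s := by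
  simp only [List.mem_cons, List.not_mem_nil, or_false, not_or, forall_eq_or_imp,
    forall_eq] at hl hm hv
  obtain ⟨hl1, hl2, hl7, hl27, hl28, hlm⟩ := hl
  obtain ⟨hm1, hm2, hm7, hm27, hm28⟩ := hm
  obtain ⟨hvl, hvm, hv1, hv2, hv27, hv28⟩ := hv
  have hset : ∀ (t : Env) a, Agree (listSets j l m test).modVar (listSets j l m test).modArr t
      (t.setVar l a) := fun t a => ⟨fun z hz => by simp_all, fun j _ => rfl⟩
  refine wp_seq ⟨hS.small_lt (by simp), wp_seq ⟨hS.small_lt (by simp), ?_⟩⟩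
  set s₁ := (s.setArr j (eval s (const 0)) (eval s (const 0))).setVar l
    (eval (s.setArr j (eval s (const 0)) (eval s (const 0))) (const 1)) with hs₁
  have hA₁ : Agree (listSets j l m test).modVar (listSets j l m test).modArr s s₁ :=
    ⟨fun z hz => by simp_all, fun j hz => by funext i; simp_all⟩
  refine wp_loop n (by simp [hs₁, Ne.symm hl1, hs.size]) hS.bound (by decide)
    (by simp [modVar, Ne.symm hm27, hv27, Ne.symm hl27])
    (by simp [modVar, Ne.symm hm1, hv1, Ne.symm hl1])
    (fun v t => Lists t j l (subsetList P v)) ?_ (fun v hv t hA hx hI => ?_) fun t _ _ h => h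
  · refine ⟨by simp [hs₁, hl27, subsetList], fun i X hi => ?_⟩
    rcases Nat.eq_zero_or_pos i with rfl | h0
    · simp only [subsetList, List.getElem?_cons_zero, Option.some.injEq] at hi
      simp [hs₁, ← hi]
    · rw [List.getElem?_eq_none (by rw [subsetList, List.length_singleton]; omega)] at hi
      simp at hi
  · have hA' : Agree (listSets j l m test).modVar (listSets j l m test).modArr s t :=
      hA₁.trans (hA.mono (by simp [modVar]) (by simp [modArr]))
    set L := subsetList P v with hL
    have hLlen : L.length ≤ 2 ^ v := length_subsetList_le P v
    have hpv : 2 ^ v * 2 ≤ 2 ^ n := by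
      rw [← pow_succ]; exact Nat.pow_le_pow_right (by norm_num) hv
    have hpn : 2 ^ n * 2 ≤ 2 ^ (n * n + n + 1) := by
      rw [← pow_succ]; exact Nat.pow_le_pow_right (by norm_num) (by omega)
    have hp2 : 0 < 2 ^ n := by positivity
    refine wp_seq ⟨hS.pow_lt (by simp only [eval_var, hI.length]; omega), ?_⟩
    refine wp_loop L.length (by simp [hI.length])
      ((length_subsetList_mono hv.le).trans hb) (Ne.symm hm28)
      (by simp [modVar, hv28, Ne.symm hl28]) (by simp [modVar, hm2, hvm, Ne.symm hlm])
      (fun i t => Lists t j l (L ++ ((L.take i).map (insert v)).filter (fun X => P X)))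
      ?_ (fun i hi t' hB hx' hJ => ?_) fun t' hB hx' hJ => ?_
    · simp only [List.take_zero, List.map_nil, List.filter_nil, List.append_nil]
      exact hI.of_eq (by simp [hlm, hl28]) rfl
    · have hB' : Agree (listSets j l m test).modVar (listSets j l m test).modArr s t' := by
        refine hA'.trans (Agree.trans (s' := t.setVar m (eval t (var l)))
          ⟨fun z hz => by simp_all, fun j _ => rfl⟩ (hB.mono ?_ (by simp [modArr])))
        intro z hz
        simp only [modVar, modVar_listSets, List.mem_cons, List.mem_append] at hz ⊢
        simp only [List.not_mem_nil, or_false] at hz ⊢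
        tauto
      have h27 : t'.var 27 = v := by
        rw [hB.var 27 (by simp [modVar, hv27, Ne.symm hl27])]
        simp [Ne.symm hm27, hx]
      have hpow : ∀ i ≤ n, t'.arr 1 i = 2 ^ i := by
        rw [hB'.arr 1 (by simp [ha, Ne.symm hj])]; exact hs.pow
      obtain ⟨Y, hY⟩ : ∃ Y, L[i]? = some Y := ⟨L[i], List.getElem?_eq_getElem hi⟩
      have hYmem : Y ∈ L := List.mem_of_getElem? hY
      have hYv : Y ⊆ range v := subset_range_of_mem_subsetList hYmem
      have hvY : v ∉ Y := fun h => by simpa using hYv h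
      have hYn : insert v Y ⊆ range n :=
        insert_subset (mem_range.2 hv) (hYv.trans (range_subset_range.2 hv.le))
      have hval : eval t' (get j (var 28) + get 1 (var 27)) = enc (insert v Y) := by
        simp only [eval_add, eval_get, eval_var, hx', h27, hpow v hv.le]
        -- Appending does not disturb the old entries, which are the only ones read.
        rw [enc_insert hvY, hJ.get i Y (by rw [List.getElem?_append_left hi, hY])]
      refine wp_seq ⟨by rw [hval]; exact hS.set_lt hYn, ?_⟩
      rw [hval]
      set t₂ := t'.setVar 2 (enc (insert v Y)) with ht₂
      have hA₂ : Agree (listSets j l m test).modVar (listSets j l m test).modArr s t₂ :=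
        hB'.trans ⟨fun z hz => by simp_all, fun j _ => rfl⟩
      have hR₂ : Ready n t₂ := hs.of_agree hA₂
        (by simp [Ne.symm hl1, Ne.symm hm1, hv1]) (by simp [ha, Ne.symm hj])
      refine wp_then (ht t₂ hA₂ hR₂ _ hYn (by simp [ht₂])) fun t₃ hA₃ h7 => ?_
      have h3l : t₃.var l = t'.var l := by rw [hA₃.var l hvl]; simp [ht₂, hl2]
      have h32 : t₃.var 2 = enc (insert v Y) := by rw [hA₃.var 2 hv2]; simp [ht₂]
      have hJ₃ := hJ.of_eq h3l (hA₃.arr j (by simp [ha]))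
      have hlen := hJ₃.length
      have hflen := List.length_filter_le (fun X => decide (P X)) ((L.take i).map (insert v))
      simp only [List.length_append, List.length_map, List.length_take] at hlen hflen
      have htake : L.take (i + 1) = L.take i ++ [Y] := by simp [List.take_add_one, hY]
      refine ⟨fun hc => ?_, fun hc _ _ => ?_⟩
      · have hP : P (insert v Y) := by
          by_contra h
          simp [h7, h] at hc
        refine wp_seq ⟨by simpa [h32] using hS.set_lt hYn, ⟨hS.pow_lt ?_, fun _ _ => ?_⟩⟩
        · simp only [eval_add, eval_var, eval_const, Env.setArr_var]
          omega
        · have := (hJ₃.push (insert v Y)).of_eq (s' := ((t₃.setArr j (t₃.var l)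
            (enc (insert v Y))).setVar l (t₃.var l + 1)).setVar 28 (i + 1)) (by simp [hl28]) rfl
          simp only [eval_add, eval_var, eval_const, Env.setArr_var, h32]
          rw [htake, List.map_append, List.filter_append, ← List.append_assoc]
          simpa [hP] using this
      · have hP : ¬P (insert v Y) := by
          intro h
          simp [h7, h] at hc
        rw [htake, List.map_append, List.filter_append]
        have := hJ₃.of_eq (s' := t₃.setVar 28 (i + 1)) (by simp [hl28]) rfl
        simpa [hP] using this
    · rw [List.take_length] at hJ
      intro _ _
      exact hJ.of_eq (by simp [hl27]) rfl

open Classical in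
theorem wp_freeTest (hS : Setting C R n D) (hs : Ready n s) {A T : Finset ℕ} (hA : s.var 8 = enc A)
    (hAn : A ⊆ range n) (hT : s.var 20 = enc T) (hTn : T ⊆ range n) :
    wp C freeTest (fun t => t.var 24 = #(freeOf R A T) ∧
      ∀ a < n, t.arr 6 a = if a ∈ freeOf R A T then 1 else 0) s := by
  refine wp_seq ⟨hS.small_lt (by simp), ?_⟩
  have hfree : ∀ a < n, (∀ u < n, ¬(R a u ∧ u ∈ T)) ↔ ∀ u ∈ T, ¬R a u := fun a _ =>
    ⟨fun h u hu hR => h u (mem_range.1 (hTn hu)) ⟨hR, hu⟩, fun h u _ hc => h u hc.2 hc.1⟩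
  refine wp_loop n (by simp [hs.size]) hS.bound (by decide) (by simp [modVar]) (by simp [modVar])
    (fun x t => t.var 24 = #({a ∈ freeOf R A T | a < x}) ∧
      ∀ a < x, t.arr 6 a = if a ∈ freeOf R A T then 1 else 0) ?_ (fun x hx t hAg hx' hI => ?_) ?_
  · simp
  · have h1 : t.var 1 = n := by simp [hAg.var 1 (by simp [modVar]), hs.size]
    have h8 : t.var 8 = enc A := by simp [hAg.var 8 (by simp [modVar]), hA]
    have h20 : t.var 20 = enc T := by simp [hAg.var 20 (by simp [modVar]), hT]
    have hp : ∀ i ≤ n, t.arr 1 i = 2 ^ i := by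
      rw [hAg.arr 1 (by simp [modArr])]; exact hs.pow
    have e0 : (bit (var 8) (var 15)).eval t = if x ∈ A then 1 else 0 :=
      eval_bit h8 hx' (hp x hx.le)
    refine wp_seq ⟨by rw [e0]; exact hS.small_lt (by split_ifs <;> omega), ?_⟩
    rw [e0]
    refine wp_then (wp_flag_loop n (f := 23) (by simp [h1]) hS.bound (by decide) (by simp [modVar])
      (by simp [modVar]) (by decide) (fun u => ¬(R x u ∧ u ∈ T)) ?_) ?_
    · intro u hu t' hB hu'
      have h1' : t'.var 1 = n := by simp [hB.var 1 (by simp [modVar]), h1]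
      have h15 : t'.var 15 = x := by simp [hB.var 15 (by simp [modVar]), hx']
      have h20' : t'.var 20 = enc T := by simp [hB.var 20 (by simp [modVar]), h20]
      have hp' : ∀ i ≤ n, t'.arr 1 i = 2 ^ i := by
        rw [hB.arr 1 (by simp [modArr])]; exact hp
      refine wp_seq ⟨?_, ?_⟩
      · simpa [h1', h15, hu'] using hS.cell_lt hx hu
      · simp only [eval_add, eval_mul, eval_var, h1', h15, hu', hS.inp_eq hx hu]
        have e1 : ∀ b, (bit (var 20) (var 4)).eval (t'.setVar 6 b) = if u ∈ T then 1 else 0 :=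
          fun b => eval_bit (by simp [h20']) (by simp [hu']) (hp' u hu.le)
        by_cases c1 : R x u <;> by_cases c2 : u ∈ T <;> simp [wp, e1, c1, c2]
    · intro t' hB h23
      have h15 : t'.var 15 = x := by simp [hB.var 15 (by simp [modVar]), hx']
      have h24 : t'.var 24 = #({a ∈ freeOf R A T | a < x}) := by
        simp [hB.var 24 (by simp [modVar]), hI.1]
      have h6 : t'.arr 6 = t.arr 6 := hB.arr 6 (by simp [modArr])
      have h23' : t'.var 23 = if x ∈ freeOf R A T then 1 else 0 := by
        rw [h23]
        simp only [Env.setVar_var, if_true, freeOf, mem_filter, hfree x hx]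
        by_cases c1 : x ∈ A <;> by_cases c2 : ∀ u ∈ T, ¬R x u <;> simp [c1, c2]
      have hcard : #({a ∈ freeOf R A T | a < x + 1}) =
          #({a ∈ freeOf R A T | a < x}) + if x ∈ freeOf R A T then 1 else 0 := by
        rw [filter_lt_succ]
        split_ifs with h
        · rw [card_insert_of_notMem (by simp)]
        · rfl
      have hle : #({a ∈ freeOf R A T | a < x}) ≤ n := by
        refine (card_le_card ((filter_subset _ _).trans ((filter_subset _ _).trans hAn))).trans ?_
        simp
      refine wp_seq ⟨?_, ⟨?_, fun _ _ => ⟨?_, ?_⟩⟩⟩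
      · simp only [eval_var, h23']
        exact hS.small_lt (by split_ifs <;> omega)
      · simp only [eval_add, eval_var, Env.setArr_var, h23', h24]
        exact hS.small_lt (by split_ifs <;> omega)
      · rw [hcard]
        simp [h23', h24]
      · intro a ha
        simp only [eval_var, h15, h23', h6, Env.setVar_arr, Env.setArr_arr, true_and]
        rcases eq_or_ne a x with rfl | hax
        · simp
        · rw [if_neg hax]
          exact hI.2 a (by omega)
  · intro t _ _ hI
    refine ⟨?_, hI.2⟩
    rw [hI.1, filter_true_of_mem]
    intro a ha
    exact mem_range.1 (hAn (mem_filter.1 ha).1)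

end RAM

/-! ### Finding suitable sets `A` and `B`. -/

namespace RAM
open RAM.Expr RAM.Cmd

/-- The set `A` consists of vertices below `x` of degree at most `D` with disjoint closed
neighbourhoods outside `B`, it is maximal, and `U` is the set of used vertices. -/
structure Picked (R : ℕ → ℕ → Prop) (n D : ℕ) (B : Finset ℕ) (x : ℕ) (A U : Finset ℕ) : Prop where
  sub : A ⊆ range x
  disj : Disjoint A B
  deg : ∀ a ∈ A, #(nbrs R n a) ≤ D
  pairwise : (A : Set ℕ).PairwiseDisjoint (outerNbhd R n B)
  used : U = B ∪ A.biUnion (outerNbhd R n B)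
  max : ∀ y < x, y ∉ B → #(nbrs R n y) ≤ D → ¬Disjoint (outerNbhd R n B y) U

section

variable {R : ℕ → ℕ → Prop} {n D x : ℕ} {B A U : Finset ℕ}

theorem Picked.zero : Picked R n D B 0 ∅ B :=
  ⟨by simp, by simp, by simp, by simp, by simp, by simp⟩

theorem self_mem_outerNbhd (hx : x < n) (hB : x ∉ B) : x ∈ outerNbhd R n B x := by
  simp [outerNbhd, hx, hB]

theorem outerNbhd_subset : outerNbhd R n B x ⊆ range n := by
  intro u hu
  simp only [outerNbhd, mem_filter] at hu
  exact hu.1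

theorem nbrs_subset : nbrs R n x ⊆ range n := by
  intro u hu
  simp only [nbrs, mem_filter] at hu
  exact hu.1

theorem Picked.pick (h : Picked R n D B x A U) (hx : x < n) (hB : x ∉ B)
    (hd : Disjoint (outerNbhd R n B x) U) (hdeg : #(nbrs R n x) ≤ D) :
    Picked R n D B (x + 1) (insert x A) (U ∪ outerNbhd R n B x) where
  sub := by rw [range_add_one]; exact insert_subset_insert x h.sub
  disj := by rw [disjoint_insert_left]; exact ⟨hB, h.disj⟩
  deg := by
    intro a ha
    rcases mem_insert.1 ha with rfl | ha
    exacts [hdeg, h.deg a ha]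
  pairwise := by
    rw [coe_insert]
    refine h.pairwise.insert fun a ha _ => hd.mono_right ?_
    rw [h.used]
    exact (subset_biUnion_of_mem _ ha).trans subset_union_right
  used := by rw [biUnion_insert, h.used, union_assoc, union_comm (A.biUnion _)]
  max := by
    intro y hy hyB hyd
    rcases (Nat.lt_succ_iff.1 hy).eq_or_lt with rfl | hy
    · exact fun hc => disjoint_left.1 hc (self_mem_outerNbhd hx hB)
        (mem_union_right _ (self_mem_outerNbhd hx hB))
    · exact fun hc => h.max y hy hyB hyd (hc.mono_right subset_union_left)

theorem Picked.skip (h : Picked R n D B x A U)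
    (hx : ¬(x ∉ B ∧ Disjoint (outerNbhd R n B x) U ∧ #(nbrs R n x) ≤ D)) :
    Picked R n D B (x + 1) A U where
  sub := h.sub.trans (range_subset_range.2 (by omega))
  disj := h.disj
  deg := h.deg
  pairwise := h.pairwise
  used := h.used
  max := by
    intro y hy hyB hyd
    rcases (Nat.lt_succ_iff.1 hy).eq_or_lt with rfl | hy
    · exact fun hc => hx ⟨hyB, hc, hyd⟩
    · exact h.max y hy hyB hyd

theorem Picked.used_subset (h : Picked R n D B x A U) (hB : B ⊆ range n) : U ⊆ range n := by
  rw [h.used]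
  exact union_subset hB (biUnion_subset.2 fun a _ => outerNbhd_subset)

theorem card_outerNbhd_le (x : ℕ) : #(outerNbhd R n B x) ≤ #(nbrs R n x) + 1 := by
  classical
  refine (card_le_card (t := insert x (nbrs R n x)) fun u hu => ?_).trans (card_insert_le _ _)
  simp only [outerNbhd, nbrs, mem_filter, mem_insert] at hu ⊢
  tauto

theorem Picked.card_used_le (h : Picked R n D B x A U) : #U ≤ #B + (D + 1) * #A := by
  rw [h.used, mul_comm]
  refine (card_union_le _ _).trans (Nat.add_le_add_left ?_ _)
  exact card_biUnion_le_card_mul _ _ _ fun a ha =>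
    (card_outerNbhd_le a).trans (Nat.add_le_add_right (h.deg a ha) 1)

/-- By maximality the outer neighbourhood of `y` meets `U`, and the common vertices are lost when
`U` replaces `B`. This is the progress made by a failed round. -/
theorem Picked.card_outerNbhd_lt (h : Picked R n D B n A U) {y : ℕ} (hy : y < n) (hyU : y ∉ U)
    (hd : #(nbrs R n y) ≤ D) : #(outerNbhd R n U y) < #(outerNbhd R n B y) := by
  have hBU : B ⊆ U := by rw [h.used]; exact subset_union_left
  obtain ⟨u, hu, huU⟩ := not_disjoint_iff.1 (h.max y hy (fun hc => hyU (hBU hc)) hd)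
  refine card_lt_card ⟨fun w hw => ?_, fun hc => ?_⟩
  · simp only [outerNbhd, mem_filter] at hw ⊢
    exact ⟨hw.1, hw.2.1, fun hc => hw.2.2 (hBU hc)⟩
  · have := hc hu
    simp only [outerNbhd, mem_filter] at this
    exact this.2.2 huU

end

variable {C : Ctx} {R : ℕ → ℕ → Prop} {n D : ℕ} {s : Env} {Q : Env → Prop}

open Classical in
theorem wp_inspect (hS : Setting C R n D) (hs : Ready n s) {B U : Finset ℕ} {x : ℕ} (hx : x < n)
    (hBU : B ⊆ U) (hU : U ⊆ range n) (h15 : s.var 15 = x) (h9 : s.var 9 = enc B)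
    (h16 : s.var 16 = enc U) (h17 : s.var 17 = enc U) (h18 : s.var 18 = 0)
    (h19 : s.var 19 = if x ∈ B then 1 else 0) :
    wp C inspect (fun t => t.var 18 = #(nbrs R n x) ∧
      t.var 19 = (if x ∉ B ∧ Disjoint (outerNbhd R n B x) U then 0 else 1) ∧
      t.var 17 = enc (U ∪ outerNbhd R n B x)) s := by
  refine wp_loop n hs.size hS.bound (by decide) (by simp [modVar]) (by simp [modVar])
    (fun u t => t.var 18 = #({w ∈ nbrs R n x | w < u}) ∧
      t.var 19 = (if x ∉ B ∧ Disjoint {w ∈ outerNbhd R n B x | w < u} U then 0 else 1) ∧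
      t.var 17 = enc (U ∪ {w ∈ outerNbhd R n B x | w < u})) ?_ (fun u hu t hA hu' hI => ?_) ?_
  · by_cases hxB : x ∈ B <;> simp [h18, h19, h17, hxB]
  · have h1 : t.var 1 = n := by simp [hA.var 1 (by simp [modVar]), hs.size]
    have h15' : t.var 15 = x := by simp [hA.var 15 (by simp [modVar]), h15]
    have h9' : t.var 9 = enc B := by simp [hA.var 9 (by simp [modVar]), h9]
    have h16' : t.var 16 = enc U := by simp [hA.var 16 (by simp [modVar]), h16]
    have hp : ∀ i ≤ n, t.arr 1 i = 2 ^ i := by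
      rw [hA.arr 1 (by simp [modArr])]; exact hs.pow
    obtain ⟨i18, i19, i17⟩ := hI
    have hdeg : #({w ∈ nbrs R n x | w < u}) ≤ n :=
      (card_le_card ((filter_subset _ _).trans (filter_subset _ _))).trans (by simp)
    have hN : u ∈ nbrs R n x ↔ R x u := by simp [nbrs, hu]
    have hO : u ∈ outerNbhd R n B x ↔ (R x u ∨ u = x) ∧ u ∉ B := by simp [outerNbhd, hu]
    have hdeg' : #({w ∈ nbrs R n x | w < u + 1}) =
        #({w ∈ nbrs R n x | w < u}) + if R x u then 1 else 0 := by
      rw [filter_lt_succ]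
      by_cases h : R x u
      · rw [if_pos (hN.2 h), if_pos h, card_insert_of_notMem (by simp)]
      · rw [if_neg (fun hc => h (hN.1 hc)), if_neg h, add_zero]
    refine wp_seq ⟨?_, wp_seq ⟨?_, ?_⟩⟩
    · simpa [h1, h15', hu'] using hS.cell_lt hx hu
    · simp only [eval_add, eval_mul, eval_var, h1, h15', hu', hS.inp_eq hx hu, Env.setVar_var,
        i18]
      exact hS.small_lt (by split_ifs <;> simp_all <;> omega)
    · simp only [eval_add, eval_mul, eval_var, h1, h15', hu', hS.inp_eq hx hu]
      set t' := (t.setVar 6 (if R x u then 1 else 0)).setVar 18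
        ((t.setVar 6 (if R x u then 1 else 0)).var 18 +
          (t.setVar 6 (if R x u then 1 else 0)).var 6) with ht'
      have e1 : (bit (var 16) (var 4)).eval t' = if u ∈ U then 1 else 0 :=
        eval_bit (by simp [ht', h16']) (by simp [ht', hu']) (hp u hu.le)
      have e2 : (bit (var 9) (var 4)).eval t' = if u ∈ B then 1 else 0 :=
        eval_bit (by simp [ht', h9']) (by simp [ht', hu']) (hp u hu.le)
      have e3 : (eqTest (var 15) (var 4)).eval t' = if u = x then 1 else 0 := by
        simp [eval_eqTest, ht', hu', h15']
      have e6 : t'.var 6 = if R x u then 1 else 0 := by simp [ht']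
      have e18 : t'.var 18 = #({w ∈ nbrs R n x | w < u + 1}) := by
        rw [hdeg']; simp [ht', i18]
      have e19 : t'.var 19 = t.var 19 := by simp [ht']
      have e17 : t'.var 17 = t.var 17 := by simp [ht']
      have e4 : t'.var 4 = u := by simp [ht', hu']
      have ep : t'.arr 1 u = 2 ^ u := hp u hu.le
      have hsame : u ∉ outerNbhd R n B x →
          {w ∈ outerNbhd R n B x | w < u + 1} = {w ∈ outerNbhd R n B x | w < u} := fun h => by
        rw [filter_lt_succ, if_neg h]
      have hins : u ∈ outerNbhd R n B x →
          {w ∈ outerNbhd R n B x | w < u + 1} = insert u {w ∈ outerNbhd R n B x | w < u} :=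
        fun h => by rw [filter_lt_succ, if_pos h]
      clear_value t'
      refine ⟨fun hc => ⟨fun hcU => ⟨fun hcB _ _ => ?_, fun hcB => ?_⟩, fun hcU => ?_⟩,
        fun hc _ _ => ?_⟩
      · have hB : u ∈ B := by by_contra h; simp [e2, h] at hcB
        have hout : u ∉ outerNbhd R n B x := fun h => (hO.1 h).2 hB
        rw [hsame hout]
        exact ⟨by simpa using e18, by simpa [e19] using i19, by simpa [e17] using i17⟩
      · have hB : u ∉ B := by intro h; simp [e2, h] at hcB
        have huU : u ∈ U := by by_contra h; simp [e1, h] at hcU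
        have hnb : R x u ∨ u = x := by
          by_contra h
          push Not at h
          simp [e6, e3, h.1, h.2] at hc
        have hout : u ∈ outerNbhd R n B x := hO.2 ⟨hnb, hB⟩
        refine ⟨hS.small_lt (by simp), fun _ _ => ⟨by simpa using e18, ?_, ?_⟩⟩
        · rw [hins hout, if_neg]
          · simp
          · exact fun h => disjoint_left.1 h.2 (mem_insert_self u _) huU
        · rw [hins hout, union_insert, insert_eq_of_mem (mem_union_left _ huU)]
          simpa [e17] using i17
      · have huU : u ∉ U := by intro h; simp [e1, h] at hcU
        have hB : u ∉ B := fun h => huU (hBU h)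
        have hnb : R x u ∨ u = x := by
          by_contra h
          push Not at h
          simp [e6, e3, h.1, h.2] at hc
        have hout : u ∈ outerNbhd R n B x := hO.2 ⟨hnb, hB⟩
        have hval : eval t' (var 17 + get 1 (var 4)) =
            enc (insert u (U ∪ {w ∈ outerNbhd R n B x | w < u})) := by
          rw [enc_insert (by simp [huU])]
          simp [e17, i17, e4, ep]
        refine ⟨?_, fun _ _ => ⟨by simpa using e18, ?_, ?_⟩⟩
        · rw [hval]
          exact hS.set_lt (insert_subset (mem_range.2 hu)
            (union_subset hU ((filter_subset _ _).trans outerNbhd_subset)))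
        · simp only [hins hout, disjoint_insert_left]
          simpa [e19, huU] using i19
        · rw [hval, hins hout, union_insert]
          simp
      · have hout : u ∉ outerNbhd R n B x := by
          intro h
          rcases (hO.1 h).1 with h | h <;> simp [e6, e3, h] at hc
        rw [hsame hout]
        exact ⟨by simpa using e18, by simpa [e19] using i19, by simpa [e17] using i17⟩
  · intro t _ _ hI
    have h1 : ∀ S ⊆ range n, {w ∈ S | w < n} = S := fun S hS =>
      filter_true_of_mem fun w hw => mem_range.1 (hS hw)
    simp only [h1 _ (outerNbhd_subset (R := R) (B := B)), h1 _ (nbrs_subset (R := R))] at hI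
    exact hI

theorem wp_pick (hS : Setting C R n D) (hs : Ready n s) {B : Finset ℕ} (hB : B ⊆ range n)
    (h8 : s.var 8 = 0) (h9 : s.var 9 = enc B) (h10 : s.var 10 = 0) (h16 : s.var 16 = enc B) :
    wp C (pick D) (fun t => ∃ A U, t.var 8 = enc A ∧ t.var 10 = #A ∧ t.var 16 = enc U ∧
      Picked R n D B n A U) s := by
  classical
  refine wp_loop n hs.size hS.bound (by decide) (by simp [modVar]) (by simp [modVar])
    (fun x t => ∃ A U, t.var 8 = enc A ∧ t.var 10 = #A ∧ t.var 16 = enc U ∧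
      Picked R n D B x A U) ⟨∅, B, by simp [h8], by simp [h10], by simp [h16], Picked.zero⟩
    (fun x hx t hA hx' hI => ?_) fun t _ _ h => h
  obtain ⟨A, U, i8, i10, i16, hP⟩ := hI
  have hR : Ready n t := hs.of_agree hA (by simp [modVar]) (by simp [modArr])
  have h9' : t.var 9 = enc B := by simp [hA.var 9 (by simp [modVar]), h9]
  have hU := hP.used_subset hB
  have hBU : B ⊆ U := by rw [hP.used]; exact subset_union_left
  have hAn : A ⊆ range n := hP.sub.trans (range_subset_range.2 hx.le)
  have hxA : x ∉ A := fun h => by simpa using hP.sub h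
  have hcard : #A ≤ n := by simpa using card_le_card hAn
  have e1 : ∀ a, (bit (var 9) (var 15)).eval (t.setVar 18 a) = if x ∈ B then 1 else 0 := fun a =>
    eval_bit (by simp [h9']) (by simp [hx']) (hR.pow x hx.le)
  refine wp_seq ⟨hS.small_lt (by simp), wp_seq ⟨?_, wp_seq ⟨?_, ?_⟩⟩⟩
  · rw [e1]
    exact hS.small_lt (by split_ifs <;> omega)
  · simpa [i16] using hS.set_lt hU
  refine wp_then (wp_inspect (B := B) (U := U) (x := x) hS ⟨by simpa using hR.size, by exact hR.pow⟩ hx hBU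
    hU (by simpa using hx') (by simpa using h9') (by simpa using i16) (by simpa using i16)
    (by simp) (by simp [e1])) fun t' hB' hpost => ?_
  obtain ⟨p18, p19, p17⟩ := hpost
  have h8' : t'.var 8 = enc A := by simp [hB'.var 8 (by simp), i8]
  have h10' : t'.var 10 = #A := by simp [hB'.var 10 (by simp), i10]
  have h16' : t'.var 16 = enc U := by simp [hB'.var 16 (by simp), i16]
  have h15' : t'.var 15 = x := by simp [hB'.var 15 (by simp), hx']
  have hpow : t'.arr 1 x = 2 ^ x := by rw [hB'.arr 1 (by simp)]; exact hR.pow x hx.le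
  have hval : eval t' (var 8 + get 1 (var 15)) = enc (insert x A) := by
    rw [enc_insert hxA]
    simp [h8', h15', hpow]
  refine ⟨fun hc => ?_, fun hc _ _ => ⟨A, U, by simpa using h8', by simpa using h10',
    by simpa using h16', hP.skip fun h => ?_⟩⟩
  · have hpick : (x ∉ B ∧ Disjoint (outerNbhd R n B x) U) ∧ #(nbrs R n x) ≤ D := by
      simp only [eval_mul, eval_sub, eval_const, eval_var, p18, p19] at hc
      split_ifs at hc with h
      · exact ⟨h, by simp at hc; omega⟩
      · simp at hc
    refine wp_seq ⟨?_, wp_seq ⟨?_, ⟨?_, fun _ _ => ⟨insert x A, U ∪ outerNbhd R n B x, ?_, ?_, ?_,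
      hP.pick hx hpick.1.1 hpick.1.2 hpick.2⟩⟩⟩⟩
    · rw [hval]
      exact hS.set_lt (insert_subset (mem_range.2 hx) hAn)
    · simpa [h10'] using hS.small_lt (by omega)
    · simpa [p17] using hS.set_lt (union_subset hU outerNbhd_subset)
    · rw [hval]; simp
    · rw [card_insert_of_notMem hxA]
      simp [h10']
    · simp [p17]
  · have hc' : (1 - 0) * (D + 1 - #(nbrs R n x)) = 0 := by
      simpa [p18, p19, h.1, h.2.1] using hc
    have := h.2.2
    omega

/-- The sets `A` and `B` are suitable for the search. -/
structure Suitable (R : ℕ → ℕ → Prop) (n D q M : ℕ) (A B : Finset ℕ) : Prop where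
  subA : A ⊆ range n
  subB : B ⊆ range n
  disj : Disjoint A B
  deg : ∀ a ∈ A, #(nbrs R n a) ≤ D
  pairwise : (A : Set ℕ).PairwiseDisjoint (outerNbhd R n B)
  large : q * M * #B + n ≤ q * #A

/-- The potential is `q * b + n`, with `b` a bound for the size of `B`. A failed round means `q * a
≤ q * M * b + n`, so adding `(D + 1) * a` vertices to `B` multiplies the potential by a constant at
most. -/
theorem potential_step {q M D a b n m : ℕ} (hb : q * b + n ≤ m) (ha : q * a ≤ q * M * b + n) :
    q * (b + (D + 1) * a) + n ≤ ((D + 1) * M + D + 2) * m :=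
  calc q * (b + (D + 1) * a) + n = q * b + (D + 1) * (q * a) + n := by ring
    _ ≤ q * b + (D + 1) * (q * M * b + n) + n := by gcongr
    _ = ((D + 1) * M + 1) * (q * b) + (D + 2) * n := by ring
    _ ≤ ((D + 1) * M + D + 2) * (q * b) + ((D + 1) * M + D + 2) * n := by gcongr <;> omega
    _ = ((D + 1) * M + D + 2) * (q * b + n) := by ring
    _ ≤ _ := by gcongr

/-- After `r` failed rounds every low vertex outside `B` has an outer neighbourhood of size at most
`D + 1 - r`. After `D + 1` rounds it would be empty although it contains the vertex itself, and
`hlow` provides such a vertex as long as the potential is under control. -/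
theorem wp_findSets (hS : Setting C R n D) (hs : Ready n s) {q M : ℕ} (hb : D + 1 ≤ C.bound 14)
    (hlow : 0 < n → ∀ B ⊆ range n, q * #B + n ≤ ((D + 1) * M + D + 2) ^ (D + 1) * n →
      ∃ y < n, y ∉ B ∧ #(nbrs R n y) ≤ D) :
    wp C (findSets D q M) (fun t => ∃ A B, t.var 8 = enc A ∧ t.var 9 = enc B ∧ t.var 10 = #A ∧
      Suitable R n D q M A B) s := by
  have hnum : ∀ y ≤ (D + 1) * ((D + 1) * n), y < 2 ^ C.w := by
    intro y hy
    refine lt_of_le_of_lt hy (lt_of_le_of_lt ?_ hS.large)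
    rw [← mul_assoc]
    refine Nat.mul_le_mul (by nlinarith) ?_
    have : n < 2 ^ n := Nat.lt_two_pow_self
    exact this.le.trans (Nat.pow_le_pow_right (by norm_num) (by omega))
  refine wp_seq ⟨hS.small_lt (by simp), wp_seq ⟨hS.small_lt (by simp),
    wp_seq ⟨hS.small_lt (by simp), wp_seq ⟨?_, ?_⟩⟩⟩⟩
  · rw [eval_const]
    refine lt_of_le_of_lt ?_ hS.large
    have : 0 < 2 ^ (n * n + n + 1) := by positivity
    nlinarith
  refine wp_loop (D + 1) (by simp) hb (by decide) (by simp [modVar]) (by simp [modVar])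
    (fun r t => (t.var 12 ≠ 0 ∧ ∃ A B, t.var 8 = enc A ∧ t.var 9 = enc B ∧ t.var 10 = #A ∧
      Suitable R n D q M A B) ∨ (t.var 12 = 0 ∧ (r = 0 ∨ 0 < n) ∧ ∃ B, t.var 9 = enc B ∧
        B ⊆ range n ∧ #B ≤ t.var 11 ∧ t.var 11 ≤ r * ((D + 1) * n) ∧
        q * t.var 11 + n ≤ ((D + 1) * M + D + 2) ^ r * n ∧
        ∀ y < n, y ∉ B → #(nbrs R n y) ≤ D → #(outerNbhd R n B y) + r ≤ D + 1)) ?_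
    (fun r hr t hA _ hI => ?_) fun t _ _ hI => ?_
  · refine Or.inr ⟨by simp, Or.inl rfl, ∅, by simp, by simp, by simp, by simp, by simp,
      fun y _ _ hy => ?_⟩
    exact (card_outerNbhd_le y).trans (Nat.add_le_add_right hy 1)
  · refine ⟨fun hc _ _ => ?_, fun hc => ?_⟩
    · rcases hI with hI | hI
      · exact Or.inl (by simpa using hI)
      · exact absurd hI.1 hc
    · rcases hI with hI | ⟨-, -, B, h9, hBn, hB11, h11, hH, hout⟩
      · exact absurd hc hI.1
      have hR : Ready n t := hs.of_agree (vs := (findSets D q M).modVar) (as := []) (by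
        refine Agree.trans (s' := (((s.setVar 9 (eval s (const 0))).setVar 11 0).setVar 12 0).setVar
          14 (D + 1)) ⟨fun z hz => by simp_all, fun j _ => rfl⟩ (hA.mono ?_ (by simp [modArr]))
        intro z
        simp only [modVar, modVar_findSets, modVar_pick, List.mem_cons, List.mem_append,
          List.not_mem_nil, or_false]
        tauto) (by simp) (by simp)
      refine wp_seq ⟨hS.small_lt (by simp), wp_seq ⟨hS.small_lt (by simp), wp_seq ⟨?_, ?_⟩⟩⟩
      · simpa [h9] using hS.set_lt hBn
      refine wp_then (wp_pick (B := B) hS ⟨by simpa using hR.size, by exact hR.pow⟩ hBn (by simp)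
        (by simpa using h9) (by simp) (by simpa using h9)) fun t' hB' hpost => ?_
      obtain ⟨A, U, p8, p10, p16, hP⟩ := hpost
      have h9' : t'.var 9 = enc B := by simp [hB'.var 9 (by simp), h9]
      have h11' : t'.var 11 = t.var 11 := by simp [hB'.var 11 (by simp)]
      have h12' : t'.var 12 = 0 := by simpa [hB'.var 12 (by simp)] using hc
      have h1' : t'.var 1 = n := by simp [hB'.var 1 (by simp), hR.size]
      have hAn : #A ≤ n := by simpa using card_le_card hP.sub
      refine ⟨fun hc' => ?_, fun hc' => ?_⟩
      · refine ⟨hS.small_lt (by simp), fun _ _ => Or.inl ⟨by simp, A, B, by simpa using p8,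
          by simpa using h9', by simpa using p10, hP.sub, hBn, hP.disj, hP.deg, hP.pairwise, ?_⟩⟩
        simp only [eval_sub, eval_add, eval_mul, eval_const, eval_var, p10, h11', h1'] at hc'
        have := Nat.mul_le_mul_left (q * M) hB11
        omega
      · simp only [eval_sub, eval_add, eval_mul, eval_const, eval_var, p10, h11', h1'] at hc'
        have hUn := hP.used_subset hBn
        have hnew : t.var 11 + (D + 1) * #A ≤ (r + 1) * ((D + 1) * n) := by
          have := Nat.mul_le_mul_left (D + 1) hAn
          calc _ ≤ r * ((D + 1) * n) + (D + 1) * n := Nat.add_le_add h11 this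
            _ = _ := by ring
        refine wp_seq ⟨?_, ⟨?_, fun _ _ => Or.inr ⟨by simpa using h12', Or.inr ?_, U, ?_, hUn, ?_,
          ?_, ?_, ?_⟩⟩⟩
        · simp only [eval_add, eval_mul, eval_const, eval_var, p10, h11']
          exact hnum _ (hnew.trans (Nat.mul_le_mul_right _ (by omega)))
        · simpa [p16] using hS.set_lt hUn
        -- Without vertices the comparison holds trivially and the round succeeds, so a failure
        -- implies `0 < n`.
        · rcases Nat.eq_zero_or_pos n with rfl | h
          · simp only [mul_zero, nonpos_iff_eq_zero] at h11
            simp [h11] at hc'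
          · exact h
        · simp [p16]
        · have := hP.card_used_le
          simp only [eval_add, eval_mul, eval_const, eval_var, p10, h11', Env.setVar_var]
          simp only [Nat.reduceEqDiff, if_true, if_false]
          omega
        · simpa [p10, h11'] using hnew
        · have hval : q * (t.var 11 + (D + 1) * #A) + n ≤
              ((D + 1) * M + D + 2) ^ (r + 1) * n := by
            rw [pow_succ', mul_assoc]
            exact potential_step hH (by omega)
          simpa [p10, h11'] using hval
        · intro y hy hyU hyd
          have hBU : B ⊆ U := by rw [hP.used]; exact subset_union_left
          have h1 := hP.card_outerNbhd_lt hy hyU hyd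
          have h2 := hout y hy (fun h => hyU (hBU h)) hyd
          omega
  · rcases hI with ⟨-, hI⟩ | ⟨-, hn, B, -, hBn, hB11, -, hH, hout⟩
    · exact hI
    · exfalso
      obtain ⟨y, hy, hyB, hyd⟩ := hlow (by omega) B hBn
        ((Nat.add_le_add_right (Nat.mul_le_mul_left q hB11) n).trans hH)
      have h1 := hout y hy hyB hyd
      have h2 := card_pos.2 ⟨y, self_mem_outerNbhd (R := R) hy hyB⟩
      omega

end RAM

/-! ### Correctness of the transforms and of the search. -/

namespace RAM
open RAM.Expr RAM.Cmd

section

variable {C : Ctx} {R : ℕ → ℕ → Prop} {n D : ℕ} {s : Env} {L : List (Finset ℕ)}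

/-- `g` gives the entries before the pass and `f` those after it. The body may assume only that each
listed entry is in one of the two states, so nothing depends on the order of the list. -/
theorem wp_forEach_put (hS : Setting C R n D) (hL : Lists s 2 25 L) (hnd : L.Nodup)
    (hsub : ∀ X ∈ L, X ⊆ range n) (hb : L.length ≤ C.bound 25) {c : Cmd} {j : Fin 8}
    (hv : ∀ x ∈ [2, 25, 29], x ∉ c.modVar) (ha : 2 ∉ c.modArr) (f g : Finset ℕ → ℕ)
    (hg : ∀ X ∈ L, s.arr j (enc X) = g X)
    (hstep : ∀ X ∈ L, ∀ s', Agree (forEach c).modVar (forEach c).modArr s s' →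
      s'.var 2 = enc X → s'.arr j (enc X) = g X →
      (∀ Y ∈ L, s'.arr j (enc Y) = g Y ∨ s'.arr j (enc Y) = f Y) →
      wp C c (fun t => t.arr j (enc X) = f X ∧ ∀ i, i ≠ enc X → t.arr j i = s'.arr j i) s') :
    wp C (forEach c) (fun t => ∀ X ∈ L, t.arr j (enc X) = f X) s := by
  simp only [List.mem_cons, List.not_mem_nil, or_false, forall_eq_or_imp, forall_eq] at hv
  refine wp_loop L.length hL.length hb (by decide) (by simp [modVar, hv])
    (by simp [modVar, hv])
    (fun i t => ∀ k X, L[k]? = some X → t.arr j (enc X) = if k < i then f X else g X)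
    (fun k X hk => by simpa using hg X (List.mem_of_getElem? hk))
    (fun i hi t hA hx hI => ?_) fun t _ _ hI X hX => ?_
  · obtain ⟨X, hX⟩ : ∃ X, L[i]? = some X := ⟨L[i], List.getElem?_eq_getElem hi⟩
    have hXL := List.mem_of_getElem? hX
    have hval : eval t (get 2 (var 29)) = enc X := by
      simp only [eval_get, eval_var, hx]
      rw [hA.arr 2 (by simpa [modArr] using ha)]
      exact hL.get i X hX
    refine wp_seq ⟨by rw [hval]; exact hS.set_lt (hsub X hXL), ?_⟩
    rw [hval]
    refine wp_mono (hstep X hXL _ (hA.trans ⟨fun z hz => by simp_all [modVar], fun j _ => rfl⟩)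
      (by simp)
      (by simpa using hI i X hX) fun Y hY => ?_) fun t' ht' _ _ k Y hk => ?_
    · obtain ⟨k, hk⟩ := List.mem_iff_getElem?.1 hY
      have := hI k Y hk
      split_ifs at this
      exacts [Or.inr this, Or.inl this]
    · by_cases hki : k = i
      · subst hki
        obtain rfl : X = Y := by rw [hX] at hk; simpa using hk
        simpa using ht'.1
      · have hne : enc Y ≠ enc X := by
          intro h
          have hYX := enc_injective h
          have hlt : k < L.length := (List.getElem?_eq_some_iff.1 hk).1
          exact hki ((List.getElem?_inj hlt hnd).1 (by rw [hk, hX, hYX]))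
        have h1 := ht'.2 _ hne
        have h2 := hI k Y hk
        rw [Env.setVar_arr] at h1 ⊢
        rw [h1, h2]
        have : k < i ↔ k < i + 1 := by omega
        simp only [this]
  · obtain ⟨k, hk⟩ := List.mem_iff_getElem?.1 hX
    have hlt : k < L.length := (List.getElem?_eq_some_iff.1 hk).1
    simpa [hlt] using hI k X hk

/-- Updating in place is safe in any order: round `v` reads the entry of `X.erase v`, which lacks
`v` and so has the same value before and after the round. By `hdown` that entry belongs to the list.
-/
theorem wp_transform (hS : Setting C R n D) (hs : Ready n s) (hL : Lists s 2 25 L) (hnd : L.Nodup)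
    (hsub : ∀ X ∈ L, X ⊆ range n) (hdown : ∀ X ∈ L, ∀ v ∈ X, X.erase v ∈ L)
    (hb : L.length ≤ C.bound 25) {o : Op} {j : Fin 8} (hj1 : j ≠ 1) (hj2 : j ≠ 2)
    (h : ℕ → Finset ℕ → ℕ) (hlt : ∀ v, ∀ X ∈ L, h v X < 2 ^ C.w)
    (hmem : ∀ v, ∀ X ∈ L, v ∈ X → h (v + 1) X = o.eval (h v X) (h v (X.erase v)))
    (hnot : ∀ v, ∀ X ∈ L, v ∉ X → h (v + 1) X = h v X)
    (h0 : ∀ X ∈ L, s.arr j (enc X) = h 0 X) :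
    wp C (transform o j) (fun t => ∀ X ∈ L, t.arr j (enc X) = h n X) s := by
  refine wp_loop n hs.size hS.bound (by decide) (by simp [modVar]) (by simp [modVar])
    (fun v t => ∀ X ∈ L, t.arr j (enc X) = h v X) (by simpa using h0)
    (fun v hv t hA hx hI => ?_) fun t _ _ h => h
  have hR : Ready n t := hs.of_agree hA (by simp [modVar]) (by simp [modArr, Ne.symm hj1])
  have hL' : Lists t 2 25 L := hL.of_eq (hA.var 25 (by simp [modVar]))
    (hA.arr 2 (by simp [modArr, Ne.symm hj2]))
  refine wp_mono (wp_forEach_put hS hL' hnd hsub hb (by simp [modVar])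
    (by simp [modArr, Ne.symm hj2]) (h (v + 1)) (h v) hI fun X hX t' hB h2 hgX hor => ?_)
    fun t' ht' _ _ X hX => by simpa using ht' X hX
  have h30 : t'.var 30 = v := by rw [hB.var 30 (by simp [modVar]), hx]
  have hp : t'.arr 1 v = 2 ^ v := by
    rw [hB.arr 1 (by simp [modArr, Ne.symm hj1])]; exact hR.pow v hv.le
  have e1 : (bit (var 2) (var 30)).eval t' = if v ∈ X then 1 else 0 := eval_bit h2 h30 hp
  refine ⟨fun hc => ?_, fun hc => ⟨?_, fun _ _ => rfl⟩⟩
  · have hvX : v ∈ X := by by_contra h; simp [e1, h] at hc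
    have hidx : eval t' (var 2 - get 1 (var 30)) = enc (X.erase v) := by
      simp [h2, h30, hp, enc_erase hvX]
    have herase : t'.arr j (enc (X.erase v)) = h v (X.erase v) := by
      have := hor _ (hdown X hX v hvX)
      rw [hnot v _ (hdown X hX v hvX) (by simp)] at this
      simpa using this
    have hval : eval t' (.op o (get j (var 2)) (get j (var 2 - get 1 (var 30)))) = h (v + 1) X := by
      rw [hmem v X hX hvX]
      simp only [eval, hgX, h2]
      rw [← hgX, ← herase, ← hidx]
    refine ⟨by rw [hval]; exact hlt _ X hX, ?_, fun i hi => ?_⟩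
    · rw [hval]; simp [h2]
    · simp [h2, hi]
  · have hvX : v ∉ X := by intro h; simp [e1, h] at hc
    rw [hgX, hnot v X hX hvX]

variable (R n) in
/-- A set that has a cover by `k` independent sets and whose complement is independent. -/
def Splits (k : ℕ) (X : Finset ℕ) : Prop :=
  coverCount R k n X ≠ 0 ∧ Indep R (range n \ X)

theorem Setting.count_lt (hS : Setting C R n D) {x : ℕ} (hx : x ≤ 2 ^ (n * n)) : x < 2 ^ C.w :=
  hS.pow_lt (hx.trans (Nat.pow_le_pow_right (by norm_num) (by omega)))

theorem two_pow_le_two_pow_mul_self {n m : ℕ} (h : n ≤ m) : 2 ^ n ≤ 2 ^ (m * m) := by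
  refine Nat.pow_le_pow_right (by norm_num) ?_
  nlinarith [Nat.zero_le m, Nat.le_mul_self m]

theorem wp_initTables (hS : Setting C R n D) (hs : Ready n s) (hL : Lists s 2 25 L)
    (hnd : L.Nodup) (hsub : ∀ X ∈ L, X ⊆ range n) (hdown : ∀ X ∈ L, ∀ v ∈ X, X.erase v ∈ L)
    (hb : L.length ≤ C.bound 25) :
    wp C initTables (fun t => ∀ X ∈ L, t.arr 3 (enc X) = #(indepSubsets R X) ∧
      t.arr 4 (enc X) = 1) s := by
  classical
  refine wp_then (P := fun t => ∀ X ∈ L, t.arr 3 (enc X) = lowCount R 0 X)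
    (wp_forEach_put (j := 3) hS hL hnd hsub hb (by simp [modVar])
    -- The old contents are arbitrary, since searches for earlier `T` leave their tables behind.
    (by simp [modArr]) (lowCount R 0) (fun X => s.arr 3 (enc X)) (fun _ _ => rfl)
    fun X hX t hA h2 _ _ => ?_) fun t hA hI => ?_
  · refine wp_then (wp_indepTest hS (hs.of_agree hA (by simp [modVar]) (by simp [modArr])) h2
      (hsub X hX)) fun t' hB h3 => ⟨?_, ?_, fun i hi => ?_⟩
    · rw [eval_var, h3]
      exact hS.small_lt (by split_ifs <;> omega)
    · have h2' : t'.var 2 = enc X := by rw [hB.var 2 (by simp), h2]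
      simp [h2', h3, lowCount_zero]
    · have h2' : t'.var 2 = enc X := by rw [hB.var 2 (by simp), h2]
      simp [h2', hi, hB.arr 3]
  have hR : Ready n t := hs.of_agree hA (by simp [modVar]) (by simp [modArr])
  have hL' : Lists t 2 25 L := hL.of_eq (hA.var 25 (by simp [modVar])) (hA.arr 2 (by simp [modArr]))
  refine wp_then (wp_transform hS hR hL' hnd hsub hdown hb (by decide) (by decide) (lowCount R)
    (fun v X hX => hS.count_lt ((lowCount_le (hsub X hX) v).trans
      (two_pow_le_two_pow_mul_self le_rfl)))
    (fun v X _ hv => lowCount_succ hv) (fun v X _ hv => lowCount_succ_of_notMem hv) hI)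
    fun t' hA' hI' => ?_
  have hL'' : Lists t' 2 25 L := hL'.of_eq (hA'.var 25 (by simp)) (hA'.arr 2 (by simp))
  refine wp_mono (wp_frame (wp_forEach_put (j := 4) hS hL'' hnd hsub hb (by simp [modVar])
    (by simp [modArr]) (fun _ => 1) (fun X => t'.arr 4 (enc X)) (fun _ _ => rfl)
    fun X hX t'' hB h2 _ _ => ⟨hS.small_lt (by simp), by simp [h2], fun i hi => by simp [h2, hi]⟩))
    fun t'' ht'' X hX => ⟨?_, ht''.2 X hX⟩
  rw [ht''.1.arr 3 (by simp [modArr]), hI' X hX, lowCount_of_subset (hsub X hX)]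

/-- Variable `32` always holds a sufficient number of colours, because it is lowered to `k + 1` only
on the evidence of a set as in `colorableBelow_succ_of_coverCount`. Every such set on the list
forces it down to `k + 1` at least. -/
theorem wp_checkSets (hS : Setting C R n D) (hs : Ready n s) (hL : Lists s 2 25 L)
    (hsub : ∀ X ∈ L, X ⊆ range n) (hb : L.length ≤ C.bound 25) {k : ℕ} (hk : k < n)
    (h31 : s.var 31 = k) (h32 : ColorableBelow R n (s.var 32))
    (h5 : ∀ X ∈ L, s.arr 5 (enc X) = coverCount R k n X) :
    wp C checkSets (fun t => t.var 32 ≤ s.var 32 ∧ ColorableBelow R n (t.var 32) ∧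
      ∀ X ∈ L, Splits R n k X → t.var 32 ≤ k + 1) s := by
  classical
  refine wp_loop L.length hL.length hb (by decide) (by simp [modVar]) (by simp [modVar])
    (fun i t => t.var 32 ≤ s.var 32 ∧ ColorableBelow R n (t.var 32) ∧
      ∀ m < i, ∀ X, L[m]? = some X → Splits R n k X → t.var 32 ≤ k + 1)
    ⟨by simp, by simpa using h32, by simp⟩
    (fun i hi t hA hx hI => ?_) fun t _ _ hI => ⟨hI.1, hI.2.1, fun X hX hsp => ?_⟩
  · obtain ⟨X, hX⟩ : ∃ X, L[i]? = some X := ⟨L[i], List.getElem?_eq_getElem hi⟩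
    have hXL := List.mem_of_getElem? hX
    have hXn := hsub X hXL
    have hA' : Agree checkSets.modVar checkSets.modArr s t := hA.mono (by simp [modVar])
      (by simp [modArr])
    have hval : eval t (get 2 (var 29)) = enc X := by
      simp only [eval_get, eval_var, hx]
      rw [hA'.arr 2 (by simp)]
      exact hL.get i X hX
    have hR : Ready n t := hs.of_agree hA' (by simp) (by simp)
    have ht5 : t.arr 5 (enc X) = coverCount R k n X := by
      rw [hA'.arr 5 (by simp), h5 X hXL]
    have ht31 : t.var 31 = k := by rw [hA'.var 31 (by simp), h31]
    have hlast : ∀ t' : Env, t'.var 32 ≤ t.var 32 → ColorableBelow R n (t'.var 32) →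
        (Splits R n k X → t'.var 32 ≤ k + 1) → t'.var 32 ≤ s.var 32 ∧
        ColorableBelow R n (t'.var 32) ∧ ∀ m < i + 1, ∀ X, L[m]? = some X → Splits R n k X →
          t'.var 32 ≤ k + 1 := by
      intro t' hle hcol hspl
      refine ⟨hle.trans hI.1, hcol, fun m hm Y hY hsp => ?_⟩
      rcases (Nat.lt_succ_iff.1 hm).eq_or_lt with rfl | hm
      · obtain rfl : X = Y := by rw [hX] at hY; simpa using hY
        exact hspl hsp
      · exact hle.trans (hI.2.2 m hm Y hY hsp)
    refine wp_seq ⟨by rw [hval]; exact hS.set_lt hXn, ?_⟩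
    rw [hval]
    refine ⟨fun hc => ?_, fun hc _ _ => hlast _ (by simp) (by simpa using hI.2.1) fun hsp => ?_⟩
    · have hcov : coverCount R k n X ≠ 0 := by simpa [ht5] using hc
      have hval2 : eval (t.setVar 2 (enc X)) (get 1 (var 1) - const 1 - var 2) =
          enc (range n \ X) := by
        rw [enc_sdiff hXn]
        simp [hR.size, hR.pow n le_rfl]
      refine wp_seq ⟨by rw [hval2]; exact hS.set_lt sdiff_subset, ?_⟩
      rw [hval2]
      refine wp_then (wp_indepTest hS (X := range n \ X) ⟨by simpa using hR.size, by exact hR.pow⟩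
        (by simp) sdiff_subset) fun t' hB h3 => ?_
      have h31' : t'.var 31 = k := by simp [hB.var 31, ht31]
      have h32' : t'.var 32 = t.var 32 := by simp [hB.var 32]
      refine ⟨fun hc' => ⟨?_, fun _ _ => hlast _ ?_ ?_ ?_⟩, fun hc' _ _ => hlast _ ?_ ?_ ?_⟩
      · simpa [h31'] using hS.small_lt (x := k + 1) (by omega)
      · have := right_ne_zero_of_mul hc'
        simp only [eval_sub, eval_add, eval_var, eval_const, h31', h32'] at this
        simp [h31']
        omega
      · have hind : Indep R (range n \ X) := by
          have := left_ne_zero_of_mul hc'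
          by_contra h
          simp [h3, h] at this
        simpa [h31'] using colorableBelow_succ_of_coverCount hXn hcov hind
      · simp [h31']
      · simp [h32']
      · simpa [h32'] using hI.2.1
      · intro hsp
        simp only [eval_mul, eval_sub, eval_add, eval_var, eval_const, h31', h32', h3, hsp.2,
          if_true, one_mul] at hc'
        simp [h32']
        omega
    · exact absurd (by simpa [ht5] using hc) hsp.1
  · obtain ⟨m, hm⟩ := List.mem_iff_getElem?.1 hX
    exact hI.2.2 m (List.getElem?_eq_some_iff.1 hm).1 X hm hsp

theorem wp_tryColors (hS : Setting C R n D) (hs : Ready n s) (hL : Lists s 2 25 L)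
    (hnd : L.Nodup) (hsub : ∀ X ∈ L, X ⊆ range n) (hdown : ∀ X ∈ L, ∀ v ∈ X, X.erase v ∈ L)
    (hb : L.length ≤ C.bound 25) (h32 : ColorableBelow R n (s.var 32))
    (h34 : ∀ X ∈ L, s.arr 3 (enc X) = #(indepSubsets R X) ∧ s.arr 4 (enc X) = 1) :
    wp C tryColors (fun t => t.var 32 ≤ s.var 32 ∧ ColorableBelow R n (t.var 32) ∧
      ∀ k < n, ∀ X ∈ L, Splits R n k X → t.var 32 ≤ k + 1) s := by
  -- `k = n` is included because the last round still computes the powers for a round that does not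
  -- take place.
  have hpow : ∀ k ≤ n, ∀ X ∈ L, #(indepSubsets R X) ^ k < 2 ^ C.w := by
    intro k hk X hX
    rw [← coverCount_zero]
    exact hS.count_lt ((coverCount_le (hsub X hX) k 0).trans
      (Nat.pow_le_pow_right (by norm_num) (Nat.mul_le_mul_left n hk)))
  refine wp_loop n hs.size hS.bound (by decide) (by simp [modVar]) (by simp [modVar])
    (fun k t => (t.var 32 ≤ s.var 32 ∧ ColorableBelow R n (t.var 32) ∧
      ∀ k' < k, ∀ X ∈ L, Splits R n k' X → t.var 32 ≤ k' + 1) ∧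
      ∀ X ∈ L, t.arr 4 (enc X) = #(indepSubsets R X) ^ k)
    ⟨⟨by simp, by simpa using h32, by simp⟩, fun X hX => by simpa using (h34 X hX).2⟩
    (fun k hk t hA hx hI => ?_) fun t _ _ hI => hI.1
  have hA' : Agree tryColors.modVar tryColors.modArr s t := hA.mono (by simp [modVar])
    (by simp [modArr])
  have hR : Ready n t := hs.of_agree hA' (by simp) (by simp)
  have hL' : Lists t 2 25 L := hL.of_eq (hA'.var 25 (by simp)) (hA'.arr 2 (by simp))
  have h3 : ∀ X ∈ L, t.arr 3 (enc X) = #(indepSubsets R X) := fun X hX => by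
    rw [hA'.arr 3 (by simp), (h34 X hX).1]
  refine wp_then (P := fun t => ∀ X ∈ L, t.arr 5 (enc X) = coverCount R k 0 X)
    (wp_forEach_put (j := 5) hS hL' hnd hsub hb (by simp [modVar]) (by simp [modArr])
    (coverCount R k 0) (fun X => t.arr 5 (enc X)) (fun _ _ => rfl)
    fun X hX t₁ hB h2 _ _ => ?_) fun t₁ hB₁ h5 => ?_
  · have h4 : t₁.arr 4 (enc X) = coverCount R k 0 X := by
      rw [hB.arr 4 (by simp [modArr]), hI.2 X hX, coverCount_zero]
    refine ⟨?_, ?_, fun i hi => by simp [h2, hi]⟩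
    · simp only [eval_get, eval_var, h2, h4, coverCount_zero]
      exact hpow k hk.le X hX
    · simp [h2, h4]
  have hR₁ : Ready n t₁ := hR.of_agree hB₁ (by simp [modVar]) (by simp [modArr])
  have hL₁ : Lists t₁ 2 25 L :=
    hL'.of_eq (hB₁.var 25 (by simp [modVar])) (hB₁.arr 2 (by simp [modArr]))
  refine wp_then (wp_transform hS hR₁ hL₁ hnd hsub hdown hb (by decide) (by decide)
    (coverCount R k) (fun v X hX => hS.count_lt ((coverCount_le (hsub X hX) k v).trans
      (Nat.pow_le_pow_right (by norm_num) (Nat.mul_le_mul_left n hk.le))))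
    (fun v X _ hv => coverCount_succ hv) (fun v X _ hv => coverCount_succ_of_notMem hv) h5)
    fun t₂ hB₂ h5' => ?_
  have hR₂ : Ready n t₂ := hR₁.of_agree hB₂ (by simp) (by simp)
  have hL₂ : Lists t₂ 2 25 L := hL₁.of_eq (hB₂.var 25 (by simp)) (hB₂.arr 2 (by simp))
  have h32₂ : t₂.var 32 = t.var 32 := by
    rw [hB₂.var 32 (by simp), hB₁.var 32 (by simp [modVar])]
  refine wp_then (wp_checkSets hS hR₂ hL₂ hsub hb hk
    (by rw [hB₂.var 31 (by simp), hB₁.var 31 (by simp [modVar]), hx])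
    (by rw [h32₂]; exact hI.1.2.1) h5') fun t₃ hB₃ h6 => ?_
  have hL₃ : Lists t₃ 2 25 L := hL₂.of_eq (hB₃.var 25 (by simp)) (hB₃.arr 2 (by simp))
  have h4₃ : t₃.arr 4 = t.arr 4 := by
    rw [hB₃.arr 4 (by simp), hB₂.arr 4 (by simp), hB₁.arr 4 (by simp [modArr])]
  have h3₃ : t₃.arr 3 = t.arr 3 := by
    rw [hB₃.arr 3 (by simp), hB₂.arr 3 (by simp), hB₁.arr 3 (by simp [modArr])]
  refine wp_mono (wp_frame (wp_forEach_put (j := 4) hS hL₃ hnd hsub hb (by simp [modVar])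
    (by simp [modArr]) (fun X => #(indepSubsets R X) ^ (k + 1)) (fun X => #(indepSubsets R X) ^ k)
    (fun X hX => by rw [h4₃]; exact hI.2 X hX) fun X hX t₄ hB₄ h2 h4 _ => ?_)) fun t₅ h7 _ _ => ?_
  · have h3' : t₄.arr 3 (enc X) = #(indepSubsets R X) := by
      rw [hB₄.arr 3 (by simp [modArr]), h3₃, h3 X hX]
    have hval : eval t₄ (get 4 (var 2) * get 3 (var 2)) = #(indepSubsets R X) ^ (k + 1) := by
      simp only [eval_mul, eval_get, eval_var, h2, h4, h3', pow_succ]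
    refine ⟨by rw [hval]; exact hpow (k + 1) hk X hX, ?_, fun i hi => by simp [h2, hi]⟩
    rw [hval]
    simp [h2]
  · have h32₅ : t₅.var 32 = t₃.var 32 := h7.1.var 32 (by simp [modVar])
    refine ⟨?_, by simpa using h7.2⟩
    simp only [Env.setVar_var, Nat.reduceEqDiff, if_false, h32₅]
    refine ⟨(h6.1.trans h32₂.le).trans hI.1.1, h6.2.1, fun k' hk' X hX hsp => ?_⟩
    rcases (Nat.lt_succ_iff.1 hk').eq_or_lt with rfl | hk'
    · exact h6.2.2 X hX hsp
    · exact (h6.1.trans h32₂.le).trans (hI.1.2.2 k' hk' X hX hsp)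

variable (R n) in
/-- The set `X` contains no closed neighbourhood outside `B` of an element of `F`. -/
def Avoids (B F X : Finset ℕ) : Prop := ∀ a ∈ F, ¬outerNbhd R n B a ⊆ X

/-- The list is built only if there are many free vertices, since only then is it known to be short.
Other `T` can be passed over, as `exists_cover_of_colorableBelow` never produces them. -/
theorem wp_searchOne (hS : Setting C R n D) (hs : Ready n s) {q M : ℕ} {A B T : Finset ℕ}
    (hAB : Suitable R n D q M A B) (h8 : s.var 8 = enc A) (h9 : s.var 9 = enc B)
    (h10 : s.var 10 = #A) (hT : T ⊆ B) (h7 : s.arr 7 (s.var 21) = enc T)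
    (h32 : ColorableBelow R n (s.var 32))
    (hb : #A ≤ #(freeOf R A T) * (D + 1) →
      (subsetList (Avoids R n B (freeOf R A T)) n).length ≤ min (C.bound 25) (C.bound 26)) :
    wp C (searchOne D) (fun t => t.var 32 ≤ s.var 32 ∧ ColorableBelow R n (t.var 32) ∧
      (#A ≤ #(freeOf R A T) * (D + 1) → ∀ k < n, ∀ X ⊆ range n, Avoids R n B (freeOf R A T) X →
        Splits R n k X → t.var 32 ≤ k + 1)) s := by
  classical
  have hTn : T ⊆ range n := hT.trans hAB.subB
  refine wp_seq ⟨by simpa [h7] using hS.set_lt hTn, ?_⟩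
  refine wp_then (wp_freeTest (A := A) (T := T) hS ⟨by simpa using hs.size, by exact hs.pow⟩
    (by simpa using h8) hAB.subA (by simp [h7]) hTn) fun t hA hpost => ?_
  obtain ⟨h24, h6⟩ := hpost
  have ht10 : t.var 10 = #A := by simp [hA.var 10, h10]
  have ht9 : t.var 9 = enc B := by simp [hA.var 9, h9]
  have ht32 : t.var 32 = s.var 32 := by simp [hA.var 32]
  have hR : Ready n t := Ready.of_agree (s := s.setVar 20 (eval s (get 7 (var 21))))
    ⟨by simpa using hs.size, by exact hs.pow⟩ hA (by simp) (by simp)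
  set F := freeOf R A T with hF
  have hFA : F ⊆ A := fun a ha => by
    rw [hF, freeOf, mem_filter] at ha
    exact ha.1
  have h0 : Avoids R n B F ∅ := fun a ha hc => by
    have h1 := self_mem_outerNbhd (R := R) (mem_range.1 (hAB.subA (hFA ha)))
      (disjoint_left.1 hAB.disj (hFA ha))
    simpa using hc h1
  have hdown : ∀ X Y, X ⊆ Y → Avoids R n B F Y → Avoids R n B F X :=
    fun X Y hXY hY a ha hc => hY a ha (hc.trans hXY)
  set L := subsetList (Avoids R n B F) n with hLdef
  have hmem : ∀ X, X ∈ L ↔ X ⊆ range n ∧ Avoids R n B F X := fun X => mem_subsetList h0 hdown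
  refine ⟨fun hc => ?_, fun hc => ⟨ht32.le, ht32 ▸ h32, fun h => ?_⟩⟩
  · have hq : #A ≤ #F * (D + 1) := by
      simp only [eval_sub, eval_add, eval_mul, eval_var, eval_const, h24, ht10] at hc
      omega
    have hb' := hb hq
    refine wp_then (wp_listSets (P := Avoids R n B F) hS hR (by decide) (by simp) (by simp)
      (by simp) (by simp) (hb'.trans (min_le_right _ _)) fun t' hA' hR' X hX h2 => ?_)
      fun t₁ hA₁ hL => ?_
    · exact wp_mono (wp_avoidTest hS hR' h2 (by rw [hA'.var 9 (by simp), ht9])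
        (hFA.trans hAB.subA) (by rw [hA'.arr 6 (by simp)]; exact h6))
        fun t ht => ht.trans (if_congr Iff.rfl rfl rfl)
    have hR₁ : Ready n t₁ := hR.of_agree hA₁ (by simp) (by simp)
    have hsub : ∀ X ∈ L, X ⊆ range n := fun X hX => ((hmem X).1 hX).1
    have hdown' : ∀ X ∈ L, ∀ v ∈ X, X.erase v ∈ L := fun X hX v _ => by
      rw [hmem] at hX ⊢
      exact ⟨(erase_subset v X).trans hX.1, hdown _ _ (erase_subset v X) hX.2⟩
    have hbL := hb'.trans (min_le_left _ _)
    refine wp_then (wp_initTables hS hR₁ hL (nodup_subsetList n) hsub hdown' hbL)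
      fun t₂ hA₂ h34 => ?_
    have ht32₂ : t₂.var 32 = s.var 32 := by
      rw [hA₂.var 32 (by simp), hA₁.var 32 (by simp), ht32]
    refine wp_mono (wp_tryColors hS (hR₁.of_agree hA₂ (by simp) (by simp))
      (hL.of_eq (hA₂.var 25 (by simp)) (hA₂.arr 2 (by simp))) (nodup_subsetList n) hsub hdown' hbL
      (ht32₂ ▸ h32) h34) fun t₃ h => ⟨h.1.trans ht32₂.le, h.2.1, fun _ k hk X hX hav hsp => ?_⟩
    exact h.2.2 k hk X ((hmem X).2 ⟨hX, hav⟩) hsp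
  · simp only [eval_sub, eval_add, eval_mul, eval_var, eval_const, h24, ht10] at hc
    omega

theorem colorableBelow_self (hirr : ∀ u, ¬R u u) : ColorableBelow R n n :=
  ⟨id, fun _ hu => hu, fun u _ v _ hR h => hirr u (by simp only [id] at h; rwa [← h] at hR)⟩

theorem wp_setup (hS : Setting C R n D) (hn : s.var 0 = n) {q M : ℕ} (hb14 : D + 1 ≤ C.bound 14)
    (hlow : 0 < n → ∀ B ⊆ range n, q * #B + n ≤ ((D + 1) * M + D + 2) ^ (D + 1) * n →
      ∃ y < n, y ∉ B ∧ #(nbrs R n y) ≤ D) :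
    wp C (setup D q M) (fun t => Ready n t ∧ ∃ A B, t.var 8 = enc A ∧ t.var 9 = enc B ∧
      t.var 10 = #A ∧ Suitable R n D q M A B) s := by
  refine wp_seq ⟨by simpa [hn] using hS.small_lt (x := n) (by omega), ?_⟩
  refine wp_then (wp_powTable hS (by simp [hn])) fun t₁ _ hR₁ => ?_
  exact wp_mono (wp_frame (wp_findSets hS hR₁ hb14 hlow)) fun t₂ h =>
    ⟨hR₁.of_agree h.1 (by simp) (by simp), h.2⟩

theorem wp_search {t₂ : Env} (hS : Setting C R n D) (hR₂ : Ready n t₂)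
    (hsym : ∀ u v, R u v → R v u) (hirr : ∀ u, ¬R u u) {q M : ℕ} {A B : Finset ℕ}
    (hAB : Suitable R n D q M A B) (h8 : t₂.var 8 = enc A) (h9 : t₂.var 9 = enc B)
    (h10 : t₂.var 10 = #A) (hbT : 2 ^ #B ≤ min (C.bound 22) (C.bound 34))
    (hbL : ∀ T ⊆ B, #A ≤ #(freeOf R A T) * (D + 1) →
      (subsetList (Avoids R n B (freeOf R A T)) n).length ≤ min (C.bound 25) (C.bound 26)) :
    wp C (search D)
      (fun t => ColorableBelow R n (t.var 0) ∧ ∀ k, ColorableBelow R n k → t.var 0 ≤ k) t₂ := by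
  classical
  set L := subsetList (fun X => X ⊆ B) n with hLdef
  have hmem : ∀ X, X ∈ L ↔ X ⊆ range n ∧ X ⊆ B := fun X =>
    mem_subsetList (by simp) (fun X Y hXY hY => hXY.trans hY)
  have hlen : L.length ≤ 2 ^ #B := by
    rw [← List.toFinset_card_of_nodup (nodup_subsetList n), ← card_powerset]
    exact card_le_card fun X hX => mem_powerset.2 ((hmem X).1 (List.mem_toFinset.1 hX)).2
  have hlen' := hlen.trans hbT
  refine wp_then (wp_listSets (P := fun X => X ⊆ B) hS hR₂ (by decide) (by simp) (by simp)
    (by simp) (by simp) (hlen'.trans (min_le_right _ _)) fun t' hA' hR' X hX h2 => ?_)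
    fun t₃ hA₃ hL => ?_
  · exact wp_mono (wp_subsetTest hS hR' h2 hX (by rw [hA'.var 9 (by simp), h9]))
      fun t ht => ht.trans (by congr)
  have hR₃ : Ready n t₃ := hR₂.of_agree hA₃ (by simp) (by simp)
  refine wp_seq ⟨by simpa [hR₃.size] using hS.small_lt (x := n) (by omega), ?_⟩
  refine wp_seq ?_
  refine wp_loop L.length (by simpa using hL.length) (hlen'.trans (min_le_left _ _)) (by decide)
    (by simp [searchOne, modVar]) (by simp [searchOne, modVar])
    (fun i t => t.var 32 ≤ n ∧ ColorableBelow R n (t.var 32) ∧ ∀ m < i, ∀ T, L[m]? = some T →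
      #A ≤ #(freeOf R A T) * (D + 1) → ∀ k < n, ∀ X ⊆ range n, Avoids R n B (freeOf R A T) X →
        Splits R n k X → t.var 32 ≤ k + 1)
    ⟨by simp [hR₃.size], by simpa [hR₃.size] using colorableBelow_self hirr, by simp⟩
    (fun i hi t hA hx hI => ?_) fun t hA _ hI => ?_
  · obtain ⟨T, hT⟩ : ∃ T, L[i]? = some T := ⟨L[i], List.getElem?_eq_getElem hi⟩
    have hTB : T ⊆ B := ((hmem T).1 (List.mem_of_getElem? hT)).2
    have hAr : ∀ j ∈ [(1 : Fin 8), 7], t.arr j = t₃.arr j := fun j hj => by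
      rw [hA.arr j (by fin_cases hj <;> simp [searchOne, modArr])]
      rfl
    have hVr : ∀ x ∈ [1, 8, 9, 10], t.var x = t₃.var x := fun x hx => by
      rw [hA.var x (by fin_cases hx <;> simp [searchOne, modVar])]
      fin_cases hx <;> simp
    refine wp_mono (wp_searchOne hS ⟨by rw [hVr 1 (by simp), hR₃.size],
      by rw [hAr 1 (by simp)]; exact hR₃.pow⟩ hAB
      (by rw [hVr 8 (by simp), hA₃.var 8 (by simp), h8])
      (by rw [hVr 9 (by simp), hA₃.var 9 (by simp), h9])
      (by rw [hVr 10 (by simp), hA₃.var 10 (by simp), h10]) hTB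
      (by rw [hAr 7 (by simp), hx]; exact hL.get i T hT) hI.2.1 (hbL T hTB))
      fun t' h _ _ => ?_
    simp only [Env.setVar_var, Nat.reduceEqDiff, if_false]
    refine ⟨h.1.trans hI.1, h.2.1, fun m hm T' hT' => ?_⟩
    rcases (Nat.lt_succ_iff.1 hm).eq_or_lt with rfl | hm
    · obtain rfl : T = T' := by rw [hT] at hT'; simpa using hT'
      exact h.2.2
    · exact fun h1 k hk X hX h2 h3 => h.1.trans (hI.2.2 m hm T' hT' h1 k hk X hX h2 h3)
  · refine ⟨by simpa using hS.small_lt (hI.1.trans (Nat.le_succ n)), ?_, fun k hk => ?_⟩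
    · simpa using hI.2.1
    · simp only [eval_var, Env.setVar_var, if_true]
      rcases lt_or_ge n k with hnk | hnk
      · exact hI.1.trans hnk.le
      rcases Nat.eq_zero_or_pos k with rfl | hk0
      -- Zero colours suffice only if there are no vertices; the combinatorial lemma needs a colour
      -- class to remove.
      · obtain ⟨c, hc, -⟩ := hk
        have : n = 0 := by
          by_contra h
          simpa using hc 0 (by omega)
        exact hI.1.trans this.le
      · obtain ⟨k, rfl⟩ : ∃ k', k = k' + 1 := ⟨k - 1, by omega⟩
        obtain ⟨T, hT, hcard, X, hX, hav, hcov, hind⟩ :=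
          exists_cover_of_colorableBelow hsym hirr hk hAB.subA hAB.subB hAB.disj hAB.deg
        -- The trace `T` of that colour class is on the list, so its round has taken `X` into
        -- account.
        obtain ⟨m, hm⟩ := List.mem_iff_getElem?.1 ((hmem T).2 ⟨hT.trans hAB.subB, hT⟩)
        exact hI.2.2 m (List.getElem?_eq_some_iff.1 hm).1 T hm hcard k (by omega) X hX hav
          ⟨hcov, hind⟩

end

end RAM

/-! ### Cost bounds up to polynomial factors. -/

namespace RAM
open RAM.Expr RAM.Cmd

/-- The function `f` is bounded by `g` up to a factor that is polynomial in `N`. -/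
def Dom {ι : Type} (N f g : ι → ℕ) : Prop := ∃ K m : ℕ, ∀ p, f p ≤ K * (N p + 1) ^ m * g p

namespace Dom

variable {ι : Type} {N f f' g g' : ι → ℕ}

theorem add (h : Dom N f g) (h' : Dom N f' g) : Dom N (fun p => f p + f' p) g := by
  obtain ⟨K, m, h⟩ := h
  obtain ⟨K', m', h'⟩ := h'
  refine ⟨K + K', m + m', fun p => ?_⟩
  have e1 : (N p + 1) ^ m ≤ (N p + 1) ^ (m + m') := Nat.pow_le_pow_right (by omega) (by omega)
  have e2 : (N p + 1) ^ m' ≤ (N p + 1) ^ (m + m') := Nat.pow_le_pow_right (by omega) (by omega)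
  beta_reduce
  rw [add_mul, add_mul]
  gcongr
  · exact (h p).trans (by gcongr)
  · exact (h' p).trans (by gcongr)

theorem mul (h : Dom N f g) (h' : Dom N f' g') :
    Dom N (fun p => f p * f' p) (fun p => g p * g' p) := by
  obtain ⟨K, m, h⟩ := h
  obtain ⟨K', m', h'⟩ := h'
  refine ⟨K * K', m + m', fun p => (Nat.mul_le_mul (h p) (h' p)).trans (le_of_eq ?_)⟩
  rw [pow_add]
  ring

theorem mono (h : Dom N f g) (hg : ∀ p, g p ≤ g' p) : Dom N f g' := by
  obtain ⟨K, m, h⟩ := h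
  exact ⟨K, m, fun p => (h p).trans (by gcongr; exact hg p)⟩

theorem const (a : ℕ) : Dom N (fun _ => a) (fun _ => 1) := ⟨a, 0, fun p => by simp⟩

theorem mul_one (h : Dom N f fun _ => 1) (h' : Dom N f' fun _ => 1) :
    Dom N (fun p => f p * f' p) (fun _ => 1) := by
  simpa using h.mul h'

theorem of_one (h : Dom N f fun _ => 1) (hg : ∀ p, 1 ≤ g p) : Dom N f g := h.mono hg

end Dom

section

variable {ι : Type} {N w : ι → ℕ}

theorem dom_bits (hw : Dom N w fun _ => 1) (e : Expr) :
    Dom N (fun p => e.bits (w p)) fun _ => 1 := by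
  induction e with
  | var x => exact hw
  | const c => exact .const _
  | op o a b iha ihb => exact (iha.add ihb).add (.const 1)
  | get j e ih => exact hw

theorem dom_addrCost (hw : Dom N w fun _ => 1) {b : ι → ℕ} (hb : Dom N b fun _ => 1) :
    Dom N (fun p => addrCost (w p) (b p)) fun _ => 1 :=
  (((((Dom.const 5).add (((Dom.const 1).add hb).mul_one (.const 5))).add (.const 5)).add
    ((hb.add (.const 6)).mul_one (.const 5))).add
    ((hb.add (.const 11)).mul_one ((Dom.const 1).add hw)))

theorem dom_exprCost (hw : Dom N w fun _ => 1) (e : Expr) :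
    Dom N (fun p => e.cost (w p)) fun _ => 1 := by
  induction e with
  | var x => exact (Dom.const 1).add hw
  | const c => exact .const _
  | op o a b iha ihb =>
    exact iha.add (ihb.add (((Dom.const 1).add (dom_bits hw a)).mul_one
      ((Dom.const 1).add (dom_bits hw b))))
  | get j e ih =>
    have hb := dom_bits hw e
    exact ih.add ((dom_addrCost hw hb).add (((Dom.const 1).add ((hb.add hw).add (.const 11))).add
      hw))

/-- The number of elementary commands executed in a run, where `G y` replaces the limit `y` of a
loop. -/
def Cmd.weight (G : ℕ → ℕ) : Cmd → ℕ
  | seq c d | ite _ c d => c.weight G + d.weight G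
  | loop _ y c => G y * c.weight G
  | _ => 1

theorem Cmd.one_le_weight {G : ℕ → ℕ} (hG : ∀ y, 1 ≤ G y) (c : Cmd) : 1 ≤ c.weight G := by
  induction c with
  | skip | assign | put | input => exact le_rfl
  | seq c d ih _ => exact ih.trans (Nat.le_add_right _ _)
  | ite e c d ih _ => exact ih.trans (Nat.le_add_right _ _)
  | loop x y c ih => exact Nat.mul_pos (hG y) ih

/-- The cost of a command is its weight, up to a polynomial factor. -/
theorem dom_cost (hw : Dom N w fun _ => 1) {β G : ι → ℕ → ℕ} (hG : ∀ p y, 1 ≤ G p y)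
    (hβ : ∀ p y, β p y ≤ (N p + 1) * G p y) (c : Cmd) :
    Dom N (fun p => c.cost (w p) (β p)) fun p => c.weight (G p) := by
  have h1 : Dom N (fun p => 1 + w p) fun _ => 1 := (Dom.const 1).add hw
  induction c with
  | skip => exact .const 1
  | assign x e => exact (dom_exprCost hw e).add h1
  | put j i e =>
    have hb := dom_bits hw i
    exact (dom_exprCost hw e).add ((dom_exprCost hw i).add ((dom_addrCost hw hb).add
      (((Dom.const 1).add ((hb.add hw).add (.const 11))).add hw)))
  | input x e =>
    exact (dom_exprCost hw e).add (((Dom.const 1).add (dom_bits hw e)).add hw)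
  | seq c d ihc ihd =>
    exact (ihc.mono fun p => Nat.le_add_right _ _).add (ihd.mono fun p => Nat.le_add_left _ _)
  | ite e c d ihc ihd =>
    have hpos : ∀ p, 1 ≤ (ite e c d).weight (G p) := fun p => one_le_weight (hG p) _
    exact ((dom_exprCost hw e).of_one hpos).add ((((Dom.const 1).add (dom_bits hw e)).of_one
      hpos).add ((ihc.mono fun p => Nat.le_add_right _ _).add
        (ihd.mono fun p => Nat.le_add_left _ _)))
  | loop x y c ih =>
    have hpos : ∀ p, 1 ≤ (loop x y c).weight (G p) := fun p => one_le_weight (hG p) _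
    have hc : ∀ p, 1 ≤ c.weight (G p) := fun p => one_le_weight (hG p) _
    have hy : Dom N (fun p => β p y) fun p => G p y := ⟨1, 1, fun p => by simpa using hβ p y⟩
    exact ((Dom.const 1).of_one hpos).add (((h1.mul_one h1).of_one hpos).add
      ((hy.mul ((h1.of_one hc).add (ih.add (((Dom.const 2).add ((h1.mul_one (.const 2)).add
        (h1.mul_one h1))).of_one hc)))).add ((Dom.const 1).of_one hpos)))

end

/-- The number of bits of all values in the computation. -/
def width (D n : ℕ) : ℕ := n * n + n + 1 + (D + 2) ^ 2

theorem dom_width (D : ℕ) {ι : Type} (N : ι → ℕ) : Dom N (fun p => width D (N p)) fun _ => 1 := by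
  refine ⟨2 + (D + 2) ^ 2, 2, fun p => ?_⟩
  have : (D + 2) ^ 2 * 1 ≤ (D + 2) ^ 2 * (N p + 1) ^ 2 :=
    Nat.mul_le_mul_left _ (Nat.one_le_pow _ _ (by omega))
  simp only [width]
  rw [add_mul]
  nlinarith

/-- Bounds for the limits of loops in the second part of the computation. -/
def searchBound (n b l : ℕ) (y : ℕ) : ℕ :=
  if y = 22 ∨ y = 34 then 2 ^ b else if y = 25 ∨ y = 26 then l else n

theorem exists_setup_cost_le (D q M : ℕ) : ∃ K m : ℕ, ∀ n : ℕ,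
    (setup D q M).cost (width D n) (fun _ => n + (D + 1)) ≤ K * (n + 1) ^ m := by
  obtain ⟨K, m, h⟩ := dom_cost (N := id) (dom_width D id) (β := fun n _ => n + (D + 1))
    -- All limits are at most n + D + 1 ≤ (n + 1)(D + 1), so the weight of the setup is a constant.
    (G := fun _ _ => D + 1) (fun _ _ => by omega) (fun n _ => by simp only [id]; nlinarith)
    (setup D q M)
  refine ⟨K * (setup D q M).weight fun _ => D + 1, m, fun n => (h n).trans (le_of_eq ?_)⟩
  simp only [id]
  ring

/-- Only the lists of sets `T` (limits `22`, `34`) and of sets `X` (limits `25`, `26`) are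
exponentially long. No loop over a list is nested in another of the same kind, so the weight is a
linear combination of 1, 2^b, l + 1 and their product. -/
theorem exists_search_cost_le (D : ℕ) : ∃ K m : ℕ, ∀ n b l : ℕ,
    (search D).cost (width D n) (searchBound n b l) ≤ K * (n + 1) ^ m * (2 ^ b * (l + 1)) := by
  obtain ⟨K, m, h⟩ := dom_cost (N := fun p : ℕ × ℕ × ℕ => p.1) (dom_width D _)
    (β := fun p => searchBound p.1 p.2.1 p.2.2)
    (G := fun p y => if y = 22 ∨ y = 34 then 2 ^ p.2.1 else if y = 25 ∨ y = 26 then p.2.2 + 1 else 1)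
    (fun p y => by
      split_ifs
      exacts [Nat.one_le_two_pow, by omega, le_rfl])
    (fun p y => by
      dsimp only [searchBound]
      split_ifs <;> nlinarith [Nat.zero_le (2 ^ p.2.1)])
    (search D)
  refine ⟨K * 1000, m, fun n b l => (h (n, b, l)).trans ?_⟩
  have hb : 1 ≤ 2 ^ b := Nat.one_le_two_pow
  -- The constant 1000 is a generous bound for the sum of the coefficients. Taking `l + 1` instead
  -- of `l` makes the product dominate the other terms even for `l = 0`.
  have e : ∀ G : ℕ → ℕ, G 1 = 1 → G 22 = 2 ^ b → G 34 = 2 ^ b → G 25 = l + 1 → G 26 = l + 1 →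
      (search D).weight G ≤ 1000 * (2 ^ b * (l + 1)) := by
    intro G h1 h22 h34 h25 h26
    simp only [search, searchOne, listSets, subsetTest, avoidTest, freeTest, initTables, tryColors,
      checkSets, transform, forEach, indepTest, Cmd.weight, h1, h22, h34, h25, h26]
    generalize 2 ^ b = P at *
    have : 1 ≤ l + 1 := by omega
    generalize l + 1 = L at *
    have e1 : P ≤ P * L := Nat.le_mul_of_pos_right _ this
    have e2 : L ≤ P * L := Nat.le_mul_of_pos_left _ hb
    ring_nf
    omega
  calc K * (n + 1) ^ m * (search D).weight _
      ≤ K * (n + 1) ^ m * (1000 * (2 ^ b * (l + 1))) :=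
        Nat.mul_le_mul_left _ (e _ (by simp) (by simp) (by simp) (by simp) (by simp))
    _ = K * 1000 * (n + 1) ^ m * (2 ^ b * (l + 1)) := by ring

end RAM

/-! ### From graphs to relations on natural numbers, and the whole run. -/

namespace RAM
open RAM.Expr RAM.Cmd

section

variable {n : ℕ} (G : SimpleGraph (Fin n))

/-- Adjacency in a graph on `{0, …, n - 1}`, as a relation on natural numbers. -/
def adjRel (u v : ℕ) : Prop := ∃ (hu : u < n) (hv : v < n), G.Adj ⟨u, hu⟩ ⟨v, hv⟩

theorem colorableBelow_adjRel {k : ℕ} : ColorableBelow (adjRel G) n k ↔ G.Colorable k := by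
  constructor
  · rintro ⟨c, hc, hp⟩
    exact ⟨SimpleGraph.Coloring.mk (fun v => (⟨c v, hc v v.2⟩ : Fin k)) fun {u v} h he =>
      hp u u.2 v v.2 ⟨u.2, v.2, h⟩ (by simpa using he)⟩
  · rintro ⟨c⟩
    refine ⟨fun u => if h : u < n then c ⟨u, h⟩ else 0, fun u hu => ?_, fun u hu v hv hR he => ?_⟩
    · simp [hu]
    · obtain ⟨_, _, h⟩ := hR
      simp only [hu, hv, dif_pos] at he
      exact c.valid h (Fin.ext he)

theorem chromaticNumber_eq {k : ℕ} (hk : ColorableBelow (adjRel G) n k)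
    (hmin : ∀ l, ColorableBelow (adjRel G) n l → k ≤ l) : G.chromaticNumber = (k : ℕ∞) := by
  simp only [colorableBelow_adjRel] at hk hmin
  refine le_antisymm (SimpleGraph.chromaticNumber_le_iff_colorable.2 hk) ?_
  exact le_iInf₂ fun l hl => by exact_mod_cast hmin l hl

theorem card_nbrs_adjRel [DecidableRel G.Adj] (v : Fin n) :
    #(nbrs (adjRel G) n v) = G.degree v := by
  classical
  rw [← G.card_neighborFinset_eq_degree, ← card_map Fin.valEmbedding]
  congr 1
  ext u
  refine mem_filter.trans ?_
  simp only [adjRel, mem_range, mem_map, SimpleGraph.mem_neighborFinset, Fin.valEmbedding_apply]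
  constructor
  · rintro ⟨hu, _, _, h⟩
    exact ⟨⟨u, hu⟩, h, rfl⟩
  · rintro ⟨w, h, rfl⟩
    exact ⟨w.2, v.2, w.2, h⟩

variable [DecidableRel G.Adj]

theorem graphInput_mem {u v : ℕ} (hu : u < n) (hv : v < n) [Decidable (adjRel G u v)] :
    (graphInput G).mem (u * n + v) = if adjRel G u v then 1 else 0 := by
  refine if_congr ⟨?_, ?_⟩ rfl rfl
  · rintro ⟨i, j, h, hG⟩
    have e : ∀ a b : ℕ, b < n → (a * n + b) / n = a ∧ (a * n + b) % n = b := fun a b hb => by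
      rw [mul_comm, Nat.mul_add_div (by omega), Nat.mul_add_mod, Nat.div_eq_of_lt hb,
        Nat.mod_eq_of_lt hb]
      simp
    have h1 := e u v hv
    have h2 := e i j j.2
    rw [h] at h1
    obtain rfl : (i : ℕ) = u := h2.1.symm.trans h1.1
    obtain rfl : (j : ℕ) = v := h2.2.symm.trans h1.2
    exact ⟨hu, hv, hG⟩
  · rintro ⟨hu, hv, hG⟩
    exact ⟨⟨u, hu⟩, ⟨v, hv⟩, rfl, hG⟩

/-- The parameters of the computation on a graph. -/
def graphCtx (D : ℕ) (β : ℕ → ℕ) : Ctx where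
  inp := (graphInput G).mem
  base := n * n
  w := width D n
  bound := β
  base_lt := Nat.lt_two_pow_self.trans_le (Nat.pow_le_pow_right (by norm_num)
    (by simp only [width]; omega))
  inp_lt i := by
    have : 1 < 2 ^ width D n := Nat.one_lt_two_pow (by simp only [width]; omega)
    simp only [graphInput]
    split_ifs <;> omega

theorem setting_graphCtx (D : ℕ) {β : ℕ → ℕ} (hβ : n ≤ β 1) :
    Setting (graphCtx G D β) (adjRel G) n D where
  base := rfl
  inp_of_rel u hu v hv h := by
    classical
    exact (graphInput_mem G hu hv).trans (if_pos h)
  inp_of_not_rel u hu v hv h := by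
    classical
    exact (graphInput_mem G hu hv).trans (if_neg h)
  large := by
    simp only [graphCtx, width]
    rw [pow_add _ (n * n + n + 1), mul_comm]
    exact Nat.mul_lt_mul_of_pos_left Nat.lt_two_pow_self (by positivity)
  bound := hβ

/-- The initial environment. -/
def initEnv (n : ℕ) : Env := ⟨fun x => if x = 0 then n else 0, fun _ _ => 0⟩

theorem rel_initEnv (D : ℕ) (β : ℕ → ℕ) :
    Rel (graphCtx G D β) (initEnv n) ((graphInput G).setReg 1 (n * n)) where
  base := by simp [State.setReg, graphCtx]
  var x := by
    simp [State.setReg, graphInput, initEnv]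
  inp i _ := rfl
  arr j i := by
    refine if_neg ?_
    rintro ⟨u, v, h, -⟩
    have h1 : (u : ℕ) * n + v < u * n + n := Nat.add_lt_add_left v.2 _
    have h2 : ((u : ℕ) + 1) * n ≤ n * n := Nat.mul_le_mul_right _ u.2
    have h3 : ((u : ℕ) + 1) * n = u * n + n := by ring
    simp only [graphCtx] at h
    omega
  var_lt x := by
    simp only [initEnv]
    split_ifs
    · refine Nat.lt_two_pow_self.trans_le (Nat.pow_le_pow_right (by norm_num) ?_)
      simp only [graphCtx, width]
      omega
    · positivity
  arr_lt _ _ := by simp [initEnv]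

/-- The program for the chromatic number. -/
def chromaticProg (D q M : ℕ) : Prog :=
  .seq (.arith .mul 1 0 0) (.seq (setup D q M).compile (search D).compile)

/-- Correctness of the program, with a bound for its cost. -/
theorem exec_chromaticProg {D q M : ℕ} {f : ℝ} (hlow : 0 < n → ∀ B ⊆ range n,
      q * #B + n ≤ ((D + 1) * M + D + 2) ^ (D + 1) * n →
        ∃ y < n, y ∉ B ∧ #(nbrs (adjRel G) n y) ≤ D)
    {K m : ℕ} (hK : ∀ b l : ℕ,
      (search D).cost (width D n) (searchBound n b l) ≤ K * (n + 1) ^ m * (2 ^ b * (l + 1)))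
    (hf : ∀ A B, Suitable (adjRel G) n D q M A B → ∃ l : ℕ, (2 ^ #B * (l + 1) : ℝ) ≤ f ∧
      ∀ T ⊆ B, #A ≤ #(freeOf (adjRel G) A T) * (D + 1) →
        (subsetList (Avoids (adjRel G) n B (freeOf (adjRel G) A T)) n).length ≤ l) :
    ComputesChromaticNumber (chromaticProg D q M) G ((n + 1) ^ 2 +
      (setup D q M).cost (width D n) (fun _ => n + (D + 1)) + K * (n + 1) ^ m * f) := by
  have hS := setting_graphCtx G D (β := fun _ => n + (D + 1)) (by omega)
  obtain ⟨T, σ, s, hE, hT, hr, hR, A, B, h8, h9, h10, hAB⟩ := compile_spec (setup D q M)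
    (wp_setup (s := initEnv n) hS (by simp [initEnv]) (by simp [graphCtx]) hlow)
    (rel_initEnv G D _)
  obtain ⟨l, hl, hlen⟩ := hf A B hAB
  -- The loop limits of the search depend on the set `B` just found. A second context with the same
  -- width and input is used, and `Rel` does not mention the limits.
  have hS' := setting_graphCtx G D (β := searchBound n #B l) (by simp [searchBound])
  have hr' : Rel (graphCtx G D (searchBound n #B l)) s σ :=
    ⟨hr.base, hr.var, hr.inp, hr.arr, hr.var_lt, hr.arr_lt⟩
  obtain ⟨T', σ', s', hE', hT', hr'', hc, hmin⟩ := compile_spec (search D)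
    (wp_search hS' hR (fun u v ⟨hu, hv, h⟩ => ⟨hv, hu, h.symm⟩)
      (fun u ⟨_, _, h⟩ => G.loopless.irrefl _ h) hAB h8 h9 h10 (by simp [graphCtx, searchBound])
      (by simpa [graphCtx, searchBound] using hlen)) hr'
  have h0 : (graphInput G).reg 0 = n := rfl
  refine ⟨_, _, .seq (.arith _ _ _ _ _) (.seq hE hE'), ?_, ?_⟩
  · have hn : n.size ≤ n := Nat.size_le.2 Nat.lt_two_pow_self
    have e1 : Op.mul.cost n n ≤ (n + 1) ^ 2 :=
      (Op.cost_le .mul hn hn).trans (le_of_eq (by ring))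
    have e2 : (T' : ℝ) ≤ K * (n + 1) ^ m * (2 ^ #B * (l + 1)) := by
      exact_mod_cast hT'.trans (hK #B l)
    have e3 : (K * (n + 1) ^ m * (2 ^ #B * (l + 1)) : ℝ) ≤ K * (n + 1) ^ m * f := by gcongr
    have e4 : (T : ℝ) ≤ (setup D q M).cost (width D n) fun _ => n + (D + 1) := by exact_mod_cast hT
    have e5 : (Op.mul.cost n n : ℝ) ≤ (n + 1) ^ 2 := by exact_mod_cast e1
    rw [h0]
    push_cast
    linarith
  · rw [show σ'.reg 0 = s'.var 0 from hr''.var 0]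
    exact chromaticNumber_eq G hc hmin

end

end RAM

/-! ### The exponential saving and the choice of constants. -/

namespace RAM

section

variable {R : ℕ → ℕ → Prop} {n D q M : ℕ} {A B : Finset ℕ}

theorem length_avoids_mul_le (hAB : Suitable R n D q M A B) {F : Finset ℕ} (hF : F ⊆ A) :
    (subsetList (Avoids R n B F) n).length * (2 ^ (D + 1)) ^ #F ≤
      2 ^ n * (2 ^ (D + 1) - 1) ^ #F := by
  classical
  have h0 : Avoids R n B F ∅ := fun a ha h => notMem_empty a (h (self_mem_outerNbhd
    (mem_range.1 (hAB.subA (hF ha))) (disjoint_left.1 hAB.disj (hF ha))))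
  rw [length_subsetList h0 fun X Y hXY hY a ha h => hY a ha (h.trans hXY)]
  have h := card_avoiding_le F (outerNbhd R n B) (D + 1)
    (fun a ha => (card_outerNbhd_le a).trans (Nat.succ_le_succ (hAB.deg a (hF ha))))
    (hAB.pairwise.subset (coe_subset.2 hF)) (range n) fun a _ => outerNbhd_subset
  rw [card_range] at h
  convert h using 4
  rfl

/-- For suitable sets `A` and `B` the lists in the search are short. -/
theorem two_pow_mul_length_le (hAB : Suitable R n D q M A B) {ρ σ : ℝ} (hρ : 0 ≤ ρ) (hρ1 : ρ ≤ 1)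
    (hσ : 0 ≤ σ) (hσ1 : σ ≤ 1) (hθ : 1 - 1 / 2 ^ (D + 1) ≤ ρ ^ (D + 1)) (hρσ : ρ ≤ σ ^ q)
    (hM : ρ ^ M ≤ 1 / 2) (hq : 0 < q) {F : Finset ℕ} (hF : F ⊆ A) (hFA : #A ≤ #F * (D + 1)) :
    2 ^ #B * ((subsetList (Avoids R n B F) n).length : ℝ) ≤ (2 * σ) ^ n := by
  set l := (subsetList (Avoids R n B F) n).length
  have h2 : (1 : ℝ) ≤ 2 ^ (D + 1) := one_le_pow₀ (by norm_num)
  have h1 : (l : ℝ) * (2 ^ (D + 1)) ^ #F ≤ 2 ^ n * (2 ^ (D + 1) - 1) ^ #F := by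
    have h := length_avoids_mul_le hAB hF
    have e : ((2 ^ (D + 1) - 1 : ℕ) : ℝ) = 2 ^ (D + 1) - 1 := by
      rw [Nat.cast_sub Nat.one_le_two_pow]
      simp
    rw [← e]
    exact_mod_cast h
  have h3 : (l : ℝ) ≤ 2 ^ n * (1 - 1 / 2 ^ (D + 1)) ^ #F := by
    have e : (2 ^ (D + 1) - 1 : ℝ) = (1 - 1 / 2 ^ (D + 1)) * 2 ^ (D + 1) := by field_simp
    rw [e, mul_pow, ← mul_assoc] at h1
    exact le_of_mul_le_mul_right h1 (by positivity)
  -- `d` is the surplus of |A| over M|B|, which is at least n/q.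
  obtain ⟨d, hd⟩ : ∃ d, #A = M * #B + d := Nat.exists_eq_add_of_le
    (Nat.le_of_mul_le_mul_left (by rw [← mul_assoc]; exact (Nat.le_add_right _ _).trans hAB.large) hq)
  have hqd : n ≤ q * d := by
    have h := hAB.large
    rw [hd, mul_add, ← mul_assoc] at h
    omega
  -- The saving is at least that of a factor `ρ` per vertex of `A`. `M` of these vertices offset one
  -- vertex of `B`, since ρ^M ≤ 1/2, and the surplus `d` yields σ^n.
  have h4 : (1 - 1 / 2 ^ (D + 1) : ℝ) ^ #F ≤ (1 / 2) ^ #B * σ ^ n :=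
    calc (1 - 1 / 2 ^ (D + 1) : ℝ) ^ #F ≤ (ρ ^ (D + 1)) ^ #F :=
          pow_le_pow_left₀ (sub_nonneg.2 ((div_le_one (by positivity)).2 h2)) hθ _
      _ = ρ ^ (#F * (D + 1)) := by rw [← pow_mul, mul_comm]
      _ ≤ ρ ^ #A := pow_le_pow_of_le_one hρ hρ1 hFA
      _ = (ρ ^ M) ^ #B * ρ ^ d := by rw [hd, pow_add, pow_mul]
      _ ≤ (1 / 2) ^ #B * (σ ^ q) ^ d := by gcongr
      _ = (1 / 2) ^ #B * σ ^ (q * d) := by rw [pow_mul]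
      _ ≤ (1 / 2) ^ #B * σ ^ n :=
          mul_le_mul_of_nonneg_left (pow_le_pow_of_le_one hσ hσ1 hqd) (by positivity)
  calc 2 ^ #B * (l : ℝ) ≤ 2 ^ #B * (2 ^ n * ((1 / 2) ^ #B * σ ^ n)) := by
        gcongr
        exact h3.trans (by gcongr)
    _ = (2 * (1 / 2)) ^ #B * (2 * σ) ^ n := by rw [mul_pow, mul_pow]; ring
    _ = (2 * σ) ^ n := by norm_num

/-- One `l` has to serve all `T`, and the summand 1 costs an extra 2^|B|. This is at most (2σ)^n by
the estimate for `F = A`, because that list contains the empty set. -/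
theorem exists_length_bound (hAB : Suitable R n D q M A B) {ρ σ : ℝ} (hρ : 0 ≤ ρ) (hρ1 : ρ ≤ 1)
    (hσ : 0 ≤ σ) (hσ1 : σ ≤ 1) (hθ : 1 - 1 / 2 ^ (D + 1) ≤ ρ ^ (D + 1)) (hρσ : ρ ≤ σ ^ q)
    (hM : ρ ^ M ≤ 1 / 2) (hq : 0 < q) :
    ∃ l : ℕ, (2 ^ #B * (l + 1) : ℝ) ≤ 2 * (2 * σ) ^ n ∧
      ∀ T ⊆ B, #A ≤ #(freeOf R A T) * (D + 1) →
        (subsetList (Avoids R n B (freeOf R A T)) n).length ≤ l := by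
  have key := fun F hF hFA => two_pow_mul_length_le hAB hρ hρ1 hσ hσ1 hθ hρσ hM hq (F := F) hF hFA
  have hpos : (0 : ℝ) < 2 ^ #B := by positivity
  refine ⟨⌊(2 * σ) ^ n / 2 ^ #B⌋₊, ?_, fun T _ hT => Nat.le_floor ?_⟩
  · have h1 := Nat.floor_le (a := (2 * σ) ^ n / 2 ^ #B) (by positivity)
    rw [le_div_iff₀ hpos] at h1
    have h2 : (1 : ℝ) ≤ ((subsetList (Avoids R n B A) n).length : ℝ) := by
      exact_mod_cast length_subsetList_mono (P := Avoids R n B A) (Nat.zero_le n)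
    have h3 := key A subset_rfl (Nat.le_mul_of_pos_right _ (by omega))
    nlinarith
  · rw [le_div_iff₀ hpos, mul_comm]
    exact key _ (fun a ha => by simp only [freeOf, mem_filter] at ha; exact ha.1) hT

end

/-- Otherwise `B` contains all low vertices, so |B| ≥ αn and q|B| + n ≥ Hn + n > Hn. -/
theorem exists_low_vertex {n : ℕ} (G : SimpleGraph (Fin n)) [DecidableRel G.Adj] {α Δ : ℝ}
    (hG : G.IsAlphaDeltaBounded α Δ) {q H : ℕ} (hq : H ≤ q * α) (hn : 0 < n)
    {B : Finset ℕ} (hB : q * #B + n ≤ H * n) :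
    ∃ y < n, y ∉ B ∧ #(nbrs (adjRel G) n y) ≤ ⌊Δ⌋₊ := by
  by_contra! hc
  have h1 : #{v : Fin n | (G.degree v : ℝ) ≤ Δ} ≤ #B := by
    rw [← card_map Fin.valEmbedding]
    refine card_le_card fun u hu => ?_
    obtain ⟨v, hv, rfl⟩ := mem_map.1 hu
    by_contra hvB
    have := hc v v.2 hvB
    rw [card_nbrs_adjRel] at this
    exact absurd (Nat.le_floor (mem_filter.1 hv).2) (not_le.2 this)
  have h2 : α * n ≤ #B := by
    have h : α * (Fintype.card (Fin n) : ℝ) ≤ (#{v : Fin n | (G.degree v : ℝ) ≤ Δ} : ℝ) := hG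
    rw [Fintype.card_fin] at h
    exact h.trans (by exact_mod_cast h1)
  have h3 : (q * #B + n : ℝ) ≤ H * n := by exact_mod_cast hB
  have h4 : (0 : ℝ) < n := by exact_mod_cast hn
  have h5 : (0 : ℝ) ≤ q := Nat.cast_nonneg q
  nlinarith [mul_le_mul_of_nonneg_left h2 h5, mul_le_mul_of_nonneg_right hq h4.le]

/-- Bernoulli's inequality for y = 1 - δ with (k + 1)δ ≤ 1 - x. -/
theorem exists_pow_ge {x : ℝ} (hx : x < 1) (k : ℕ) : ∃ y : ℝ, 1 / 2 ≤ y ∧ y < 1 ∧ x ≤ y ^ k := by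
  have hk : (0 : ℝ) < k + 1 := by positivity
  set δ := min (1 / 2) ((1 - x) / (k + 1)) with hδ
  have h1 : 0 < δ := lt_min (by norm_num) (div_pos (by linarith) hk)
  have h2 : δ ≤ 1 / 2 := min_le_left _ _
  have h3 : δ * (k + 1) ≤ 1 - x := (le_div_iff₀ hk).1 (min_le_right _ _)
  have h4 := one_add_mul_le_pow (a := -δ) (by linarith) k
  exact ⟨1 + -δ, by linarith, by linarith, by linarith⟩

theorem exists_poly_mul_pow_le (K m : ℕ) {r s : ℝ} (hr : 0 < r) (hrs : r < s) :
    ∃ C : ℝ, ∀ n : ℕ, K * ((n : ℝ) + 1) ^ m * r ^ n ≤ C * s ^ n := by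
  have hs := hr.trans hrs
  have ht : 0 < r / s := div_pos hr hs
  have h := tendsto_pow_const_mul_const_pow_of_abs_lt_one m (r := r / s)
    (by rw [abs_of_pos ht]; exact (div_lt_one hs).2 hrs)
  obtain ⟨c, hc⟩ := h.bddAbove_range
  refine ⟨K * (c / (r / s)), fun n => ?_⟩
  -- The bounded sequence n^m (r/s)^n is taken at n + 1, which costs one factor r/s.
  have h1 : ((n : ℝ) + 1) ^ m * (r / s) ^ (n + 1) ≤ c := by
    have := hc ⟨n + 1, rfl⟩
    simpa using this
  have h2 : ((n : ℝ) + 1) ^ m * (r / s) ^ n ≤ c / (r / s) := by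
    rw [le_div_iff₀ ht]
    rw [pow_succ] at h1
    linarith
  calc K * ((n : ℝ) + 1) ^ m * r ^ n = K * (((n : ℝ) + 1) ^ m * (r / s) ^ n) * s ^ n := by
        rw [div_pow]
        field_simp
    _ ≤ K * (c / (r / s)) * s ^ n := by gcongr

end RAM

open RAM in
theorem theorem1 (Δ α : ℝ) (hΔ : 0 < Δ) (hα : 0 < α) :
    ∃ ε : ℝ, 0 < ε ∧ ε < 1 ∧
      ∃ (p : RAM.Prog) (C : ℝ),
        ∀ (n : ℕ) (G : SimpleGraph (Fin n)) [DecidableRel G.Adj],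
          G.IsAlphaDeltaBounded α Δ →
            RAM.ComputesChromaticNumber p G (C * (2 - ε) ^ n) := by
  set D := ⌊Δ⌋₊
  -- A free vertex saves a factor `1 - 1 / 2 ^ (D + 1)`. As few as one in `D + 1` vertices of `A`
  -- may be free, so `ρ` is the saving per vertex of `A`.
  obtain ⟨ρ, hρ0, hρ1, hθ⟩ := exists_pow_ge (x := 1 - 1 / 2 ^ (D + 1))
    (sub_lt_self _ (by positivity)) (D + 1)
  obtain ⟨M, hM⟩ := exists_pow_lt_of_lt_one (show (0 : ℝ) < 1 / 2 by norm_num) hρ1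
  set H := ((D + 1) * M + D + 2) ^ (D + 1) with hH
  -- `H` bounds the growth of the potential over `D + 1` rounds. With `H ≤ q * α` the set `B` cannot
  -- absorb all low vertices.
  obtain ⟨q, hq⟩ := exists_nat_ge ((H : ℝ) / α)
  rw [div_le_iff₀ hα] at hq
  have hq0 : 0 < q := by
    rcases Nat.eq_zero_or_pos q with rfl | h
    · have : 0 < H := by positivity
      have : (0 : ℝ) < H := by exact_mod_cast this
      simp only [Nat.cast_zero, zero_mul] at hq
      linarith
    · exact h
  obtain ⟨σ, hσ0, hσ1, hρσ⟩ := exists_pow_ge hρ1 q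
  obtain ⟨K₁, m₁, hK₁⟩ := exists_setup_cost_le D q M
  obtain ⟨K₂, m₂, hK₂⟩ := exists_search_cost_le D
  -- The gap between 2σ and 1 + σ = 2 - ε, where ε = 1 - σ, absorbs the polynomial factors.
  have hσ : 2 * σ < 2 - (1 - σ) := by linarith
  obtain ⟨C₀, hC₀⟩ := exists_poly_mul_pow_le 1 2 (by linarith) hσ
  obtain ⟨C₁, hC₁⟩ := exists_poly_mul_pow_le K₁ m₁ (by linarith) hσ
  obtain ⟨C₂, hC₂⟩ := exists_poly_mul_pow_le K₂ m₂ (by linarith) hσ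
  refine ⟨1 - σ, by linarith, by linarith, chromaticProg D q M, C₀ + C₁ + 2 * C₂,
    fun n G _ hG => ?_⟩
  obtain ⟨t, s, hE, ht, hs⟩ := exec_chromaticProg G
    (fun hn B _ hB => exists_low_vertex G hG hq hn hB) (hK₂ n)
    fun A B hAB => exists_length_bound hAB (by linarith) hρ1.le (by linarith) hσ1.le hθ hρσ hM.le hq0
  refine ⟨t, s, hE, ht.trans ?_, hs⟩
  -- Since σ ≥ 1/2, the polynomial costs outside the search are covered by the exponential bound as
  -- well.
  have h1 : (1 : ℝ) ≤ (2 * σ) ^ n := one_le_pow₀ (by linarith)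
  have h2 : ((setup D q M).cost (width D n) (fun _ => n + (D + 1)) : ℝ) ≤
      K₁ * ((n : ℝ) + 1) ^ m₁ := by exact_mod_cast hK₁ n
  have h3 := le_mul_of_one_le_right (a := ((n : ℝ) + 1) ^ 2) (by positivity) h1
  have h4 := le_mul_of_one_le_right (a := K₁ * ((n : ℝ) + 1) ^ m₁) (by positivity) h1
  have e₀ := hC₀ n
  have e₁ := hC₁ n
  have e₂ := hC₂ n
  rw [Nat.cast_one, one_mul] at e₀
  linarith
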